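/- Let $\alpha\in(0,2]$, $d\ge 1$, $m\ge 0$, and let $X=(X_t)_{t\ge0}$ be a $d$-dimensional Lévy process on a filtered probability space $(\Omega,\mathcal F,(\mathcal F_t)_{t\ge0},\mathbb P)$ whose components are i.i.d. symmetric $\alpha$-stable processes, i.e. for some $c>0$, $\mathbb E[e^{\mathbf i\beta X^{(\ell)}_t}]=e^{-tc|\beta|^\alpha}$ for all $\ell$, $t\ge 0$, $\beta\in\mathbb R$. Put $a_n=n^{1/\alpha}$. Let $g:\mathbb R^d\times(\mathbb R^{d})^{m+1}\to\mathbb R$, $(x,y)\mapsto g(x,y)$, be Borel measurable and twice continuously differentiable in $x$, with $g$, $\partial g/\partial x_i$ and $\partial^2 g/\partial x_i\partial x_j$ bounded for all $1\le i,j\le d$. For $n\ge1$ and $t>0$ define $$\mathcal I_{i,n}=\big(a_n(X_{\frac in}-X_{\frac{i-1}n}),\dots,a_n(X_{\frac{i+m}n}-X_{\frac{i+m-1}n})\big),$$ $$Z^{(n)}_t=\frac1{\sqrt n}\sum_{i=1}^{\lfloor nt\rfloor}\Big(g(X_{\frac{i-1}n},\mathcal I_{i,n})-\mathbb E\big[g(X_{\frac{i-1}n},\mathcal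 I_{i,n})\,\big|\,\mathcal F_{\frac{i-1}n}\big]\Big),$$ $$\mathfrak g_n(x)=\sum_{j=-m}^m\mathrm{Cov}\big(g(x,\xi_1,\dots,\xi_{m+1}),\,g(x,\xi_{j+1},\dots,\xi_{j+m+1})\big),$$ where $\xi_{1-m},\dots,\xi_{2m+1}$ are independent copies of $a_nX_{1/n}$. For probability measures $\mu,\nu$ on $\mathbb R$ let $d(\mu,\nu)=\sup_\psi|\int\psi\,d\mu-\int\psi\,d\nu|$, the supremum being over all $\psi\in C^5(\mathbb R)$ with $\|\psi^{(l)}\|_\infty\le1$ for $l=0,\dots,5$; for random variables, $d$ is the distance of their laws. Then $\mathfrak g(x)=\lim_n\mathfrak g_n(x)$ exists and is nonnegative for every $x\in\mathbb R^d$, so that $A_s=\mathfrak g(X_s)$ and $\sqrt{A_s}$ are well defined. Moreover, on an extension of the filtered probability space, there exists a standard Brownian motion $W$ independent of $X$ such that the Itô integrals $\int_0^t\sqrt{A_s}\,dW_s$ exist and, for every $t>0$, there is a constant $C>0$ not depending on $n$ with: 1. if $\alpha\in(1,2)$, then $d\big(Z^{(n)}_t,\int_0^t\sqrt{A_s}\,dW_s\big)\le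 C\,n^{\frac12-\frac1\alpha}$ for all $n\ge1$; 2. if $\alpha=1$, then $d\big(Z^{(n)}_t,\int_0^t\sqrt{A_s}\,dW_s\big)\le \frac{C}{\sqrt n}\log n$ for all $n\ge2$; 3. if $\alpha\in(0,1)$, then $d\big(Z^{(n)}_t,\int_0^t\sqrt{A_s}\,dW_s\big)\le \frac{C}{\sqrt n}$ for all $n\ge1$; 4. if $\alpha\in(1,2]$ and $g(x,-y)=g(x,y)$ for all $x,y$, then $d\big(Z^{(n)}_t,\int_0^t\sqrt{A_s}\,dW_s\big)\le \frac{C}{\sqrt n}$ for all $n\ge1$. -/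

import Mathlib

open MeasureTheory ProbabilityTheory Filter Topology
open scoped NNReal ENNReal

universe u

noncomputable section

namespace HighFreq

/-! ### Lévy processes and symmetric stable processes -/

/-- The path `x` is right-continuous with left limits. -/
def IsCadlagPath {E : Type*} [TopologicalSpace E] (x : ℝ≥0 → E) : Prop :=
  ∀ t : ℝ≥0, ContinuousWithinAt x (Set.Ici t) t ∧ ∃ l : E, Tendsto x (𝓝[<] t) (𝓝 l)

/-- `X` is a Lévy process on the filtered probability space `(Ω, 𝓕, P)`. -/
structure IsLevyProcess {Ω E : Type*} [mΩ : MeasurableSpace Ω] [NormedAddCommGroup E]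
    [MeasurableSpace E] (P : Measure Ω) (𝓕 : Filtration ℝ≥0 mΩ) (X : ℝ≥0 → Ω → E) : Prop where
  adapted : ∀ t, Measurable[𝓕 t] (X t)
  zero : ∀ᵐ ω ∂P, X 0 ω = 0
  indep_increments : ∀ s t : ℝ≥0, s ≤ t →
    Indep (MeasurableSpace.comap (fun ω => X t ω - X s ω) inferInstance) (𝓕 s) P
  stationary_increments : ∀ s h : ℝ≥0,
    P.map (fun ω => X (s + h) ω - X s ω) = P.map (X h)
  cadlag : ∀ᵐ ω ∂P, IsCadlagPath (fun t => X t ω)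

/-- The real random variables `Y t` satisfy `𝔼[exp(iβ Y_t)] = exp(t ψ(β))` for all `t` and `β`. -/
def HasLevyExponent {Ω : Type*} [MeasurableSpace Ω] (P : Measure Ω) (Y : ℝ≥0 → Ω → ℝ)
    (ψ : ℝ → ℂ) : Prop :=
  ∀ (t : ℝ≥0) (β : ℝ), charFun (P.map (Y t)) β = Complex.exp ((t : ℂ) * ψ β)

/-- A `d`-dimensional symmetric `α`-stable Lévy process with i.i.d. components: the components are
independent as processes, and each of them has the Lévy exponent `β ↦ -c |β| ^ α`, for the
same `c > 0`. For `α = 2` this is a multiple of `d`-dimensional Brownian motion. -/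
structure IsSymmetricStable {Ω : Type*} [mΩ : MeasurableSpace Ω] {d : ℕ} (P : Measure Ω)
    (𝓕 : Filtration ℝ≥0 mΩ) (α : ℝ) (X : ℝ≥0 → Ω → EuclideanSpace ℝ (Fin d)) : Prop where
  levy : IsLevyProcess P 𝓕 X
  indep_components : iIndepFun (fun (l : Fin d) (ω : Ω) (t : ℝ≥0) => X t ω l) P
  exponent : ∃ c : ℝ, 0 < c ∧ ∀ l : Fin d,
    HasLevyExponent P (fun t ω => X t ω l) (fun β => ((-(c * |β| ^ α) : ℝ) : ℂ))

/-! ### The statistic -/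

/-- The observation time `i / n`. -/
def gridTime (n i : ℕ) : ℝ≥0 := (i : ℝ≥0) / (n : ℝ≥0)

/-- The block of `m + 1` successive increments of mesh `1 / n`, normalised by `a n`, that starts at
time `i / n`. (With indices starting at `0`, it is the block usually numbered `i + 1`.) -/
def incrementBlock {Ω : Type*} {d : ℕ} (m : ℕ) (a : ℕ → ℝ)
    (X : ℝ≥0 → Ω → EuclideanSpace ℝ (Fin d)) (n i : ℕ) (ω : Ω) :
    Fin (m + 1) → EuclideanSpace ℝ (Fin d) :=
  fun k => a n • (X (gridTime n (i + k + 1)) ω - X (gridTime n (i + k)) ω)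

/-- One summand of the high-frequency statistic, before centring. -/
def summand {Ω : Type*} {d m : ℕ} (a : ℕ → ℝ)
    (g : EuclideanSpace ℝ (Fin d) → (Fin (m + 1) → EuclideanSpace ℝ (Fin d)) → ℝ)
    (X : ℝ≥0 → Ω → EuclideanSpace ℝ (Fin d)) (n i : ℕ) (ω : Ω) : ℝ :=
  g (X (gridTime n i) ω) (incrementBlock m a X n i ω)

/-- The normalised statistic `Z_t^(n)`, each summand being centred by its conditional expectation
given the past of the block. -/
def statZ {Ω : Type*} [mΩ : MeasurableSpace Ω] {d m : ℕ} (P : Measure Ω) (𝓕 : Filtration ℝ≥0 mΩ)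
    (a : ℕ → ℝ) (g : EuclideanSpace ℝ (Fin d) → (Fin (m + 1) → EuclideanSpace ℝ (Fin d)) → ℝ)
    (X : ℝ≥0 → Ω → EuclideanSpace ℝ (Fin d)) (n : ℕ) (t : ℝ≥0) (ω : Ω) : ℝ :=
  (Real.sqrt n)⁻¹ * ∑ i ∈ Finset.range ⌊(n : ℝ≥0) * t⌋₊,
    (summand a g X n i ω - (P[summand a g X n i | 𝓕 (gridTime n i)]) ω)

/-! ### The asymptotic conditional variance -/

/-- The function `𝔤_n`. The independent copies of `a_n X_{1/n}` are the coordinates of the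
product space; `ξ 0, …, ξ (3 * m)` stand for the copies numbered `1 - m, …, 2 * m + 1`, and the
summation index `k` stands for `j + m`, where `j` runs from `-m` to `m`. -/
def covFun {Ω : Type*} [MeasurableSpace Ω] {d m : ℕ} (P : Measure Ω)
    (a : ℕ → ℝ) (g : EuclideanSpace ℝ (Fin d) → (Fin (m + 1) → EuclideanSpace ℝ (Fin d)) → ℝ)
    (X : ℝ≥0 → Ω → EuclideanSpace ℝ (Fin d)) (n : ℕ) (x : EuclideanSpace ℝ (Fin d)) : ℝ :=
  ∑ k : Fin (2 * m + 1),
    covariance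
      (fun ξ : Fin (3 * m + 1) → EuclideanSpace ℝ (Fin d) =>
        g x (fun l : Fin (m + 1) => ξ ⟨m + l, by omega⟩))
      (fun ξ : Fin (3 * m + 1) → EuclideanSpace ℝ (Fin d) =>
        g x (fun l : Fin (m + 1) => ξ ⟨k + l, by omega⟩))
      (Measure.pi (fun _ : Fin (3 * m + 1) => P.map (fun ω => a n • X (gridTime n 1) ω)))

/-- The pointwise limit `𝔤` of the functions `𝔤_n`. -/
def limCovFun {Ω : Type*} [MeasurableSpace Ω] {d m : ℕ} (P : Measure Ω)
    (a : ℕ → ℝ) (g : EuclideanSpace ℝ (Fin d) → (Fin (m + 1) → EuclideanSpace ℝ (Fin d)) → ℝ)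
    (X : ℝ≥0 → Ω → EuclideanSpace ℝ (Fin d)) (x : EuclideanSpace ℝ (Fin d)) : ℝ :=
  limUnder atTop (fun n : ℕ => covFun P a g X n x)

/-! ### Conditions on `g` -/

/-- `g` is Borel, twice continuously differentiable in `x`, and `g`, `∂g/∂x_i` and
`∂²g/∂x_i∂x_j` are bounded. -/
structure IsAdmissible {d m : ℕ}
    (g : EuclideanSpace ℝ (Fin d) → (Fin (m + 1) → EuclideanSpace ℝ (Fin d)) → ℝ) : Prop where
  measurable : Measurable (Function.uncurry g)
  contDiff : ∀ y, ContDiff ℝ 2 (fun x => g x y)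
  bounded : ∃ K : ℝ, ∀ x y, |g x y| ≤ K
  bounded_fst : ∃ K : ℝ, ∀ (i : Fin d) (x) (y),
    |fderiv ℝ (fun z => g z y) x (EuclideanSpace.single i 1)| ≤ K
  bounded_snd : ∃ K : ℝ, ∀ (i j : Fin d) (x) (y),
    |iteratedFDeriv ℝ 2 (fun z => g z y) x
      ![EuclideanSpace.single i 1, EuclideanSpace.single j 1]| ≤ K

/-! ### The smooth distance -/

/-- Test functions: of class `C⁵`, with all derivatives of order `0, …, 5` bounded by `1`. -/
def testClass : Set (ℝ → ℝ) :=
  {ψ | ContDiff ℝ 5 ψ ∧ ∀ l : ℕ, l ≤ 5 → ∀ x : ℝ, |iteratedDeriv l ψ x| ≤ 1}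

/-- The smooth distance between two probability measures on `ℝ`. -/
def smoothDist (μ ν : Measure ℝ) : ℝ :=
  ⨆ ψ : testClass, |∫ x, ψ.1 x ∂μ - ∫ x, ψ.1 x ∂ν|

/-! ### Extensions, Brownian motion and the Itô integral -/

/-- `(Ω', 𝓖, P')` is an extension of the filtered probability space `(Ω, 𝓕, P)`, with
projection `π`: a random variable `Y` on `Ω` is identified with `Y ∘ π`. -/
structure IsFilteredExtension {Ω Ω' : Type*} [mΩ : MeasurableSpace Ω] [mΩ' : MeasurableSpace Ω']
    (P : Measure Ω) (𝓕 : Filtration ℝ≥0 mΩ) (P' : Measure Ω') (𝓖 : Filtration ℝ≥0 mΩ')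
    (π : Ω' → Ω) : Prop where
  measurePreserving : MeasurePreserving π P' P
  filtration_le : ∀ t, MeasurableSpace.comap π (𝓕 t) ≤ 𝓖 t

/-- `W` is a standard Brownian motion with respect to the filtration `𝓖`. -/
structure IsBrownianFor {Ω : Type*} [mΩ : MeasurableSpace Ω] (P : Measure Ω)
    (𝓖 : Filtration ℝ≥0 mΩ) (W : ℝ≥0 → Ω → ℝ) : Prop where
  brownian : IsBrownianReal W P
  adapted : ∀ t, Measurable[𝓖 t] (W t)
  indep_increments : ∀ s t : ℝ≥0, s ≤ t →
    Indep (MeasurableSpace.comap (fun ω => W t ω - W s ω) inferInstance) (𝓖 s) P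

/-- A simple predictable process `∑_{k < N} ξ_k 1_{(τ_k, τ_{k+1}]}` with deterministic times and
bounded `𝓖_{τ_k}`-measurable coefficients `ξ_k`. -/
structure SimpleProcess {Ω : Type*} [mΩ : MeasurableSpace Ω] (𝓖 : Filtration ℝ≥0 mΩ) where
  N : ℕ
  τ : ℕ → ℝ≥0
  ξ : ℕ → Ω → ℝ
  mono : Monotone τ
  measurable : ∀ k, Measurable[𝓖 (τ k)] (ξ k)
  bounded : ∃ K : ℝ, ∀ k ω, |ξ k ω| ≤ K

/-- The value of a simple process. -/
def SimpleProcess.value {Ω : Type*} [mΩ : MeasurableSpace Ω] {𝓖 : Filtration ℝ≥0 mΩ}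
    (S : SimpleProcess 𝓖) (s : ℝ≥0) (ω : Ω) : ℝ :=
  ∑ k ∈ Finset.range S.N, (Set.Ioc (S.τ k) (S.τ (k + 1))).indicator (fun _ => S.ξ k ω) s

/-- The elementary integral over `(0, t]` of a simple process against `W`. -/
def SimpleProcess.integral {Ω : Type*} [mΩ : MeasurableSpace Ω] {𝓖 : Filtration ℝ≥0 mΩ}
    (S : SimpleProcess 𝓖) (W : ℝ≥0 → Ω → ℝ) (t : ℝ≥0) (ω : Ω) : ℝ :=
  ∑ k ∈ Finset.range S.N, S.ξ k ω * (W (min (S.τ (k + 1)) t) ω - W (min (S.τ k) t) ω)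

/-- The random variable `I` is (a version of) the Itô integral `∫_0^t H_s dW_s`: the integrand is
an `L²([0,t] × Ω)`-limit of simple predictable processes whose elementary integrals converge
to `I` in `L²(P)`. By the Itô isometry, `I` is unique up to almost sure equality when `W` is a
Brownian motion with respect to `𝓖`. -/
structure IsItoIntegral {Ω : Type*} [mΩ : MeasurableSpace Ω] (P : Measure Ω)
    (𝓖 : Filtration ℝ≥0 mΩ) (W : ℝ≥0 → Ω → ℝ) (H : ℝ≥0 → Ω → ℝ) (t : ℝ≥0) (I : Ω → ℝ) :
    Prop where
  memLp_integrand :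
    MemLp (fun p : ℝ × Ω => H p.1.toNNReal p.2) 2
      ((volume.restrict (Set.Ioc 0 (t : ℝ))).prod P)
  memLp : MemLp I 2 P
  approx : ∃ S : ℕ → SimpleProcess 𝓖,
    Tendsto (fun k => eLpNorm
      (fun p : ℝ × Ω => (S k).value p.1.toNNReal p.2 - H p.1.toNNReal p.2) 2
      ((volume.restrict (Set.Ioc 0 (t : ℝ))).prod P)) atTop (𝓝 0) ∧
    Tendsto (fun k => eLpNorm (fun ω => (S k).integral W t ω - I ω) 2 P) atTop (𝓝 0)

end HighFreq

end

open HighFreq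

open HighFreq

set_option linter.unusedSectionVars false

/-! The statistic is a sum along a random walk. By self-similarity the normalised increments `y l`
are i.i.d. with the law `ν` of `X 1`, whatever `n ≥ 1` is (`map_smul_eq`, `map_scaledIncrement`). At
the grid times `X` is the walk with steps `(a n)⁻¹ • y l`, and by independence of increments the
conditional expectation of a summand is a function of the current position. Hence `statZ` is almost
surely `r ∑ h (x l) (y l, …, y (l + m))` with `r = n ^ (-1/2)` and `h` centred at every frozen
position (`statZ_ae_eq_partialSum`). For the same reason `covFun` does not depend on `n ≥ 1`: it is
`asympVar`, which is nonnegative because it is the growth rate of the variances of `m`-dependent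
partial sums.

On the limit side, the Brownian motion lives on an independent factor, so given `X` the stochastic
integral is Gaussian with variance `∫ A`. Its law is therefore tested by averaging `gaussSmooth f 0
(timeIntegral A t)` over `X` (`exists_isItoIntegral`). The integral itself is an `L²` limit of
dyadic step integrals, which converge geometrically because `(√a - √b) ^ 2 ≤ |a - b|` and `A` is
1/2-Hölder in the mean.

The two laws are compared by a Lindeberg argument (`abs_integral_partialSum_sub_le`). Let `S i` be
the partial sum, `V i` the sum of the local variances from `i` to the end, and `u = gaussSmooth f`.
The mean of `u (S i) (V i)` moves from the Gaussian mixture with variance `V 0` to the mean of `f (S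
N)` as `i` runs from `0` to `N`. Since `u` solves the heat equation, each step expands into a
first-order and a second-order term. Successive blocks overlap, so the derivatives of `u` are
evaluated at sums lagging by `m` and `2 m`; the second-order coefficient, frozen in space, then has
mean zero by the definition of `asympVar`.

What remains is a bias: `V` looks at the future of the walk, and the entries of the current block
translate all later positions. This keeps the first-order term from vanishing. It is at most a
multiple of `r` times the truncated mean `κ n` of `(a n)⁻¹ • y`, so all steps together contribute
`√n κ n` (`abs_integral_first_order_le`). When `h` is even in `y`, reflecting the block replaces the
first difference by a second difference, and `κ n` by the truncated second moment
(`abs_integral_first_order_le_of_even`).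

The truncated second moment is `O(1 / n)`, by pairing the stable characteristic function with a
Gaussian law (`integral_min_one_sq_le`). A dyadic decomposition deduces that `κ n` is of order `1 /
n`, `log n / n` or `n ^ (-1/α)` according to whether `α < 1`, `α = 1` or `1 < α`. Replacing the
Riemann sum `V 0` by the time integral costs a further `O(1 / √n)`. Together these give the four
rates. -/

/-- `f 0, …, f k` are successive derivatives, all bounded by `1`, and `f k` is continuous. -/
structure BoundedDerivs (k : ℕ) (f : ℕ → ℝ → ℝ) : Prop where
  hasDerivAt : ∀ l < k, ∀ x, HasDerivAt (f l) (f (l + 1) x) x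
  bound : ∀ l ≤ k, ∀ x, |f l x| ≤ 1
  continuous_top : Continuous (f k)

namespace BoundedDerivs

variable {k : ℕ} {f : ℕ → ℝ → ℝ}

lemma continuous (h : BoundedDerivs k f) {l : ℕ} (hl : l ≤ k) : Continuous (f l) := by
  rcases hl.eq_or_lt with rfl | hl
  · exact h.continuous_top
  · exact continuous_iff_continuousAt.2 fun x => (h.hasDerivAt l hl x).continuousAt

lemma mono (h : BoundedDerivs k f) {j : ℕ} (hj : j ≤ k) : BoundedDerivs j f :=
  ⟨fun l hl => h.hasDerivAt l (hl.trans_le hj), fun l hl => h.bound l (hl.trans hj),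
    h.continuous hj⟩

lemma shift (h : BoundedDerivs k f) {i j : ℕ} (hj : j + i ≤ k) :
    BoundedDerivs j (fun l => f (l + i)) where
  hasDerivAt l hl x := by
    have := h.hasDerivAt (l + i) (by omega) x
    rwa [show l + i + 1 = l + 1 + i by omega] at this
  bound l hl := h.bound _ (by omega)
  continuous_top := h.continuous hj

end BoundedDerivs

lemma testClass.boundedDerivs {ψ : ℝ → ℝ} (hψ : ψ ∈ testClass) :
    BoundedDerivs 5 (fun l => iteratedDeriv l ψ) where
  hasDerivAt l hl x := by
    have h := hψ.1.differentiable_iteratedDeriv l (by exact_mod_cast hl)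
    simpa [iteratedDeriv_succ] using (h x).hasDerivAt
  bound := hψ.2
  continuous_top := hψ.1.continuous_iteratedDeriv 5 (by norm_num)

/-- If `u 0 = 0` and `|u' s| ≤ C |s| ^ k`, then `|u h| ≤ C |h| ^ (k + 1)`. -/
lemma abs_le_of_hasDerivAt_of_abs_le_pow {u u' : ℝ → ℝ} {C : ℝ} {k : ℕ}
    (hu : ∀ s, HasDerivAt u (u' s) s) (h0 : u 0 = 0) (hb : ∀ s, |u' s| ≤ C * |s| ^ k)
    (hC : 0 ≤ C) (h : ℝ) : |u h| ≤ C * |h| ^ (k + 1) := by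
  have key := (convex_uIcc (0 : ℝ) h).norm_image_sub_le_of_norm_hasDerivWithin_le
    (f := u) (f' := u') (C := C * |h| ^ k) (x := 0) (y := h)
    (fun x _ => (hu x).hasDerivWithinAt)
    (fun x hx => by
      refine (hb x).trans ?_
      have hx' : |x| ≤ |h| := by simpa using Set.abs_sub_left_of_mem_uIcc hx
      gcongr)
    Set.left_mem_uIcc Set.right_mem_uIcc
  simpa [h0, pow_succ, mul_assoc] using key

/-! ### Taylor remainders. -/

section Taylor

variable {f : ℕ → ℝ → ℝ}

/-- This bound and the next three form a ladder: the derivative in `s` of each remainder is the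
previous remainder for the shifted sequence `f (· + 1)`. Only orders matter, so the factorials that
could be gained are dropped. -/
lemma BoundedDerivs.taylor_one (h : BoundedDerivs 1 f) (x s : ℝ) :
    |f 0 (x + s) - f 0 x| ≤ |s| := by
  have := abs_le_of_hasDerivAt_of_abs_le_pow (u := fun s => f 0 (x + s) - f 0 x)
    (u' := fun s => f 1 (x + s)) (C := 1) (k := 0)
    (fun s => ((h.hasDerivAt 0 (by norm_num) (x + s)).comp_const_add x s).sub_const _)
    (by simp) (fun s => by simpa using h.bound 1 le_rfl _) zero_le_one s
  simpa using this

lemma BoundedDerivs.taylor_two (h : BoundedDerivs 2 f) (x s : ℝ) :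
    |f 0 (x + s) - f 0 x - s * f 1 x| ≤ s ^ 2 := by
  have := abs_le_of_hasDerivAt_of_abs_le_pow (u := fun s => f 0 (x + s) - f 0 x - s * f 1 x)
    (u' := fun s => f 1 (x + s) - f 1 x) (C := 1) (k := 1)
    (fun s => by
      simpa using (((h.hasDerivAt 0 (by norm_num) (x + s)).comp_const_add x s).sub_const
        (f 0 x)).fun_sub ((hasDerivAt_id s).mul_const (f 1 x)))
    (by simp) (fun s => by
      simpa using (h.shift (i := 1) (j := 1) le_rfl).taylor_one x s) zero_le_one s
  simpa using this

lemma BoundedDerivs.taylor_three (h : BoundedDerivs 3 f) (x s : ℝ) :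
    |f 0 (x + s) - f 0 x - s * f 1 x - s ^ 2 / 2 * f 2 x| ≤ |s| ^ 3 := by
  have := abs_le_of_hasDerivAt_of_abs_le_pow
    (u := fun s => f 0 (x + s) - f 0 x - s * f 1 x - s ^ 2 / 2 * f 2 x)
    (u' := fun s => f 1 (x + s) - f 1 x - s * f 2 x) (C := 1) (k := 2)
    (fun s => by
      have h2 : HasDerivAt (fun s : ℝ => s ^ 2 / 2) s s := by
        simpa using ((hasDerivAt_id s).pow 2).div_const 2
      simpa using ((((h.hasDerivAt 0 (by norm_num) (x + s)).comp_const_add x s).sub_const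
        (f 0 x)).fun_sub ((hasDerivAt_id s).mul_const (f 1 x))).fun_sub (h2.mul_const (f 2 x)))
    (by simp) (fun s => by
      simpa using (h.shift (i := 1) (j := 2) le_rfl).taylor_two x s) zero_le_one s
  simpa using this

/-- Fourth order is needed because the third Gaussian moment vanishes: the heat-equation error is
then quadratic in the variance, not of order 3/2. -/
lemma BoundedDerivs.taylor_four (h : BoundedDerivs 4 f) (x s : ℝ) :
    |f 0 (x + s) - f 0 x - s * f 1 x - s ^ 2 / 2 * f 2 x - s ^ 3 / 6 * f 3 x| ≤ s ^ 4 := by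
  have := abs_le_of_hasDerivAt_of_abs_le_pow
    (u := fun s => f 0 (x + s) - f 0 x - s * f 1 x - s ^ 2 / 2 * f 2 x - s ^ 3 / 6 * f 3 x)
    (u' := fun s => f 1 (x + s) - f 1 x - s * f 2 x - s ^ 2 / 2 * f 3 x) (C := 1) (k := 3)
    (fun s => by
      have h2 : HasDerivAt (fun s : ℝ => s ^ 2 / 2) s s := by
        simpa using ((hasDerivAt_id s).pow 2).div_const 2
      have h3 : HasDerivAt (fun s : ℝ => s ^ 3 / 6) (s ^ 2 / 2) s := by
        refine ((hasDerivAt_pow 3 s).div_const 6).congr_deriv ?_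
        norm_num
        linarith
      simpa using (((((h.hasDerivAt 0 (by norm_num) (x + s)).comp_const_add x s).sub_const
        (f 0 x)).fun_sub ((hasDerivAt_id s).mul_const (f 1 x))).fun_sub (h2.mul_const (f 2 x))).fun_sub
          (h3.mul_const (f 3 x)))
    (by simp) (fun s => by
      simpa using (h.shift (i := 1) (j := 3) le_rfl).taylor_three x s) zero_le_one s
  simpa [Even.pow_abs (show Even 4 by decide)] using this

end Taylor

lemma abs_integral_le_of_abs_le {α : Type*} [MeasurableSpace α] {μ : Measure α}
    [IsProbabilityMeasure μ] {F : α → ℝ} {C : ℝ} (h : ∀ x, |F x| ≤ C) : |∫ x, F x ∂μ| ≤ C := by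
  simpa using norm_integral_le_of_norm_le_const (μ := μ) (f := F) (ae_of_all _ h)

/-! ### Gaussian smoothing -/

/-- `gaussSmooth φ z v = 𝔼[φ(z + √v N)]` for a standard normal variable `N`. -/
noncomputable def gaussSmooth (φ : ℝ → ℝ) (z v : ℝ) : ℝ :=
  ∫ x, φ (z + √v * x) ∂gaussianReal 0 1

/-- The fourth moment of the standard normal law. -/
noncomputable def gaussFourthMoment : ℝ := ∫ x, x ^ 4 ∂gaussianReal 0 1

lemma integrable_pow_gaussianReal (p : ℕ) : Integrable (fun x : ℝ => x ^ p) (gaussianReal 0 1) := by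
  have h := (memLp_id_gaussianReal' (μ := 0) (v := 1) (p : ℝ≥0∞) (by simp)).integrable_norm_pow'
  rw [← integrable_norm_iff (by fun_prop)]
  simpa using h

lemma integral_pow_three_gaussianReal : ∫ x : ℝ, x ^ 3 ∂gaussianReal 0 1 = 0 := by
  have h : ∫ x : ℝ, x ^ 3 ∂gaussianReal 0 1 = ∫ x : ℝ, (-x) ^ 3 ∂gaussianReal 0 1 := by
    conv_lhs => rw [show gaussianReal 0 1 = (gaussianReal 0 1).map (fun x => -x) by
      rw [gaussianReal_map_neg, neg_zero]]
    rw [integral_map (by fun_prop) (by fun_prop)]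
  have h2 : ∫ x : ℝ, (-x) ^ 3 ∂gaussianReal 0 1 = - ∫ x : ℝ, x ^ 3 ∂gaussianReal 0 1 := by
    rw [← integral_neg]
    congr 1
    ext x
    ring
  linarith

lemma integral_pow_two_gaussianReal : ∫ x : ℝ, x ^ 2 ∂gaussianReal 0 1 = 1 := by
  have h := variance_id_gaussianReal (μ := 0) (v := 1)
  rw [variance_of_integral_eq_zero (by fun_prop) (by simp [integral_id_gaussianReal])] at h
  simpa using h

lemma integrable_gaussSmooth {φ : ℝ → ℝ} (hc : Continuous φ) (hb : ∀ x, |φ x| ≤ 1) (z c : ℝ) :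
    Integrable (fun x => φ (z + c * x)) (gaussianReal 0 1) :=
  Integrable.of_bound (by fun_prop) 1 (ae_of_all _ fun x => hb _)

lemma gaussSmooth_zero (φ : ℝ → ℝ) (z : ℝ) : gaussSmooth φ z 0 = φ z := by
  simp [gaussSmooth]

lemma abs_gaussSmooth_le {φ : ℝ → ℝ} (hb : ∀ x, |φ x| ≤ 1) (z v : ℝ) : |gaussSmooth φ z v| ≤ 1 := by
  have := norm_integral_le_of_norm_le_const (μ := gaussianReal 0 1)
    (f := fun x => φ (z + √v * x)) (C := 1) (ae_of_all _ fun x => hb _)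
  simpa [gaussSmooth] using this

/-- The form with `√v` allows differentiation under a fixed law; the form with `gaussianReal 0 v`
gives access to convolution. This lemma passes between them. -/
lemma gaussSmooth_eq_integral {φ : ℝ → ℝ} (hc : Continuous φ) (z : ℝ) (v : ℝ≥0) :
    gaussSmooth φ z v = ∫ x, φ (z + x) ∂gaussianReal 0 v := by
  have h : gaussianReal 0 v = (gaussianReal 0 1).map (fun x => √v * x) := by
    rw [gaussianReal_map_const_mul]
    congr 1
    · simp
    · ext
      simp
  rw [h, integral_map (by fun_prop) (by fun_prop), gaussSmooth]

/-- Semigroup property: the convolution of centred Gaussian laws adds their variances. -/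
lemma gaussSmooth_add {φ : ℝ → ℝ} (hc : Continuous φ) (hb : ∀ x, |φ x| ≤ 1) (z : ℝ) {v q : ℝ}
    (hv : 0 ≤ v) (hq : 0 ≤ q) :
    gaussSmooth φ z (v + q) =
      ∫ x, (∫ y, φ (z + √v * x + √q * y) ∂gaussianReal 0 1) ∂gaussianReal 0 1 := by
  lift v to ℝ≥0 using hv
  lift q to ℝ≥0 using hq
  have h1 (x : ℝ) : ∫ y, φ (z + √v * x + √q * y) ∂gaussianReal 0 1 =
      ∫ y, φ (z + √v * x + y) ∂gaussianReal 0 q := gaussSmooth_eq_integral hc _ q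
  simp_rw [h1]
  have hm : Continuous (fun x => ∫ y, φ (z + x + y) ∂gaussianReal 0 q) :=
    continuous_of_dominated (bound := fun _ => 1) (fun x => by fun_prop)
      (fun x => ae_of_all _ fun y => hb _) (integrable_const _)
      (ae_of_all _ fun y => by fun_prop)
  have h2 : ∫ x, (∫ y, φ (z + √v * x + y) ∂gaussianReal 0 q) ∂gaussianReal 0 1 =
      ∫ x, (∫ y, φ (z + x + y) ∂gaussianReal 0 q) ∂gaussianReal 0 v := by
    have := gaussSmooth_eq_integral hm 0 v
    simpa [gaussSmooth] using this
  rw [h2, ← NNReal.coe_add, gaussSmooth_eq_integral hc, ← add_zero (0 : ℝ),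
    ← gaussianReal_conv_gaussianReal, Measure.conv, integral_map (by fun_prop) (by fun_prop),
    integral_prod]
  · simp [add_assoc]
  · exact Integrable.of_bound (by fun_prop) 1 (ae_of_all _ fun x => hb _)

section Smoothing

variable {f : ℕ → ℝ → ℝ}

lemma abs_integral_gaussian_le {F G : ℝ → ℝ} {B : ℝ}
    (hG : Integrable G (gaussianReal 0 1)) (h : ∀ x, |F x| ≤ G x)
    (hB : ∫ x, G x ∂gaussianReal 0 1 = B) :
    |∫ x, F x ∂gaussianReal 0 1| ≤ B := by
  rw [← hB]
  exact norm_integral_le_of_norm_le (f := F) hG (ae_of_all _ h)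

/-- The linear Taylor term has mean zero, so the error is the mean of `(√q y) ^ 2`. This is why
smoothing is Lipschitz in the variance and not merely in the standard deviation. -/
lemma BoundedDerivs.abs_gaussian_step_sub_le (h : BoundedDerivs 2 f) (x : ℝ) {q : ℝ} (hq : 0 ≤ q) :
    |(∫ y, f 0 (x + √q * y) ∂gaussianReal 0 1) - f 0 x| ≤ q := by
  have hc0 := h.continuous (l := 0) (by norm_num)
  have hi0 := integrable_gaussSmooth hc0 (h.bound 0 (by norm_num)) x (√q)
  have e : (∫ y, f 0 (x + √q * y) ∂gaussianReal 0 1) - f 0 x =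
      ∫ y, (f 0 (x + √q * y) - f 0 x - √q * y * f 1 x) ∂gaussianReal 0 1 := by
    have hi1 : Integrable (fun y : ℝ => √q * y * f 1 x) (gaussianReal 0 1) := by
      simpa using ((integrable_pow_gaussianReal 1).const_mul √q).mul_const (f 1 x)
    rw [integral_sub (hi0.sub' (integrable_const _)) hi1, integral_sub hi0 (integrable_const _),
      integral_mul_const, integral_const_mul, integral_id_gaussianReal]
    simp
  rw [e]
  refine abs_integral_gaussian_le (G := fun y => q * y ^ 2)
    ((integrable_pow_gaussianReal 2).const_mul q) (fun y => ?_) ?_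
  · refine (h.taylor_two x (√q * y)).trans ?_
    rw [mul_pow, Real.sq_sqrt hq]
  · rw [integral_const_mul, integral_pow_two_gaussianReal, mul_one]

/-- Subtract the third-order Taylor polynomial: its odd terms integrate to zero and its quadratic
term to `q / 2 * f 2 x`. -/
lemma BoundedDerivs.abs_gaussian_step_sub_sub_le (h : BoundedDerivs 4 f) (x : ℝ) {q : ℝ}
    (hq : 0 ≤ q) :
    |(∫ y, f 0 (x + √q * y) ∂gaussianReal 0 1) - f 0 x - q / 2 * f 2 x| ≤
      gaussFourthMoment * q ^ 2 := by
  have hc0 := h.continuous (l := 0) (by norm_num)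
  have hi0 := integrable_gaussSmooth hc0 (h.bound 0 (by norm_num)) x (√q)
  have e : (∫ y, f 0 (x + √q * y) ∂gaussianReal 0 1) - f 0 x - q / 2 * f 2 x =
      ∫ y, (f 0 (x + √q * y) - f 0 x - √q * y * f 1 x - (√q * y) ^ 2 / 2 * f 2 x
        - (√q * y) ^ 3 / 6 * f 3 x) ∂gaussianReal 0 1 := by
    have hi1 : Integrable (fun y : ℝ => √q * y * f 1 x) (gaussianReal 0 1) := by
      simpa using ((integrable_pow_gaussianReal 1).const_mul √q).mul_const (f 1 x)
    have e2 : (fun y : ℝ => (√q * y) ^ 2 / 2 * f 2 x) = fun y => q / 2 * f 2 x * y ^ 2 := by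
      ext y
      rw [mul_pow, Real.sq_sqrt hq]
      ring
    have hi2 : Integrable (fun y : ℝ => (√q * y) ^ 2 / 2 * f 2 x) (gaussianReal 0 1) := by
      rw [e2]
      exact (integrable_pow_gaussianReal 2).const_mul _
    have e3 : (fun y : ℝ => (√q * y) ^ 3 / 6 * f 3 x) = fun y => √q ^ 3 / 6 * f 3 x * y ^ 3 := by
      ext y
      ring
    have hi3 : Integrable (fun y : ℝ => (√q * y) ^ 3 / 6 * f 3 x) (gaussianReal 0 1) := by
      rw [e3]
      exact (integrable_pow_gaussianReal 3).const_mul _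
    rw [integral_sub (((hi0.sub' (integrable_const _)).sub' hi1).sub' hi2) hi3,
      integral_sub ((hi0.sub' (integrable_const _)).sub' hi1) hi2,
      integral_sub (hi0.sub' (integrable_const _)) hi1, integral_sub hi0 (integrable_const _),
      integral_mul_const, integral_const_mul, integral_id_gaussianReal, e2, e3, integral_const_mul,
      integral_const_mul, integral_pow_two_gaussianReal, integral_pow_three_gaussianReal]
    simp
  rw [e]
  have hc : Continuous (fun y => f 0 (x + √q * y)) := by fun_prop
  refine abs_integral_gaussian_le (G := fun y => q ^ 2 * y ^ 4)
    ((integrable_pow_gaussianReal 4).const_mul _) (fun y => ?_) ?_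
  · refine (h.taylor_four x (√q * y)).trans ?_
    rw [mul_pow, show √q ^ 4 = (√q ^ 2) ^ 2 by ring, Real.sq_sqrt hq]
  · rw [integral_const_mul, mul_comm, gaussFourthMoment]

lemma integrable_gaussSmooth_step {φ : ℝ → ℝ} (hc : Continuous φ) (hb : ∀ x, |φ x| ≤ 1)
    (z v q : ℝ) :
    Integrable (fun x => ∫ y, φ (z + √v * x + √q * y) ∂gaussianReal 0 1) (gaussianReal 0 1) := by
  have hm : Continuous (fun x => ∫ y, φ (z + √v * x + √q * y) ∂gaussianReal 0 1) :=
    continuous_of_dominated (bound := fun _ => 1) (fun x => by fun_prop)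
      (fun x => ae_of_all _ fun y => hb _) (integrable_const _)
      (ae_of_all _ fun y => by fun_prop)
  refine Integrable.of_bound hm.aestronglyMeasurable 1 (ae_of_all _ fun x => ?_)
  simpa using norm_integral_le_of_norm_le_const (μ := gaussianReal 0 1)
    (f := fun y => φ (z + √v * x + √q * y)) (C := 1) (ae_of_all _ fun y => hb _)

lemma BoundedDerivs.abs_gaussSmooth_add_sub_le (h : BoundedDerivs 2 f) (z : ℝ) {v q : ℝ}
    (hv : 0 ≤ v) (hq : 0 ≤ q) :
    |gaussSmooth (f 0) z (v + q) - gaussSmooth (f 0) z v| ≤ q := by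
  have hc0 := h.continuous (l := 0) (by norm_num)
  have hb0 := h.bound 0 (by norm_num)
  rw [gaussSmooth_add hc0 hb0 z hv hq, gaussSmooth, ← integral_sub
    (integrable_gaussSmooth_step hc0 hb0 z v q) (integrable_gaussSmooth hc0 hb0 z _)]
  simpa using norm_integral_le_of_norm_le_const (μ := gaussianReal 0 1) (C := q)
    (f := fun x => (∫ y, f 0 (z + √v * x + √q * y) ∂gaussianReal 0 1) - f 0 (z + √v * x))
    (ae_of_all _ fun x => h.abs_gaussian_step_sub_le (z + √v * x) hq)

/-- `v ↦ gaussSmooth φ z v` solves the heat equation, up to a quadratic error. -/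
lemma BoundedDerivs.abs_gaussSmooth_add_sub_sub_le (h : BoundedDerivs 4 f) (z : ℝ) {v q : ℝ}
    (hv : 0 ≤ v) (hq : 0 ≤ q) :
    |gaussSmooth (f 0) z (v + q) - gaussSmooth (f 0) z v - q / 2 * gaussSmooth (f 2) z v| ≤
      gaussFourthMoment * q ^ 2 := by
  have hc0 := h.continuous (l := 0) (by norm_num)
  have hb0 := h.bound 0 (by norm_num)
  have hi2 := integrable_gaussSmooth (h.continuous (l := 2) (by norm_num))
    (h.bound 2 (by norm_num)) z (√v)
  rw [gaussSmooth_add hc0 hb0 z hv hq, gaussSmooth, gaussSmooth, ← integral_const_mul,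
    ← integral_sub
    (integrable_gaussSmooth_step hc0 hb0 z v q) (integrable_gaussSmooth hc0 hb0 z _),
    ← integral_sub ((integrable_gaussSmooth_step hc0 hb0 z v q).sub'
      (integrable_gaussSmooth hc0 hb0 z _)) (hi2.const_mul _)]
  simpa using norm_integral_le_of_norm_le_const (μ := gaussianReal 0 1)
    (C := gaussFourthMoment * q ^ 2)
    (f := fun x => (∫ y, f 0 (z + √v * x + √q * y) ∂gaussianReal 0 1) - f 0 (z + √v * x)
      - q / 2 * f 2 (z + √v * x))
    (ae_of_all _ fun x => h.abs_gaussian_step_sub_sub_le (z + √v * x) hq)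

lemma BoundedDerivs.abs_gaussSmooth_sub_le (h : BoundedDerivs 2 f) (z : ℝ) {v w : ℝ}
    (hv : 0 ≤ v) (hw : 0 ≤ w) :
    |gaussSmooth (f 0) z w - gaussSmooth (f 0) z v| ≤ |w - v| := by
  rcases le_total v w with hvw | hvw
  · have := h.abs_gaussSmooth_add_sub_le z hv (sub_nonneg.2 hvw)
    rwa [add_sub_cancel, ← abs_of_nonneg (sub_nonneg.2 hvw)] at this
  · have := h.abs_gaussSmooth_add_sub_le z hw (sub_nonneg.2 hvw)
    rwa [add_sub_cancel, abs_sub_comm, ← abs_of_nonneg (sub_nonneg.2 hvw), abs_sub_comm v w] at this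

/-- For `w < v` the forward expansion starts at `w`; moving its coefficient `f 2` from `w` to `v`
costs at most `(w - v) ^ 2`, which accounts for the `+ 1`. -/
lemma BoundedDerivs.abs_gaussSmooth_sub_sub_le (h : BoundedDerivs 4 f) (z : ℝ) {v w : ℝ}
    (hv : 0 ≤ v) (hw : 0 ≤ w) :
    |gaussSmooth (f 0) z w - gaussSmooth (f 0) z v - (w - v) / 2 * gaussSmooth (f 2) z v| ≤
      (gaussFourthMoment + 1) * (w - v) ^ 2 := by
  rcases le_total v w with hvw | hvw
  · have := h.abs_gaussSmooth_add_sub_sub_le z hv (sub_nonneg.2 hvw)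
    rw [add_sub_cancel] at this
    nlinarith [sq_nonneg (w - v)]
  · have h1 := h.abs_gaussSmooth_add_sub_sub_le z hw (sub_nonneg.2 hvw)
    rw [add_sub_cancel] at h1
    have h2 := (h.shift (i := 2) (j := 2) le_rfl).abs_gaussSmooth_sub_le z hv hw
    simp only [zero_add] at h2
    have h3 : |(v - w) / 2 * (gaussSmooth (f 2) z w - gaussSmooth (f 2) z v)| ≤ (w - v) ^ 2 := by
      rw [abs_mul, ← sq_abs (w - v), abs_div, abs_sub_comm v w, abs_two]
      nlinarith [abs_nonneg (w - v)]
    have e : gaussSmooth (f 0) z w - gaussSmooth (f 0) z v - (w - v) / 2 * gaussSmooth (f 2) z v =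
      -(gaussSmooth (f 0) z v - gaussSmooth (f 0) z w - (v - w) / 2 * gaussSmooth (f 2) z w)
        - (v - w) / 2 * (gaussSmooth (f 2) z w - gaussSmooth (f 2) z v) := by ring
    rw [e]
    refine (abs_sub _ _).trans ?_
    rw [abs_neg]
    nlinarith

/-- The second difference of `v ↦ gaussSmooth φ z v`. -/
lemma BoundedDerivs.abs_gaussSmooth_second_diff_le (h : BoundedDerivs 4 f) (z : ℝ) {v w u : ℝ}
    (hv : 0 ≤ v) (hw : 0 ≤ w) (hu : 0 ≤ u) :
    |gaussSmooth (f 0) z w + gaussSmooth (f 0) z u - 2 * gaussSmooth (f 0) z v| ≤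
      |w + u - 2 * v| + (gaussFourthMoment + 1) * ((w - v) ^ 2 + (u - v) ^ 2) := by
  have h1 := h.abs_gaussSmooth_sub_sub_le z hv hw
  have h2 := h.abs_gaussSmooth_sub_sub_le z hv hu
  have h3 := abs_gaussSmooth_le (h.bound 2 (by norm_num)) z v
  have h4 : |(w + u - 2 * v) / 2 * gaussSmooth (f 2) z v| ≤ |w + u - 2 * v| := by
    rw [abs_mul, abs_div, abs_two]
    nlinarith [abs_nonneg (w + u - 2 * v), abs_nonneg (gaussSmooth (f 2) z v)]
  have e : gaussSmooth (f 0) z w + gaussSmooth (f 0) z u - 2 * gaussSmooth (f 0) z v =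
      (gaussSmooth (f 0) z w - gaussSmooth (f 0) z v - (w - v) / 2 * gaussSmooth (f 2) z v)
      + (gaussSmooth (f 0) z u - gaussSmooth (f 0) z v - (u - v) / 2 * gaussSmooth (f 2) z v)
      + (w + u - 2 * v) / 2 * gaussSmooth (f 2) z v := by ring
  rw [e]
  refine (abs_add_three _ _ _).trans ?_
  linarith

lemma BoundedDerivs.gaussSmooth_taylor_one (h : BoundedDerivs 1 f) (z s v : ℝ) :
    |gaussSmooth (f 0) (z + s) v - gaussSmooth (f 0) z v| ≤ |s| := by
  have hc0 := h.continuous (l := 0) (by norm_num)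
  have hb0 := h.bound 0 (by norm_num)
  rw [gaussSmooth, gaussSmooth, ← integral_sub
    (integrable_gaussSmooth hc0 hb0 _ _) (integrable_gaussSmooth hc0 hb0 z _)]
  refine abs_integral_le_of_abs_le fun x => ?_
  rw [add_right_comm]
  exact h.taylor_one (z + √v * x) s

lemma BoundedDerivs.gaussSmooth_taylor_two (h : BoundedDerivs 2 f) (z s v : ℝ) :
    |gaussSmooth (f 0) (z + s) v - gaussSmooth (f 0) z v - s * gaussSmooth (f 1) z v| ≤ s ^ 2 := by
  have hc0 := h.continuous (l := 0) (by norm_num)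
  have hb0 := h.bound 0 (by norm_num)
  have hi1 := integrable_gaussSmooth (h.continuous (l := 1) (by norm_num))
    (h.bound 1 (by norm_num)) z (√v)
  have hi := (integrable_gaussSmooth hc0 hb0 (z + s) (√v)).sub' (integrable_gaussSmooth hc0 hb0 z √v)
  rw [gaussSmooth, gaussSmooth, gaussSmooth, ← integral_const_mul, ← integral_sub
    (integrable_gaussSmooth hc0 hb0 _ _) (integrable_gaussSmooth hc0 hb0 z _),
    ← integral_sub hi (hi1.const_mul _)]
  refine abs_integral_le_of_abs_le fun x => ?_
  rw [add_right_comm]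
  exact h.taylor_two (z + √v * x) s

lemma BoundedDerivs.gaussSmooth_taylor_three (h : BoundedDerivs 3 f) (z s v : ℝ) :
    |gaussSmooth (f 0) (z + s) v - gaussSmooth (f 0) z v - s * gaussSmooth (f 1) z v
      - s ^ 2 / 2 * gaussSmooth (f 2) z v| ≤ |s| ^ 3 := by
  have hc0 := h.continuous (l := 0) (by norm_num)
  have hb0 := h.bound 0 (by norm_num)
  have hi1 := integrable_gaussSmooth (h.continuous (l := 1) (by norm_num))
    (h.bound 1 (by norm_num)) z (√v)
  have hi2 := integrable_gaussSmooth (h.continuous (l := 2) (by norm_num))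
    (h.bound 2 (by norm_num)) z (√v)
  have hi := (integrable_gaussSmooth hc0 hb0 (z + s) (√v)).sub' (integrable_gaussSmooth hc0 hb0 z √v)
  have hi' := hi.sub' (hi1.const_mul s)
  rw [gaussSmooth, gaussSmooth, gaussSmooth, gaussSmooth, ← integral_const_mul,
    ← integral_const_mul, ← integral_sub
    (integrable_gaussSmooth hc0 hb0 _ _) (integrable_gaussSmooth hc0 hb0 z _),
    ← integral_sub hi (hi1.const_mul _), ← integral_sub hi' (hi2.const_mul _)]
  refine abs_integral_le_of_abs_le fun x => ?_
  rw [add_right_comm]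
  exact h.taylor_three (z + √v * x) s

end Smoothing

/-! ### Independent identically distributed sequences -/

/-- The law of a sequence of independent variables with common law `ν`. -/
noncomputable abbrev iidLaw {E : Type*} [MeasurableSpace E] (ν : Measure E) : Measure (ℕ → E) :=
  Measure.infinitePi (fun _ : ℕ => ν)

/-- The sequence `y` with its entries of index in `[i, j)` replaced by those of `y'`. -/
def splice {E : Type*} (i j : ℕ) (y y' : ℕ → E) : ℕ → E :=
  fun l => if i ≤ l ∧ l < j then y' l else y l

/-- The `m + 1` consecutive entries of `y` that start at index `i`. -/
def seqBlock {E : Type*} (m i : ℕ) (y : ℕ → E) : Fin (m + 1) → E := fun k => y (i + k)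

section Splice

variable {E : Type*}

lemma splice_of_mem {i j l : ℕ} (y y' : ℕ → E) (h : i ≤ l ∧ l < j) : splice i j y y' l = y' l :=
  if_pos h

lemma splice_of_notMem {i j l : ℕ} (y y' : ℕ → E) (h : ¬(i ≤ l ∧ l < j)) :
    splice i j y y' l = y l :=
  if_neg h

lemma seqBlock_splice_of_subset {m i j l : ℕ} (y y' : ℕ → E) (h1 : i ≤ l) (h2 : l + m < j) :
    seqBlock m l (splice i j y y') = seqBlock m l y' := by
  ext k
  exact splice_of_mem _ _ (by omega)

lemma seqBlock_splice_of_disjoint {m i j l : ℕ} (y y' : ℕ → E) (h : l + m < i ∨ j ≤ l) :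
    seqBlock m l (splice i j y y') = seqBlock m l y := by
  ext k
  exact splice_of_notMem _ _ (by omega)

lemma seqBlock_shift (m i k : ℕ) (y : ℕ → E) :
    seqBlock m k (fun l => y (i + l)) = seqBlock m (i + k) y := by
  ext l
  simp [seqBlock, add_assoc]

end Splice

section IID

variable {E : Type*} [MeasurableSpace E] {ν : Measure E} [IsProbabilityMeasure ν]

@[fun_prop]
lemma measurable_seqBlock (m i : ℕ) : Measurable (seqBlock (E := E) m i) := by
  unfold seqBlock
  fun_prop

lemma measurable_splice (i j : ℕ) :
    Measurable (fun p : (ℕ → E) × (ℕ → E) => splice i j p.1 p.2) := by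
  refine measurable_pi_lambda _ fun l => ?_
  by_cases h : i ≤ l ∧ l < j
  · simp only [splice, h, and_self, if_true]
    fun_prop
  · simp only [splice, h, if_false]
    fun_prop

lemma measurable_splice_right (i j : ℕ) (y : ℕ → E) : Measurable (splice i j y) :=
  (measurable_splice i j).comp measurable_prodMk_left

/-- Resampling a window of coordinates from an independent copy preserves the law. On a cylinder the
product of probabilities splits into the factors inside and outside the window. -/
lemma measurePreserving_splice (ν : Measure E) [IsProbabilityMeasure ν] (i j : ℕ) :
    MeasurePreserving (fun p : (ℕ → E) × (ℕ → E) => splice i j p.1 p.2)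
      ((iidLaw ν).prod (iidLaw ν)) (iidLaw ν) := by
  refine ⟨measurable_splice i j, Measure.eq_infinitePi _ fun s t ht => ?_⟩
  rw [Measure.map_apply (measurable_splice i j)
    (MeasurableSet.pi s.countable_toSet fun l _ => ht l)]
  have e : (fun p : (ℕ → E) × (ℕ → E) => splice i j p.1 p.2) ⁻¹' (s : Set ℕ).pi t =
      ((s.filter fun l => ¬(i ≤ l ∧ l < j) : Finset ℕ) : Set ℕ).pi t ×ˢ
        ((s.filter fun l => i ≤ l ∧ l < j : Finset ℕ) : Set ℕ).pi t := by
    ext p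
    simp only [Set.mem_preimage, Set.mem_pi, Set.mem_prod, Finset.coe_filter, Set.mem_ofPred_eq,
      Finset.mem_coe, and_imp]
    constructor
    · intro h
      refine ⟨fun l hl hn => ?_, fun l hl h1 h2 => ?_⟩
      · simpa [splice_of_notMem _ _ hn] using h l hl
      · simpa [splice_of_mem _ _ ⟨h1, h2⟩] using h l hl
    · rintro ⟨h1, h2⟩ l hl
      by_cases h : i ≤ l ∧ l < j
      · simpa [splice_of_mem _ _ h] using h2 l hl h.1 h.2
      · simpa [splice_of_notMem _ _ h] using h1 l hl h
  rw [e, Measure.prod_prod, Measure.infinitePi_pi _ fun l _ => ht l,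
    Measure.infinitePi_pi _ fun l _ => ht l, mul_comm]
  exact Finset.prod_filter_mul_prod_filter_not s _ _

/-- The inner integral plays the role of the conditional expectation given the coordinates outside
`[i, j)`. Every conditioning argument along the walk goes through this formula. -/
lemma integral_eq_integral_splice (i j : ℕ) {F : (ℕ → E) → ℝ} (hF : Integrable F (iidLaw ν)) :
    ∫ y, F y ∂iidLaw ν = ∫ y, ∫ y', F (splice i j y y') ∂iidLaw ν ∂iidLaw ν := by
  have h := measurePreserving_splice ν i j
  rw [← integral_prod (fun p : (ℕ → E) × (ℕ → E) => F (splice i j p.1 p.2))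
    (h.integrable_comp_of_integrable hF)]
  conv_lhs => rw [← h.map_eq]
  refine integral_map h.aemeasurable ?_
  rw [h.map_eq]
  exact hF.aestronglyMeasurable

/-- If `G` does not depend on the entries in `[i, j)`, and `F` is centred when these entries are
averaged out, then `F * G` is centred. -/
lemma integral_mul_eq_zero_of_splice {i j : ℕ} {F G : (ℕ → E) → ℝ}
    (hFG : Integrable (fun y => F y * G y) (iidLaw ν))
    (hG : ∀ y y', G (splice i j y y') = G y)
    (hF : ∀ y, ∫ y', F (splice i j y y') ∂iidLaw ν = 0) :
    ∫ y, F y * G y ∂iidLaw ν = 0 := by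
  rw [integral_eq_integral_splice i j hFG]
  simp_rw [hG, integral_mul_const, hF]
  simp

lemma measurePreserving_shift (ν : Measure E) [IsProbabilityMeasure ν] (p : ℕ) :
    MeasurePreserving (fun (y : ℕ → E) l => y (p + l)) (iidLaw ν) (iidLaw ν) :=
  ⟨by fun_prop, Measure.map_infinitePi_infinitePi_of_inj (P := fun _ : ℕ => ν)
    (f := fun l => p + l) (add_right_injective p)⟩

lemma integral_shift (p : ℕ) {F : (ℕ → E) → ℝ} (hF : Measurable F) :
    ∫ y, F (fun l => y (p + l)) ∂iidLaw ν = ∫ y, F y ∂iidLaw ν := by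
  have h := measurePreserving_shift ν p
  conv_rhs => rw [← h.map_eq]
  exact (integral_map h.aemeasurable hF.aestronglyMeasurable).symm

lemma integral_apply_iidLaw (l : ℕ) {F : E → ℝ} (hF : Measurable F) :
    ∫ y, F (y l) ∂iidLaw ν = ∫ x, F x ∂ν := by
  have h := measurePreserving_eval_infinitePi (fun _ : ℕ => ν) l
  conv_rhs => rw [← h.map_eq]
  exact (integral_map h.aemeasurable hF.aestronglyMeasurable).symm

end IID

section Neg

variable {E : Type*} [MeasurableSpace E] [AddGroup E] [MeasurableNeg E] {ν : Measure E}
  [IsProbabilityMeasure ν]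

lemma integral_neg_iidLaw (hν : ν.map Neg.neg = ν) {F : (ℕ → E) → ℝ} (hF : Measurable F) :
    ∫ y, F (-y) ∂iidLaw ν = ∫ y, F y ∂iidLaw ν := by
  have h : (iidLaw ν).map (fun y => -y) = iidLaw ν := by
    have := Measure.infinitePi_map_pi (μ := fun _ : ℕ => ν) (f := fun _ => Neg.neg)
      (fun _ => measurable_neg)
    simp only [hν] at this
    exact this
  conv_rhs => rw [← h]
  exact (integral_map (by fun_prop) hF.aestronglyMeasurable).symm

/-- Resample the window first; reflecting the window then amounts to reflecting the independent
copy, whose law is symmetric. -/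
lemma integral_splice_neg (hν : ν.map Neg.neg = ν) (i j : ℕ) {F : (ℕ → E) → ℝ}
    (hF : Measurable F) {C : ℝ} (hb : ∀ y, |F y| ≤ C) :
    ∫ y, F (splice i j y (-y)) ∂iidLaw ν = ∫ y, F y ∂iidLaw ν := by
  have hm : Measurable fun y : ℕ → E => splice i j y (-y) :=
    (measurable_splice i j).comp (measurable_id.prodMk measurable_neg)
  rw [integral_eq_integral_splice i j (F := fun y => F (splice i j y (-y))) (Integrable.of_bound
      (hF.comp hm).aestronglyMeasurable C (ae_of_all _ fun y => hb _)),
    integral_eq_integral_splice i j (Integrable.of_bound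
      hF.aestronglyMeasurable C (ae_of_all _ fun y => hb _))]
  congr 1
  ext y
  rw [← integral_neg_iidLaw hν (F := fun y' => F (splice i j y y'))
    (hF.comp (measurable_splice_right i j y))]
  congr 1
  ext y'
  congr 1
  ext l
  by_cases h : i ≤ l ∧ l < j <;> simp [splice, h]

end Neg

/-! ### Functions with bounded differences of order one and two -/

/-- The truncated norm `min 1 ‖v‖`. -/
noncomputable def truncNorm {E : Type*} [NormedAddCommGroup E] (v : E) : ℝ := min 1 ‖v‖

section TruncNorm

variable {E : Type*} [NormedAddCommGroup E]

lemma truncNorm_nonneg (v : E) : 0 ≤ truncNorm v := le_min zero_le_one (norm_nonneg v)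

lemma truncNorm_le_one (v : E) : truncNorm v ≤ 1 := min_le_left _ _

lemma truncNorm_neg (v : E) : truncNorm (-v) = truncNorm v := by simp [truncNorm]

@[simp]
lemma truncNorm_zero : truncNorm (0 : E) = 0 := by simp [truncNorm]

lemma truncNorm_add_le (v w : E) : truncNorm (v + w) ≤ truncNorm v + truncNorm w := by
  have h := norm_add_le v w
  unfold truncNorm
  rcases min_cases 1 ‖v‖ with ⟨h1, _⟩ | ⟨h1, _⟩ <;> rcases min_cases 1 ‖w‖ with ⟨h2, _⟩ | ⟨h2, _⟩ <;>
    rw [h1, h2]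
  · exact (min_le_left _ _).trans (by norm_num)
  · exact (min_le_left _ _).trans (by linarith [norm_nonneg w])
  · exact (min_le_left _ _).trans (by linarith [norm_nonneg v])
  · exact (min_le_right _ _).trans h

lemma truncNorm_sum_le {ι : Type*} (s : Finset ι) (v : ι → E) :
    truncNorm (∑ i ∈ s, v i) ≤ ∑ i ∈ s, truncNorm (v i) := by
  induction s using Finset.cons_induction with
  | empty => simp
  | cons a s ha ih =>
    rw [Finset.sum_cons, Finset.sum_cons]
    exact (truncNorm_add_le _ _).trans (by linarith)

lemma truncNorm_sum_sq_le {ι : Type*} (s : Finset ι) (v : ι → E) :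
    truncNorm (∑ i ∈ s, v i) ^ 2 ≤ s.card * ∑ i ∈ s, truncNorm (v i) ^ 2 :=
  (pow_le_pow_left₀ (truncNorm_nonneg _) (truncNorm_sum_le s v) 2).trans
    (sq_sum_le_card_mul_sum_sq)

lemma abs_truncNorm_le_one (v : E) : |truncNorm v| ≤ 1 := by
  rw [abs_of_nonneg (truncNorm_nonneg v)]
  exact truncNorm_le_one v

lemma continuous_truncNorm : Continuous (truncNorm (E := E)) := by
  unfold truncNorm
  fun_prop

end TruncNorm

/-- `f` and its first and second differences are bounded by `K` times the appropriate power of the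
truncated norm of the increment. -/
structure HasBoundedDiffs {E : Type*} [NormedAddCommGroup E] (K : ℝ) (f : E → ℝ) : Prop where
  bound : ∀ x, |f x| ≤ K
  diff : ∀ x v, |f (x + v) - f x| ≤ K * truncNorm v
  diff_two : ∀ x v, |f (x + v) + f (x - v) - 2 * f x| ≤ K * truncNorm v ^ 2

namespace HasBoundedDiffs

variable {E : Type*} [NormedAddCommGroup E] {K L : ℝ} {f g : E → ℝ}

lemma nonneg (hf : HasBoundedDiffs K f) : 0 ≤ K := (abs_nonneg _).trans (hf.bound 0)

lemma mono (hf : HasBoundedDiffs K f) (h : K ≤ L) : HasBoundedDiffs L f where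
  bound x := (hf.bound x).trans h
  diff x v := (hf.diff x v).trans (mul_le_mul_of_nonneg_right h (truncNorm_nonneg v))
  diff_two x v := (hf.diff_two x v).trans (mul_le_mul_of_nonneg_right h (sq_nonneg _))

lemma diff' (hf : HasBoundedDiffs K f) (x y : E) : |f y - f x| ≤ K * truncNorm (y - x) := by
  simpa using hf.diff x (y - x)

lemma add (hf : HasBoundedDiffs K f) (hg : HasBoundedDiffs L g) :
    HasBoundedDiffs (K + L) (fun x => f x + g x) where
  bound x := (abs_add_le _ _).trans (add_le_add (hf.bound x) (hg.bound x))
  diff x v := by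
    rw [add_mul, add_sub_add_comm]
    exact (abs_add_le _ _).trans (add_le_add (hf.diff x v) (hg.diff x v))
  diff_two x v := by
    rw [add_mul, show f (x + v) + g (x + v) + (f (x - v) + g (x - v)) - 2 * (f x + g x) =
      f (x + v) + f (x - v) - 2 * f x + (g (x + v) + g (x - v) - 2 * g x) by ring]
    exact (abs_add_le _ _).trans (add_le_add (hf.diff_two x v) (hg.diff_two x v))

lemma const_mul (hf : HasBoundedDiffs K f) (c : ℝ) :
    HasBoundedDiffs (|c| * K) (fun x => c * f x) where
  bound x := by
    rw [abs_mul]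
    exact mul_le_mul_of_nonneg_left (hf.bound x) (abs_nonneg c)
  diff x v := by
    rw [← mul_sub, abs_mul, mul_assoc]
    exact mul_le_mul_of_nonneg_left (hf.diff x v) (abs_nonneg c)
  diff_two x v := by
    rw [show c * f (x + v) + c * f (x - v) - 2 * (c * f x) =
      c * (f (x + v) + f (x - v) - 2 * f x) by ring, abs_mul, mul_assoc]
    exact mul_le_mul_of_nonneg_left (hf.diff_two x v) (abs_nonneg c)

lemma sub (hf : HasBoundedDiffs K f) (hg : HasBoundedDiffs L g) :
    HasBoundedDiffs (K + L) (fun x => f x - g x) := by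
  simpa [sub_eq_add_neg] using hf.add (hg.const_mul (-1))

lemma zero : HasBoundedDiffs (E := E) 0 (fun _ => 0) := ⟨by simp, by simp, by simp⟩

lemma sum {ι : Type*} (s : Finset ι) {F : ι → E → ℝ} (h : ∀ i ∈ s, HasBoundedDiffs K (F i)) :
    HasBoundedDiffs (s.card * K) (fun x => ∑ i ∈ s, F i x) := by
  induction s using Finset.cons_induction with
  | empty => simpa using zero
  | cons a s ha ih =>
    simp only [Finset.sum_cons, Finset.card_cons, Nat.cast_add, Nat.cast_one]
    exact ((h a (by simp)).add (ih fun i hi => h i (by simp [hi]))).mono (by linarith)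

/-- The second difference of a product is `f Δ²g + g Δ²f` plus two products of first differences.
Each of the four is at most `K ^ 2` times the squared truncated norm. -/
lemma mul (hf : HasBoundedDiffs K f) (hg : HasBoundedDiffs K g) :
    HasBoundedDiffs (4 * K ^ 2) (fun x => f x * g x) where
  bound x := by
    rw [abs_mul]
    nlinarith [hf.bound x, hg.bound x, abs_nonneg (f x), abs_nonneg (g x), hf.nonneg]
  diff x v := by
    have e : f (x + v) * g (x + v) - f x * g x =
      (f (x + v) - f x) * g (x + v) + f x * (g (x + v) - g x) := by ring
    rw [e]
    refine (abs_add_le _ _).trans ?_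
    rw [abs_mul, abs_mul]
    have h1 : |f (x + v) - f x| * |g (x + v)| ≤ (K * truncNorm v) * K :=
      mul_le_mul (hf.diff x v) (hg.bound _) (abs_nonneg _)
        (mul_nonneg hf.nonneg (truncNorm_nonneg v))
    have h2 : |f x| * |g (x + v) - g x| ≤ K * (K * truncNorm v) :=
      mul_le_mul (hf.bound x) (hg.diff x v) (abs_nonneg _) hf.nonneg
    nlinarith [mul_nonneg (sq_nonneg K) (truncNorm_nonneg v)]
  diff_two x v := by
    have e : f (x + v) * g (x + v) + f (x - v) * g (x - v) - 2 * (f x * g x) =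
      f x * (g (x + v) + g (x - v) - 2 * g x) + (f (x + v) + f (x - v) - 2 * f x) * g x
      + (f (x + v) - f x) * (g (x + v) - g x)
      + (f (x + -v) - f x) * (g (x + -v) - g x) := by
      simp only [← sub_eq_add_neg]
      ring
    have hK := hf.nonneg
    have hw := truncNorm_nonneg v
    have h1 : |f x * (g (x + v) + g (x - v) - 2 * g x)| ≤ K * (K * truncNorm v ^ 2) := by
      rw [abs_mul]
      exact mul_le_mul (hf.bound x) (hg.diff_two x v) (abs_nonneg _) hK
    have h2 : |(f (x + v) + f (x - v) - 2 * f x) * g x| ≤ (K * truncNorm v ^ 2) * K := by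
      rw [abs_mul]
      exact mul_le_mul (hf.diff_two x v) (hg.bound x) (abs_nonneg _) (by positivity)
    have h3 : |(f (x + v) - f x) * (g (x + v) - g x)| ≤ (K * truncNorm v) * (K * truncNorm v) := by
      rw [abs_mul]
      exact mul_le_mul (hf.diff x v) (hg.diff x v) (abs_nonneg _) (by positivity)
    have h4 : |(f (x + -v) - f x) * (g (x + -v) - g x)| ≤
        (K * truncNorm v) * (K * truncNorm v) := by
      rw [abs_mul]
      have h5 := hf.diff x (-v)
      have h6 := hg.diff x (-v)
      rw [truncNorm_neg] at h5 h6
      exact mul_le_mul h5 h6 (abs_nonneg _) (by positivity)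
    rw [e]
    refine (abs_add_le _ _).trans ((add_le_add (abs_add_three _ _ _) le_rfl).trans ?_)
    linarith

lemma integral {α : Type*} [MeasurableSpace α] {μ : Measure α} [IsProbabilityMeasure μ]
    {F : E → α → ℝ} (hm : ∀ x, Measurable (F x)) (hF : ∀ a, HasBoundedDiffs K (fun x => F x a)) :
    HasBoundedDiffs K (fun x => ∫ a, F x a ∂μ) := by
  have hi (x : E) : Integrable (F x) μ :=
    Integrable.of_bound (hm x).aestronglyMeasurable K (ae_of_all _ fun a => (hF a).bound x)
  refine ⟨fun x => abs_integral_le_of_abs_le fun a => (hF a).bound x, fun x v => ?_, fun x v => ?_⟩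
  · rw [← integral_sub (hi _) (hi _)]
    exact abs_integral_le_of_abs_le fun a => (hF a).diff x v
  · have hi2 : Integrable (fun a => F (x + v) a + F (x - v) a) μ := (hi _).add (hi _)
    rw [← integral_const_mul, ← integral_add (hi _) (hi _),
      ← integral_sub hi2 ((hi _).const_mul 2)]
    exact abs_integral_le_of_abs_le fun a => (hF a).diff_two x v

lemma continuous (hf : HasBoundedDiffs K f) : Continuous f := by
  refine continuous_iff_continuousAt.2 fun x => ?_
  rw [ContinuousAt, tendsto_iff_dist_tendsto_zero]
  have h : Tendsto (fun y => K * truncNorm (y - x)) (𝓝 x) (𝓝 0) := by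
    have hc : Continuous fun y => K * truncNorm (y - x) :=
      continuous_const.mul (continuous_truncNorm.comp (by fun_prop))
    simpa using hc.tendsto x
  exact squeeze_zero (fun _ => dist_nonneg) (fun y => by
    simpa [Real.dist_eq] using hf.diff' x y) h

end HasBoundedDiffs

/-! ### The asymptotic variance of an `m`-dependent sequence -/

section AsympVar

variable {E : Type*} [NormedAddCommGroup E] [MeasurableSpace E] {m : ℕ}

/-- The kernel `h x y` has bounded differences in `x`, and is centred in `y` when the entries of
`y` are independent with law `ν`. -/
structure IsCenteredKernel (ν : Measure E) (K : ℝ) (h : E → (Fin (m + 1) → E) → ℝ) : Prop where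
  measurable : Measurable (Function.uncurry h)
  hasBoundedDiffs : ∀ y, HasBoundedDiffs K (fun x => h x y)
  integral_eq_zero : ∀ x, ∫ y, h x (seqBlock m 0 y) ∂iidLaw ν = 0

/-- The covariance of `h x (ξ 0, …, ξ m)` and `h x (ξ k, …, ξ (k + m))`. -/
noncomputable def autocov (ν : Measure E) (h : E → (Fin (m + 1) → E) → ℝ) (k : ℕ) (x : E) : ℝ :=
  ∫ y, h x (seqBlock m 0 y) * h x (seqBlock m k y) ∂iidLaw ν

/-- The asymptotic variance of the `m`-dependent sequence `i ↦ h x (ξ i, …, ξ (i + m))`. -/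
noncomputable def asympVar (ν : Measure E) (h : E → (Fin (m + 1) → E) → ℝ) (x : E) : ℝ :=
  autocov ν h 0 x + 2 * ∑ k ∈ Finset.range m, autocov ν h (k + 1) x

variable {ν : Measure E} [IsProbabilityMeasure ν] {K : ℝ} {h : E → (Fin (m + 1) → E) → ℝ}

namespace IsCenteredKernel

lemma nonneg (hh : IsCenteredKernel ν K h) : 0 ≤ K := (hh.hasBoundedDiffs 0).nonneg

lemma measurable_right (hh : IsCenteredKernel ν K h) (x : E) : Measurable (h x) :=
  hh.measurable.comp measurable_prodMk_left

lemma measurable_seqBlock (hh : IsCenteredKernel ν K h) (x : E) (i : ℕ) :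
    Measurable fun y => h x (seqBlock m i y) :=
  (hh.measurable_right x).comp (_root_.measurable_seqBlock m i)

lemma abs_le (hh : IsCenteredKernel ν K h) (x : E) (y : Fin (m + 1) → E) : |h x y| ≤ K :=
  (hh.hasBoundedDiffs y).bound x

lemma abs_mul_le (hh : IsCenteredKernel ν K h) (x x' : E) (y y' : Fin (m + 1) → E) :
    |h x y * h x' y'| ≤ K ^ 2 := by
  rw [abs_mul, sq]
  exact mul_le_mul (hh.abs_le x y) (hh.abs_le x' y') (abs_nonneg _) hh.nonneg

lemma integral_seqBlock (hh : IsCenteredKernel ν K h) (x : E) (i : ℕ) :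
    ∫ y, h x (seqBlock m i y) ∂iidLaw ν = 0 := by
  rw [← hh.integral_eq_zero x, ← integral_shift i (hh.measurable_seqBlock x 0)]
  simp_rw [seqBlock_shift, add_zero]

lemma integral_seqBlock_mul (hh : IsCenteredKernel ν K h) (x : E) (i k : ℕ) :
    ∫ y, h x (seqBlock m i y) * h x (seqBlock m (i + k) y) ∂iidLaw ν = autocov ν h k x := by
  rw [autocov, ← integral_shift i (F := fun y => h x (seqBlock m 0 y) * h x (seqBlock m k y))
    ((hh.measurable_seqBlock x 0).mul (hh.measurable_seqBlock x k))]
  simp_rw [seqBlock_shift, add_zero]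

lemma integrable_mul (hh : IsCenteredKernel ν K h) (x : E) (i j : ℕ) :
    Integrable (fun y => h x (seqBlock m i y) * h x (seqBlock m j y)) (iidLaw ν) :=
  Integrable.of_bound ((hh.measurable_seqBlock x i).mul
    (hh.measurable_seqBlock x j)).aestronglyMeasurable (K ^ 2)
    (ae_of_all _ fun _ => hh.abs_mul_le x x _ _)

/-- At lags above `m` the two blocks share no entry, so averaging over the first block alone gives
zero. -/
lemma autocov_eq_zero (hh : IsCenteredKernel ν K h) (x : E) {k : ℕ} (hk : m < k) :
    autocov ν h k x = 0 := by
  refine integral_mul_eq_zero_of_splice (i := 0) (j := m + 1) (hh.integrable_mul x 0 k)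
    (fun y y' => ?_) (fun y => ?_)
  · rw [seqBlock_splice_of_disjoint _ _ (by omega)]
  · simp_rw [seqBlock_splice_of_subset (i := 0) (j := m + 1) (l := 0) (m := m) y _ le_rfl (by omega)]
    exact hh.integral_eq_zero x

lemma hasBoundedDiffs_autocov (hh : IsCenteredKernel ν K h) (k : ℕ) :
    HasBoundedDiffs (4 * K ^ 2) (autocov ν h k) :=
  HasBoundedDiffs.integral
    (fun x => (hh.measurable_seqBlock x 0).mul (hh.measurable_seqBlock x k))
    (fun _ => (hh.hasBoundedDiffs _).mul (hh.hasBoundedDiffs _))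

lemma hasBoundedDiffs_asympVar (hh : IsCenteredKernel ν K h) :
    HasBoundedDiffs ((2 * m + 1) * (4 * K ^ 2)) (asympVar ν h) := by
  have h1 := (HasBoundedDiffs.sum (Finset.range m)
    (fun k _ => hh.hasBoundedDiffs_autocov (k + 1))).const_mul 2
  refine ((hh.hasBoundedDiffs_autocov 0).add h1).mono (le_of_eq ?_)
  rw [Finset.card_range, abs_two]
  ring

/-- The increment of the variance of the partial sums. -/
lemma integral_sq_sum_succ (hh : IsCenteredKernel ν K h) (x : E) {M : ℕ} (hM : m ≤ M) :
    ∫ y, (∑ i ∈ Finset.range (M + 1), h x (seqBlock m i y)) ^ 2 ∂iidLaw ν =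
      ∫ y, (∑ i ∈ Finset.range M, h x (seqBlock m i y)) ^ 2 ∂iidLaw ν + asympVar ν h x := by
  have e (y : ℕ → E) : (∑ i ∈ Finset.range (M + 1), h x (seqBlock m i y)) ^ 2 =
      (∑ i ∈ Finset.range M, h x (seqBlock m i y)) ^ 2 +
      (h x (seqBlock m M y) * h x (seqBlock m M y) +
        2 * ∑ k ∈ Finset.range M, h x (seqBlock m k y) * h x (seqBlock m M y)) := by
    rw [Finset.sum_range_succ, add_sq, mul_assoc 2, Finset.sum_mul]
    ring
  simp_rw [e]
  have hi2 : Integrable (fun y => ∑ k ∈ Finset.range M, h x (seqBlock m k y) *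
      h x (seqBlock m M y)) (iidLaw ν) := integrable_finsetSum _ fun k _ => hh.integrable_mul x k M
  have hi3 : Integrable (fun y => h x (seqBlock m M y) * h x (seqBlock m M y) +
        2 * ∑ k ∈ Finset.range M, h x (seqBlock m k y) * h x (seqBlock m M y)) (iidLaw ν) :=
    (hh.integrable_mul x M M).add (hi2.const_mul 2)
  have hi1 : Integrable (fun y => (∑ i ∈ Finset.range M, h x (seqBlock m i y)) ^ 2)
      (iidLaw ν) := by
    simp_rw [sq, Finset.sum_mul_sum]
    exact integrable_finsetSum _ fun i _ => integrable_finsetSum _ fun j _ =>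
      hh.integrable_mul x i j
  rw [integral_add hi1 hi3, integral_add (hh.integrable_mul x M M) (hi2.const_mul 2),
    integral_const_mul, integral_finsetSum _ fun k _ => hh.integrable_mul x k M, asympVar]
  have h0 : ∫ y, h x (seqBlock m M y) * h x (seqBlock m M y) ∂iidLaw ν = autocov ν h 0 x :=
    hh.integral_seqBlock_mul x M 0
  have hs : ∑ k ∈ Finset.range M, ∫ y, h x (seqBlock m k y) * h x (seqBlock m M y) ∂iidLaw ν =
      ∑ k ∈ Finset.range m, autocov ν h (k + 1) x := by
    -- Reindexed by the lag `k + 1` to the last block; only the lags `1, …, m` survive.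
    rw [← Finset.sum_range_reflect]
    have : ∀ k ∈ Finset.range M, ∫ y, h x (seqBlock m (M - 1 - k) y) * h x (seqBlock m M y)
        ∂iidLaw ν = autocov ν h (k + 1) x := fun k hk => by
      have hk' := Finset.mem_range.1 hk
      rw [← hh.integral_seqBlock_mul x (M - 1 - k) (k + 1), show M - 1 - k + (k + 1) = M by omega]
    rw [Finset.sum_congr rfl this]
    refine (Finset.sum_subset (Finset.range_mono hM) fun k _ hk => ?_).symm
    exact hh.autocov_eq_zero x (by simpa [Nat.lt_succ_iff] using hk)
  rw [h0, hs]

/-- From `M = m` on, the variance of the partial sums is affine in the number of terms with slope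
`asympVar`. A negative slope would eventually make a variance negative. -/
lemma asympVar_nonneg (hh : IsCenteredKernel ν K h) (x : E) : 0 ≤ asympVar ν h x := by
  set V : ℕ → ℝ := fun M => ∫ y, (∑ i ∈ Finset.range M, h x (seqBlock m i y)) ^ 2 ∂iidLaw ν
  have hV (M : ℕ) : 0 ≤ V M := integral_nonneg fun y => sq_nonneg _
  have hk (k : ℕ) : V (m + k) = V m + k * asympVar ν h x := by
    induction k with
    | zero => simp
    | succ k ih =>
      have := hh.integral_sq_sum_succ x (M := m + k) (by omega)
      rw [← add_assoc]
      change V (m + k + 1) = V (m + k) + _ at this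
      rw [this, ih]
      push_cast
      ring
  by_contra hneg
  rw [not_le] at hneg
  obtain ⟨k, hk2⟩ := exists_nat_gt (V m / -asympVar ν h x)
  rw [div_lt_iff₀ (by linarith)] at hk2
  have := hV (m + k)
  rw [hk] at this
  linarith

/-- The local second-order term of the Lindeberg expansion, with the spatial variable frozen. -/
lemma integral_frozen_eq_zero (hh : IsCenteredKernel ν K h) (x : E) {i : ℕ} (hi : m ≤ i) :
    ∫ y, (h x (seqBlock m i y) ^ 2 / 2 + h x (seqBlock m i y) *
      (∑ k ∈ Finset.range m, h x (seqBlock m (i - m + k) y)) - asympVar ν h x / 2) ∂iidLaw ν = 0 := by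
  have e (y : ℕ → E) : h x (seqBlock m i y) ^ 2 / 2 + h x (seqBlock m i y) *
      (∑ k ∈ Finset.range m, h x (seqBlock m (i - m + k) y)) - asympVar ν h x / 2 =
      (2⁻¹ * (h x (seqBlock m i y) * h x (seqBlock m i y)) +
        ∑ k ∈ Finset.range m, h x (seqBlock m (i - m + k) y) * h x (seqBlock m i y))
        - asympVar ν h x / 2 := by
    rw [Finset.mul_sum]
    simp_rw [mul_comm (h x (seqBlock m i y)) (h x (seqBlock m (i - m + _) y))]
    ring
  simp_rw [e]
  have hi2 : Integrable (fun y => ∑ k ∈ Finset.range m, h x (seqBlock m (i - m + k) y) *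
      h x (seqBlock m i y)) (iidLaw ν) := integrable_finsetSum _ fun k _ => hh.integrable_mul x _ i
  have hi1 := (hh.integrable_mul x i i).const_mul 2⁻¹
  have hi3 : Integrable (fun y => 2⁻¹ * (h x (seqBlock m i y) * h x (seqBlock m i y)) +
        ∑ k ∈ Finset.range m, h x (seqBlock m (i - m + k) y) * h x (seqBlock m i y))
        (iidLaw ν) := hi1.add hi2
  have h0 : ∫ y, h x (seqBlock m i y) * h x (seqBlock m i y) ∂iidLaw ν = autocov ν h 0 x :=
    hh.integral_seqBlock_mul x i 0
  -- Each lag `1, …, m` appears once here against twice in `asympVar`, matching the halved square.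
  have hs : ∑ k ∈ Finset.range m, ∫ y, h x (seqBlock m (i - m + k) y) * h x (seqBlock m i y)
      ∂iidLaw ν = ∑ k ∈ Finset.range m, autocov ν h (k + 1) x := by
    rw [← Finset.sum_range_reflect]
    refine Finset.sum_congr rfl fun k hk => ?_
    have hk' := Finset.mem_range.1 hk
    rw [← hh.integral_seqBlock_mul x (i - m + (m - 1 - k)) (k + 1),
      show i - m + (m - 1 - k) + (k + 1) = i by omega]
  rw [integral_sub hi3 (integrable_const _), integral_add hi1 hi2, integral_const_mul,
    integral_finsetSum _ fun k _ => hh.integrable_mul x _ i, h0, hs, asympVar]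
  simp
  ring

end IsCenteredKernel

end AsympVar

/-! ### The Lindeberg expansion -/

lemma continuous_gaussSmooth {φ : ℝ → ℝ} (hc : Continuous φ) (hb : ∀ x, |φ x| ≤ 1) :
    Continuous (fun p : ℝ × ℝ => gaussSmooth φ p.1 p.2) :=
  continuous_of_dominated (bound := fun _ => 1) (fun p => by fun_prop)
    (fun p => ae_of_all _ fun y => hb _) (integrable_const _)
    (ae_of_all _ fun y => by fun_prop)

/-- One step of the Lindeberg expansion. -/
lemma BoundedDerivs.abs_lindeberg_step_le {f : ℕ → ℝ → ℝ} (hf : BoundedDerivs 5 f)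
    {L r s₀ s₁ s z v₀ v q : ℝ} (hL : 1 ≤ L) (hL4 : gaussFourthMoment ≤ L) (hr : 0 ≤ r) (hr1 : r ≤ 1)
    (hv₀ : 0 ≤ v₀) (hv : 0 ≤ v) (hq : 0 ≤ q) (hz : |z| ≤ L * r) (hs : |s - s₁| ≤ L ^ 2 * r)
    (hs₁ : |s₁ - s₀| ≤ L ^ 2 * r) (hvv : |v₀ - v| ≤ L ^ 2 * r ^ 2) (hqL : q ≤ L * r ^ 2) :
    |gaussSmooth (f 0) (s + z) v₀ - gaussSmooth (f 0) s (v₀ + q) - z * gaussSmooth (f 1) s₁ v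
      - (z ^ 2 / 2 + z * (s - s₁) - q / 2) * gaussSmooth (f 2) s₀ v| ≤ 11 * L ^ 5 * r ^ 3 := by
  have hL0 : 0 ≤ L := by linarith
  have hLp (k l : ℕ) (hkl : k ≤ l) : L ^ k ≤ L ^ l := pow_le_pow_right₀ hL hkl
  have hr2 : r ^ 2 ≤ r := by nlinarith
  -- `h1` expands in the jump `z` and `h2` in the variance step `q`. Then `h3` and `h4` move the
  -- first derivative from `(s, v₀)` to `(s₁, v)`; the correction `z * (s - s₁)` made in `h3` joins
  -- the second-order coefficient. Finally `h5` and `h6` move the second derivative to `(s₀, v)`.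
  -- The six errors add up to `9 * L ^ 5 * r ^ 3`, which is below the stated bound.
  have h1 : |gaussSmooth (f 0) (s + z) v₀ - gaussSmooth (f 0) s v₀ - z * gaussSmooth (f 1) s v₀
      - z ^ 2 / 2 * gaussSmooth (f 2) s v₀| ≤ L ^ 5 * r ^ 3 := by
    refine ((hf.mono (by norm_num)).gaussSmooth_taylor_three s z v₀).trans ?_
    calc |z| ^ 3 ≤ (L * r) ^ 3 := by gcongr
      _ = L ^ 3 * r ^ 3 := by ring
      _ ≤ L ^ 5 * r ^ 3 := by gcongr; norm_num
  have h2 : |gaussSmooth (f 0) s (v₀ + q) - gaussSmooth (f 0) s v₀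
      - q / 2 * gaussSmooth (f 2) s v₀| ≤ L ^ 5 * r ^ 3 := by
    refine ((hf.mono (by norm_num)).abs_gaussSmooth_add_sub_sub_le s hv₀ hq).trans ?_
    calc gaussFourthMoment * q ^ 2 ≤ L * (L * r ^ 2) ^ 2 := by gcongr
      _ = L ^ 3 * (r ^ 3 * r) := by ring
      _ ≤ L ^ 5 * (r ^ 3 * 1) := by gcongr; norm_num
      _ = L ^ 5 * r ^ 3 := by ring
  have h3 : |z * (gaussSmooth (f 1) s v₀ - gaussSmooth (f 1) s₁ v₀
      - (s - s₁) * gaussSmooth (f 2) s₁ v₀)| ≤ L ^ 5 * r ^ 3 := by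
    have := (hf.shift (i := 1) (j := 2) (by norm_num)).gaussSmooth_taylor_two s₁ (s - s₁) v₀
    rw [add_sub_cancel] at this
    rw [abs_mul]
    calc _ ≤ (L * r) * (s - s₁) ^ 2 := by gcongr
      _ = (L * r) * |s - s₁| ^ 2 := by rw [sq_abs]
      _ ≤ (L * r) * (L ^ 2 * r) ^ 2 := by gcongr
      _ = L ^ 5 * r ^ 3 := by ring
  have h4 : |z * (gaussSmooth (f 1) s₁ v₀ - gaussSmooth (f 1) s₁ v)| ≤ L ^ 5 * r ^ 3 := by
    have := (hf.shift (i := 1) (j := 2) (by norm_num)).abs_gaussSmooth_sub_le s₁ hv hv₀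
    rw [abs_mul]
    calc _ ≤ (L * r) * (L ^ 2 * r ^ 2) := by gcongr; exact this.trans hvv
      _ = L ^ 3 * r ^ 3 := by ring
      _ ≤ L ^ 5 * r ^ 3 := by gcongr; norm_num
  have hΦ (a a' : ℝ) : |gaussSmooth (f 2) a v₀ - gaussSmooth (f 2) a' v| ≤
      |a - a'| + L ^ 2 * r := by
    have e1 := (hf.shift (i := 2) (j := 2) (by norm_num)).abs_gaussSmooth_sub_le a hv hv₀
    have e2 := (hf.shift (i := 2) (j := 1) (by norm_num)).gaussSmooth_taylor_one a' (a - a') v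
    rw [add_sub_cancel] at e2
    simp only [zero_add] at e1 e2
    have e3 : L ^ 2 * r ^ 2 ≤ L ^ 2 * r := by gcongr
    rw [show gaussSmooth (f 2) a v₀ - gaussSmooth (f 2) a' v =
      (gaussSmooth (f 2) a v₀ - gaussSmooth (f 2) a v) +
        (gaussSmooth (f 2) a v - gaussSmooth (f 2) a' v) by ring]
    refine (abs_add_le _ _).trans ?_
    linarith
  have h5 : |(z ^ 2 / 2 - q / 2) * (gaussSmooth (f 2) s v₀ - gaussSmooth (f 2) s₀ v)| ≤
      3 * (L ^ 5 * r ^ 3) := by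
    have e1 : |z ^ 2 / 2 - q / 2| ≤ L ^ 2 * r ^ 2 := by
      have ez : z ^ 2 ≤ L ^ 2 * r ^ 2 := by
        rw [← sq_abs, ← mul_pow]
        gcongr
      have eq' : q ≤ L ^ 2 * r ^ 2 := hqL.trans (by gcongr; nlinarith)
      rw [abs_le]
      constructor <;> nlinarith [sq_nonneg z]
    have e2 : |s - s₀| ≤ 2 * (L ^ 2 * r) := by
      rw [show s - s₀ = (s - s₁) + (s₁ - s₀) by ring]
      exact (abs_add_le _ _).trans (by linarith)
    rw [abs_mul]
    calc _ ≤ (L ^ 2 * r ^ 2) * (2 * (L ^ 2 * r) + L ^ 2 * r) := by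
          gcongr
          exact (hΦ s s₀).trans (by gcongr)
      _ = 3 * (L ^ 4 * r ^ 3) := by ring
      _ ≤ 3 * (L ^ 5 * r ^ 3) := by gcongr; norm_num
  have h6 : |z * (s - s₁) * (gaussSmooth (f 2) s₁ v₀ - gaussSmooth (f 2) s₀ v)| ≤
      2 * (L ^ 5 * r ^ 3) := by
    rw [abs_mul, abs_mul]
    calc _ ≤ (L * r) * (L ^ 2 * r) * (L ^ 2 * r + L ^ 2 * r) := by
          gcongr
          exact (hΦ s₁ s₀).trans (by gcongr)
      _ = 2 * (L ^ 5 * r ^ 3) := by ring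
  rw [abs_le] at *
  constructor <;> linarith

/-! ### The walk, its partial sums and the remaining variance. -/

section Walk

variable {E : Type*} [NormedAddCommGroup E] [NormedSpace ℝ E] {m : ℕ}

/-- The random walk with steps `b • y l`. -/
def walk (b : ℝ) (i : ℕ) (y : ℕ → E) : E := b • ∑ l ∈ Finset.range i, y l

/-- The normalised partial sums of `h (walk b l y) (y l, …, y (l + m))`. -/
def partialSum (h : E → (Fin (m + 1) → E) → ℝ) (b r : ℝ) (i : ℕ) (y : ℕ → E) : ℝ :=
  r * ∑ l ∈ Finset.range i, h (walk b l y) (seqBlock m l y)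

/-- The sum of the values of `q` along the walk between times `i` and `N`. -/
def remVar (q : E → ℝ) (b r : ℝ) (N i : ℕ) (y : ℕ → E) : ℝ :=
  r ^ 2 * ∑ l ∈ Finset.Ico i N, q (walk b l y)

lemma walk_splice_of_le (b : ℝ) {i j l : ℕ} (y y' : ℕ → E) (h : l ≤ i) :
    walk b l (splice i j y y') = walk b l y := by
  unfold walk
  congr 1
  refine Finset.sum_congr rfl fun k hk => splice_of_notMem _ _ ?_
  have := Finset.mem_range.1 hk
  omega

/-- Changing the steps in a window translates all later positions by one common vector. Taking the
window filled with zeros as the reference makes this vector the sum of the new steps. -/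
lemma walk_splice_of_ge (b : ℝ) {i j l : ℕ} (y y' : ℕ → E) (hij : i ≤ j) (h : j ≤ l) :
    walk b l (splice i j y y') =
      walk b l (splice i j y 0) + b • ∑ k ∈ Finset.Ico i j, y' k := by
  have key (y' : ℕ → E) : ∑ k ∈ Finset.range l, splice i j y y' k =
      ∑ k ∈ Finset.range i, y k + ∑ k ∈ Finset.Ico i j, y' k + ∑ k ∈ Finset.Ico j l, y k := by
    rw [Finset.range_eq_Ico, ← Finset.sum_Ico_consecutive _ (Nat.zero_le j) h,
      ← Finset.sum_Ico_consecutive _ (Nat.zero_le i) hij, Finset.range_eq_Ico]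
    congr 1
    · congr 1
      · refine Finset.sum_congr rfl fun k hk => splice_of_notMem _ _ ?_
        have := Finset.mem_Ico.1 hk
        omega
      · refine Finset.sum_congr rfl fun k hk => splice_of_mem _ _ ?_
        have := Finset.mem_Ico.1 hk
        omega
    · refine Finset.sum_congr rfl fun k hk => splice_of_notMem _ _ ?_
      have := Finset.mem_Ico.1 hk
      omega
  rw [walk, walk, key, key, ← smul_add]
  congr 1
  simp
  abel

lemma splice_self {α : Type*} (i j : ℕ) (y : ℕ → α) : splice i j y y = y := by
  ext l
  simp [splice]

lemma walk_eq_splice_zero_add (b : ℝ) {i j l : ℕ} (y : ℕ → E) (hij : i ≤ j) (h : j ≤ l) :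
    walk b l y = walk b l (splice i j y 0) + b • ∑ k ∈ Finset.Ico i j, y k := by
  conv_lhs => rw [← splice_self i j y]
  exact walk_splice_of_ge b y y hij h

lemma walk_sub_walk (b : ℝ) {i j : ℕ} (y : ℕ → E) (hij : i ≤ j) :
    walk b j y - walk b i y = ∑ k ∈ Finset.Ico i j, b • y k := by
  rw [walk, walk, ← smul_sub, Finset.sum_Ico_eq_sub _ hij, ← Finset.smul_sum, ← Finset.smul_sum,
    smul_sub]

/-- The last summand has index `p - 1` and reads entries up to `p - 1 + m < i`. -/
lemma partialSum_splice (h : E → (Fin (m + 1) → E) → ℝ) (b r : ℝ) {i j p : ℕ} (y y' : ℕ → E)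
    (hp : p + m ≤ i) : partialSum h b r p (splice i j y y') = partialSum h b r p y := by
  unfold partialSum
  congr 1
  refine Finset.sum_congr rfl fun l hl => ?_
  have := Finset.mem_range.1 hl
  rw [walk_splice_of_le b y y' (by omega), seqBlock_splice_of_disjoint y y' (by omega)]

lemma partialSum_succ (h : E → (Fin (m + 1) → E) → ℝ) (b r : ℝ) (i : ℕ) (y : ℕ → E) :
    partialSum h b r (i + 1) y =
      partialSum h b r i y + r * h (walk b i y) (seqBlock m i y) := by
  simp [partialSum, Finset.sum_range_succ, mul_add]

lemma partialSum_add_sub (h : E → (Fin (m + 1) → E) → ℝ) (b r : ℝ) (p k : ℕ) (y : ℕ → E) :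
    partialSum h b r (p + k) y - partialSum h b r p y =
      r * ∑ l ∈ Finset.range k, h (walk b (p + l) y) (seqBlock m (p + l) y) := by
  simp [partialSum, Finset.sum_range_add, mul_add]

lemma remVar_eq_succ_add (q : E → ℝ) (b r : ℝ) {N i : ℕ} (hi : i < N) (y : ℕ → E) :
    remVar q b r N i y = remVar q b r N (i + 1) y + r ^ 2 * q (walk b i y) := by
  rw [remVar, remVar, Finset.sum_eq_sum_Ico_succ_bot hi]
  ring

lemma remVar_self (q : E → ℝ) (b r : ℝ) (N : ℕ) (y : ℕ → E) : remVar q b r N N y = 0 := by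
  simp [remVar]

lemma remVar_nonneg {q : E → ℝ} (hq : ∀ x, 0 ≤ q x) (b r : ℝ) (N i : ℕ) (y : ℕ → E) :
    0 ≤ remVar q b r N i y :=
  mul_nonneg (sq_nonneg r) (Finset.sum_nonneg fun _ _ => hq _)

/-- At most `k` terms are dropped, and fewer when `i + k` exceeds `N`. -/
lemma abs_remVar_sub_le {q : E → ℝ} {L : ℝ} (hq : ∀ x, |q x| ≤ L) (b r : ℝ) (N i k : ℕ)
    (y : ℕ → E) :
    |remVar q b r N i y - remVar q b r N (i + k) y| ≤ r ^ 2 * (k * L) := by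
  have hL : 0 ≤ L := (abs_nonneg _).trans (hq 0)
  have hk : ∑ l ∈ Finset.Ico i N, q (walk b l y) - ∑ l ∈ Finset.Ico (i + k) N, q (walk b l y) =
      ∑ l ∈ Finset.Ico i N \ Finset.Ico (i + k) N, q (walk b l y) := by
    rw [eq_comm, Finset.sum_sdiff_eq_sub]
    exact Finset.Ico_subset_Ico_left (by omega)
  rw [remVar, remVar, ← mul_sub, abs_mul, abs_of_nonneg (sq_nonneg r), hk]
  gcongr
  refine (Finset.abs_sum_le_sum_abs _ _).trans ((Finset.sum_le_card_nsmul _ _ L fun l _ => hq _).trans ?_)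
  rw [nsmul_eq_mul]
  gcongr
  have : Finset.Ico i N \ Finset.Ico (i + k) N ⊆ Finset.Ico i (i + k) := by
    intro l
    simp only [Finset.mem_sdiff, Finset.mem_Ico]
    omega
  simpa using Finset.card_le_card this

/-- The change of `remVar` when the steps before `j` are modified. -/
lemma abs_remVar_sub_le_of_walk {q : E → ℝ} {L : ℝ} (hq : HasBoundedDiffs L q) (b : ℝ) {r : ℝ}
    {N j : ℕ} (hN : N * r ^ 2 ≤ L) {y y' : ℕ → E} {v : E}
    (hw : ∀ l, j ≤ l → walk b l y' = walk b l y + v) :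
    |remVar q b r N j y' - remVar q b r N j y| ≤ L ^ 2 * truncNorm v := by
  have hL := hq.nonneg
  rw [remVar, remVar, ← mul_sub, abs_mul, abs_of_nonneg (sq_nonneg r), ← Finset.sum_sub_distrib]
  have h1 : |∑ l ∈ Finset.Ico j N, (q (walk b l y') - q (walk b l y))| ≤ N * (L * truncNorm v) := by
    refine (Finset.abs_sum_le_sum_abs _ _).trans ((Finset.sum_le_card_nsmul _ _
      (L * truncNorm v) fun l hl => ?_).trans ?_)
    · rw [hw l (Finset.mem_Ico.1 hl).1]
      exact hq.diff _ _
    · rw [nsmul_eq_mul, Nat.card_Ico]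
      have := truncNorm_nonneg v
      gcongr
      omega
  calc _ ≤ r ^ 2 * (N * (L * truncNorm v)) := by gcongr
    _ = (N * r ^ 2) * (L * truncNorm v) := by ring
    _ ≤ L * (L * truncNorm v) := by
      gcongr
      exact mul_nonneg hL (truncNorm_nonneg v)
    _ = _ := by ring

/-- The second difference of `remVar` when the steps before `j` are modified. -/
lemma abs_remVar_second_diff_le {q : E → ℝ} {L : ℝ} (hq : HasBoundedDiffs L q) (b : ℝ) {r : ℝ}
    {N j : ℕ} (hN : N * r ^ 2 ≤ L) {y y₁ y₂ : ℕ → E} {v : E}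
    (hw₁ : ∀ l, j ≤ l → walk b l y₁ = walk b l y + v)
    (hw₂ : ∀ l, j ≤ l → walk b l y₂ = walk b l y - v) :
    |remVar q b r N j y₁ + remVar q b r N j y₂ - 2 * remVar q b r N j y| ≤
      L ^ 2 * truncNorm v ^ 2 := by
  have hL := hq.nonneg
  have e : remVar q b r N j y₁ + remVar q b r N j y₂ - 2 * remVar q b r N j y =
      r ^ 2 * ∑ l ∈ Finset.Ico j N,
        (q (walk b l y₁) + q (walk b l y₂) - 2 * q (walk b l y)) := by
    simp only [remVar, Finset.sum_sub_distrib, Finset.sum_add_distrib, ← Finset.mul_sum]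
    ring
  rw [e, abs_mul, abs_of_nonneg (sq_nonneg r)]
  have h1 : |∑ l ∈ Finset.Ico j N, (q (walk b l y₁) + q (walk b l y₂) - 2 * q (walk b l y))| ≤
      N * (L * truncNorm v ^ 2) := by
    refine (Finset.abs_sum_le_sum_abs _ _).trans ((Finset.sum_le_card_nsmul _ _
      (L * truncNorm v ^ 2) fun l hl => ?_).trans ?_)
    · rw [hw₁ l (Finset.mem_Ico.1 hl).1, hw₂ l (Finset.mem_Ico.1 hl).1]
      exact hq.diff_two _ _
    · rw [nsmul_eq_mul, Nat.card_Ico]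
      gcongr
      omega
  calc _ ≤ r ^ 2 * (N * (L * truncNorm v ^ 2)) := by gcongr
    _ = (N * r ^ 2) * (L * truncNorm v ^ 2) := by ring
    _ ≤ L * (L * truncNorm v ^ 2) := by gcongr
    _ = _ := by ring

end Walk

/-! ### Measurability, and the first-order term of the expansion. -/

section Lindeberg

variable {E : Type*} [NormedAddCommGroup E] [NormedSpace ℝ E] [MeasurableSpace E] [BorelSpace E]
  [SecondCountableTopology E] {m : ℕ}

@[fun_prop]
lemma measurable_walk (b : ℝ) (i : ℕ) : Measurable (walk (E := E) b i) := by
  unfold walk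
  fun_prop

lemma measurable_partialSum {h : E → (Fin (m + 1) → E) → ℝ} (hh : Measurable (Function.uncurry h))
    (b r : ℝ) (i : ℕ) : Measurable (partialSum h b r i) := by
  unfold partialSum
  refine Measurable.const_mul (Finset.measurable_sum _ fun l _ => ?_) r
  exact hh.comp ((measurable_walk b l).prodMk (measurable_seqBlock m l))

lemma measurable_remVar {q : E → ℝ} (hq : Measurable q) (b r : ℝ) (N i : ℕ) :
    Measurable (remVar q b r N i) := by
  unfold remVar
  refine Measurable.const_mul (Finset.measurable_sum _ fun l _ => ?_) _
  exact hq.comp (measurable_walk b l)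

lemma measurable_truncNorm : Measurable (truncNorm (E := E)) := continuous_truncNorm.measurable

variable {ν : Measure E} [IsProbabilityMeasure ν] {L : ℝ} {h : E → (Fin (m + 1) → E) → ℝ}

lemma integrable_truncNorm_pow {α : Type*} [MeasurableSpace α] {μ : Measure α}
    [IsProbabilityMeasure μ] {F : α → E} (hF : Measurable F) (p : ℕ) :
    Integrable (fun a => truncNorm (F a) ^ p) μ :=
  Integrable.of_bound ((measurable_truncNorm.comp hF).pow_const p).aestronglyMeasurable 1
    (ae_of_all _ fun a => by
      rw [Real.norm_of_nonneg (pow_nonneg (truncNorm_nonneg _) p)]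
      exact pow_le_one₀ (truncNorm_nonneg _) (truncNorm_le_one _))

lemma integrable_truncNorm {α : Type*} [MeasurableSpace α] {μ : Measure α}
    [IsProbabilityMeasure μ] {F : α → E} (hF : Measurable F) :
    Integrable (fun a => truncNorm (F a)) μ := by
  simpa using integrable_truncNorm_pow hF 1

lemma integral_sum_truncNorm (b : ℝ) (i j : ℕ) (p : ℕ) :
    ∫ y, ∑ k ∈ Finset.Ico i j, truncNorm (b • y k) ^ p ∂iidLaw ν =
      (j - i : ℕ) * ∫ x, truncNorm (b • x) ^ p ∂ν := by
  rw [integral_finsetSum _ fun k _ => integrable_truncNorm_pow (by fun_prop) p]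
  have (k : ℕ) : ∫ y, truncNorm (b • y k) ^ p ∂iidLaw ν = ∫ x, truncNorm (b • x) ^ p ∂ν :=
    integral_apply_iidLaw k (F := fun x => truncNorm (b • x) ^ p)
      ((measurable_truncNorm.comp (by fun_prop)).pow_const p)
  simp_rw [this]
  simp

lemma integral_truncNorm_smul_sum_le (b : ℝ) (i j : ℕ) :
    ∫ y, truncNorm (b • ∑ k ∈ Finset.Ico i j, y k) ∂iidLaw ν ≤
      (j - i : ℕ) * ∫ x, truncNorm (b • x) ∂ν := by
  have := integral_sum_truncNorm (ν := ν) b i j 1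
  simp only [pow_one] at this
  rw [← this]
  refine integral_mono (integrable_truncNorm (by fun_prop))
    (integrable_finsetSum _ fun k _ => integrable_truncNorm (by fun_prop)) fun y => ?_
  simp only [Finset.smul_sum]
  exact truncNorm_sum_le _ _

lemma integral_truncNorm_smul_sum_sq_le (b : ℝ) (i j : ℕ) :
    ∫ y, truncNorm (b • ∑ k ∈ Finset.Ico i j, y k) ^ 2 ∂iidLaw ν ≤
      (j - i : ℕ) * ((j - i : ℕ) * ∫ x, truncNorm (b • x) ^ 2 ∂ν) := by
  rw [← integral_sum_truncNorm (ν := ν) b i j 2, ← integral_const_mul]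
  refine integral_mono (integrable_truncNorm_pow (by fun_prop) 2)
    ((integrable_finsetSum _ fun k _ => integrable_truncNorm_pow (by fun_prop) 2).const_mul _)
    fun y => ?_
  simp only [Finset.smul_sum]
  simpa using truncNorm_sum_sq_le (Finset.Ico i j) fun k => b • y k

lemma abs_integral_le_of_abs_le_integrable {α : Type*} [MeasurableSpace α] {μ : Measure α}
    {F G : α → ℝ} (hG : Integrable G μ) (h : ∀ a, |F a| ≤ G a) : |∫ a, F a ∂μ| ≤ ∫ a, G a ∂μ :=
  norm_integral_le_of_norm_le (f := F) hG (ae_of_all _ h)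

namespace IsCenteredKernel

lemma measurable_summand (hh : IsCenteredKernel ν L h) (b : ℝ) (i : ℕ) :
    Measurable fun y => h (walk b i y) (seqBlock m i y) :=
  hh.measurable.comp ((measurable_walk b i).prodMk (_root_.measurable_seqBlock m i))

lemma measurable_asympVar (hh : IsCenteredKernel ν L h) : Measurable (asympVar ν h) :=
  hh.hasBoundedDiffs_asympVar.continuous.measurable

/-- The composition of a smoothed test function with the partial sum and the remaining variance. -/
lemma measurable_smooth (hh : IsCenteredKernel ν L h) {φ : ℝ → ℝ} (hc : Continuous φ)
    (hb : ∀ x, |φ x| ≤ 1) (b r : ℝ) (N i j : ℕ) :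
    Measurable fun y => gaussSmooth φ (partialSum h b r i y)
      (remVar (asympVar ν h) b r N j y) :=
  (continuous_gaussSmooth hc hb).measurable.comp ((measurable_partialSum hh.measurable b r i).prodMk
    (measurable_remVar hh.measurable_asympVar b r N j))

/-- The first-order term vanishes when the steps of the current block are removed from the
remaining variance. -/
lemma integral_first_order_eq_zero (hh : IsCenteredKernel ν L h) {φ : ℝ → ℝ} (hc : Continuous φ)
    (hb : ∀ x, |φ x| ≤ 1) (b r : ℝ) (N : ℕ) {p i : ℕ} (hp : p + m ≤ i) :
    ∫ y, h (walk b i y) (seqBlock m i y) *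
      gaussSmooth φ (partialSum h b r p y)
        (remVar (asympVar ν h) b r N (i + m + 1) (splice i (i + m + 1) y 0)) ∂iidLaw ν = 0 := by
  have hs : Measurable fun y : ℕ → E => splice i (i + m + 1) y 0 :=
    (measurable_splice i (i + m + 1)).comp (measurable_id.prodMk measurable_const)
  have hm : Measurable fun y : ℕ → E => gaussSmooth φ (partialSum h b r p y)
      (remVar (asympVar ν h) b r N (i + m + 1) (splice i (i + m + 1) y 0)) :=
    (continuous_gaussSmooth hc hb).measurable.comp
      ((measurable_partialSum hh.measurable b r p).prodMk
        ((measurable_remVar hh.measurable_asympVar b r N _).comp hs))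
  -- The window is exactly the set of entries read by the block at `i`. The position at time `i` and
  -- the sum at `p ≤ i - m` use only earlier entries, and the window has been blanked in the
  -- remaining variance.
  refine integral_mul_eq_zero_of_splice (i := i) (j := i + m + 1) ?_ (fun y y' => ?_) fun y => ?_
  · refine Integrable.of_bound ((hh.measurable_summand b i).mul hm).aestronglyMeasurable L
      (ae_of_all _ fun y => ?_)
    rw [norm_mul, ← mul_one L]
    exact mul_le_mul (hh.abs_le _ _) (abs_gaussSmooth_le hb _ _) (norm_nonneg _) hh.nonneg
  · rw [partialSum_splice h b r y y' hp]
    congr 2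
    ext l
    by_cases hl : i ≤ l ∧ l < i + m + 1
    · simp [splice_of_mem _ _ hl]
    · simp [splice_of_notMem _ _ hl]
  · simp_rw [walk_splice_of_le b y _ le_rfl,
      seqBlock_splice_of_subset (m := m) (i := i) (j := i + m + 1) (l := i) y _ le_rfl
        (Nat.lt_succ_self _)]
    exact hh.integral_seqBlock _ i

section FirstOrder

variable {f : ℕ → ℝ → ℝ} {b r : ℝ} {N p i : ℕ}

/-- Subtract the same integral with the window blanked, which vanishes. The remaining variance then
changes by at most `L ^ 2` times the truncated norm of the displacement caused by the window, and
smoothing is 1-Lipschitz in the variance. -/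
lemma abs_integral_first_order_le (hh : IsCenteredKernel ν L h)
    (hq : HasBoundedDiffs L (asympVar ν h)) (hf : BoundedDerivs 2 f)
    (hN : N * r ^ 2 ≤ L) (hp : p + m ≤ i) :
    |∫ y, h (walk b i y) (seqBlock m i y) * gaussSmooth (f 0) (partialSum h b r p y)
        (remVar (asympVar ν h) b r N (i + m + 1) y) ∂iidLaw ν| ≤
      L ^ 3 * ((m + 1) * ∫ x, truncNorm (b • x) ∂ν) := by
  have hc := hf.continuous (l := 0) (by norm_num)
  have hb := hf.bound 0 (by norm_num)
  have hL := hh.nonneg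
  have hs : Measurable fun y : ℕ → E => splice i (i + m + 1) y 0 :=
    (measurable_splice i (i + m + 1)).comp (measurable_id.prodMk measurable_const)
  have hm : Measurable fun y : ℕ → E => gaussSmooth (f 0) (partialSum h b r p y)
      (remVar (asympVar ν h) b r N (i + m + 1) (splice i (i + m + 1) y 0)) :=
    (continuous_gaussSmooth hc hb).measurable.comp
      ((measurable_partialSum hh.measurable b r p).prodMk
        ((measurable_remVar hh.measurable_asympVar b r N _).comp hs))
  have hb' (y : ℕ → E) (z v : ℝ) :
      ‖h (walk b i y) (seqBlock m i y) * gaussSmooth (f 0) z v‖ ≤ L := by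
    rw [norm_mul, ← mul_one L]
    exact mul_le_mul (hh.abs_le _ _) (abs_gaussSmooth_le hb _ _) (norm_nonneg _) hh.nonneg
  have hint {F : (ℕ → E) → ℝ} (hF : Measurable fun y =>
      gaussSmooth (f 0) (partialSum h b r p y) (F y)) :
      Integrable (fun y => h (walk b i y) (seqBlock m i y) *
        gaussSmooth (f 0) (partialSum h b r p y) (F y)) (iidLaw ν) :=
    Integrable.of_bound ((hh.measurable_summand b i).mul hF).aestronglyMeasurable L
      (ae_of_all _ fun y => hb' y _ _)
  rw [← sub_zero (∫ y, _ ∂iidLaw ν), ← hh.integral_first_order_eq_zero hc hb b r N hp,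
    ← integral_sub (hint (hh.measurable_smooth hc hb b r N p (i + m + 1))) (hint hm)]
  have hi := (integrable_truncNorm (μ := iidLaw ν)
    (F := fun y => b • ∑ k ∈ Finset.Ico i (i + m + 1), y k) (by fun_prop)).const_mul (L ^ 3)
  refine (abs_integral_le_of_abs_le_integrable hi fun y => ?_).trans ?_
  · rw [← mul_sub, abs_mul, show L ^ 3 * truncNorm (b • ∑ k ∈ Finset.Ico i (i + m + 1), y k) =
      L * (L ^ 2 * truncNorm (b • ∑ k ∈ Finset.Ico i (i + m + 1), y k)) by ring]
    refine mul_le_mul (hh.abs_le _ _) ?_ (abs_nonneg _) hL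
    refine (hf.abs_gaussSmooth_sub_le _ (remVar_nonneg hh.asympVar_nonneg _ _ _ _ _)
      (remVar_nonneg hh.asympVar_nonneg _ _ _ _ _)).trans ?_
    exact abs_remVar_sub_le_of_walk hq b hN
      fun l hl => walk_eq_splice_zero_add b y (by omega) hl
  · rw [integral_const_mul]
    gcongr
    refine (integral_truncNorm_smul_sum_le b i (i + m + 1)).trans (le_of_eq ?_)
    rw [show i + m + 1 - i = m + 1 by omega]
    push_cast
    rfl

/-- Reflecting the window preserves the law and, by evenness, the factor `h`. The original and the
reflected configurations displace the walk by `v` and `-v` from the blanked one, so averaging them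
leaves a symmetric second difference, quadratic in `v`. -/
lemma abs_integral_first_order_le_of_even (hh : IsCenteredKernel ν L h) (hL1 : 1 ≤ L)
    (hL4 : gaussFourthMoment ≤ L)
    (hq : HasBoundedDiffs L (asympVar ν h)) (hf : BoundedDerivs 4 f)
    (hN : N * r ^ 2 ≤ L) (hp : p + m ≤ i) (hν : ν.map Neg.neg = ν)
    (heven : ∀ x y, h x (-y) = h x y) :
    |∫ y, h (walk b i y) (seqBlock m i y) * gaussSmooth (f 0) (partialSum h b r p y)
        (remVar (asympVar ν h) b r N (i + m + 1) y) ∂iidLaw ν| ≤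
      3 * L ^ 6 * ((m + 1) * ((m + 1) * ∫ x, truncNorm (b • x) ^ 2 ∂ν)) := by
  have hc := hf.continuous (l := 0) (by norm_num)
  have hb := hf.bound 0 (by norm_num)
  have hL := hh.nonneg
  set j := i + m + 1 with hj
  have hs : Measurable fun y : ℕ → E => splice i j y 0 :=
    (measurable_splice i j).comp (measurable_id.prodMk measurable_const)
  have hs' : Measurable fun y : ℕ → E => splice i j y (-y) :=
    (measurable_splice i j).comp (measurable_id.prodMk measurable_neg)
  set H : (ℕ → E) → ℝ := fun y => h (walk b i y) (seqBlock m i y) with hH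
  set Θ : (ℕ → E) → ℝ := fun y => gaussSmooth (f 0) (partialSum h b r p y)
        (remVar (asympVar ν h) b r N j y) with hΘ
  have hHm : Measurable H := hh.measurable_summand b i
  have hΘm : Measurable Θ := hh.measurable_smooth hc hb b r N p j
  have hS (y y' : ℕ → E) : partialSum h b r p (splice i j y y') = partialSum h b r p y :=
    partialSum_splice h b r y y' hp
  have hHflip (y : ℕ → E) : H (splice i j y (-y)) = H y := by
    simp only [hH]
    rw [walk_splice_of_le b y _ le_rfl, seqBlock_splice_of_subset y _ le_rfl (by omega),
      ← heven _ (seqBlock m i y)]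
    rfl
  have hbd (y y' : ℕ → E) : ‖H y * Θ y'‖ ≤ L := by
    rw [norm_mul, ← mul_one L]
    exact mul_le_mul (hh.abs_le _ _) (abs_gaussSmooth_le hb _ _) (norm_nonneg _) hh.nonneg
  have hint {F : (ℕ → E) → ℕ → E} (hF : Measurable F) :
      Integrable (fun y => H y * Θ (F y)) (iidLaw ν) :=
    Integrable.of_bound (hHm.mul (hΘm.comp hF)).aestronglyMeasurable L
        (ae_of_all _ fun y => hbd y _)
  have e1 : ∫ y, H y * Θ (splice i j y (-y)) ∂iidLaw ν = ∫ y, H y * Θ y ∂iidLaw ν := by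
    rw [← integral_splice_neg hν i j (F := fun y => H y * Θ y) (hHm.mul hΘm)
      (fun y => hbd y y)]
    simp_rw [hHflip]
  have e2 : ∫ y, H y * Θ (splice i j y 0) ∂iidLaw ν = 0 := by
    simp only [hΘ, hS]
    exact hh.integral_first_order_eq_zero hc hb b r N hp
  have hid : Integrable (fun y => H y * Θ y) (iidLaw ν) := hint measurable_id
  -- By `e1` the first two terms have equal integrals and by `e2` the third has integral zero, so
  -- the integral is unchanged while the integrand becomes a second difference.
  have e3 : ∫ y, H y * Θ y ∂iidLaw ν = ∫ y, (H y * Θ y + H y * Θ (splice i j y (-y)) -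
      2 * (H y * Θ (splice i j y 0))) / 2 ∂iidLaw ν := by
    have hi2 : Integrable (fun y => H y * Θ y + H y * Θ (splice i j y (-y))) (iidLaw ν) :=
      hid.add (hint hs')
    rw [integral_div, integral_sub hi2 ((hint hs).const_mul 2), integral_add hid (hint hs'),
      integral_const_mul, e1, e2]
    ring
  rw [e3]
  have hi := (integrable_truncNorm_pow (μ := iidLaw ν)
    (F := fun y => b • ∑ k ∈ Finset.Ico i j, y k) (by fun_prop) 2).const_mul (3 * L ^ 6)
  refine (abs_integral_le_of_abs_le_integrable hi fun y => ?_).trans ?_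
  · set v := b • ∑ k ∈ Finset.Ico i j, y k with hv
    have hw₁ (l : ℕ) (hl : j ≤ l) : walk b l y = walk b l (splice i j y 0) + v :=
      walk_eq_splice_zero_add b y (by omega) hl
    have hw₂ (l : ℕ) (hl : j ≤ l) :
        walk b l (splice i j y (-y)) = walk b l (splice i j y 0) - v := by
      rw [walk_splice_of_ge b y (-y) (by omega) hl, hv]
      simp [sub_eq_add_neg]
    have hw₂' (l : ℕ) (hl : j ≤ l) :
        walk b l (splice i j y (-y)) = walk b l (splice i j y 0) + -v := by
      rw [hw₂ l hl, sub_eq_add_neg]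
    have h1 := abs_remVar_second_diff_le hq b hN hw₁ hw₂
    have h2 := abs_remVar_sub_le_of_walk hq b hN hw₁
    have h3 := abs_remVar_sub_le_of_walk hq b hN hw₂'
    rw [truncNorm_neg] at h3
    have h4 := hf.abs_gaussSmooth_second_diff_le (partialSum h b r p y)
      (remVar_nonneg hh.asympVar_nonneg b r N j (splice i j y 0))
      (remVar_nonneg hh.asympVar_nonneg b r N j y)
      (remVar_nonneg hh.asympVar_nonneg b r N j (splice i j y (-y)))
    have h5 : |Θ y + Θ (splice i j y (-y)) - 2 * Θ (splice i j y 0)| ≤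
        5 * L ^ 5 * truncNorm v ^ 2 := by
      simp only [hΘ, hS]
      refine h4.trans ?_
      have g2 := pow_le_pow_left₀ (abs_nonneg _) h2 2
      have g3 := pow_le_pow_left₀ (abs_nonneg _) h3 2
      rw [sq_abs] at g2 g3
      have hcm : gaussFourthMoment + 1 ≤ 2 * L := by linarith
      calc _ ≤ L ^ 2 * truncNorm v ^ 2 +
            (2 * L) * ((L ^ 2 * truncNorm v) ^ 2 + (L ^ 2 * truncNorm v) ^ 2) := by gcongr
        _ = (L ^ 2 + 4 * L ^ 5) * truncNorm v ^ 2 := by ring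
        _ ≤ (L ^ 5 + 4 * L ^ 5) * truncNorm v ^ 2 := by
          gcongr
          · norm_num
        _ = _ := by ring
    have e4 : (H y * Θ y + H y * Θ (splice i j y (-y)) - 2 * (H y * Θ (splice i j y 0))) / 2 =
      H y * ((Θ y + Θ (splice i j y (-y)) - 2 * Θ (splice i j y 0)) / 2) := by ring
    rw [e4, abs_mul, abs_div, abs_two]
    calc |H y| * (|Θ y + Θ (splice i j y (-y)) - 2 * Θ (splice i j y 0)| / 2)
        ≤ L * (5 * L ^ 5 * truncNorm v ^ 2 / 2) := by
          gcongr
          exact hh.abs_le _ _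
      -- The factor `5 / 2` is rounded up to `3`.
      _ ≤ 3 * L ^ 6 * truncNorm v ^ 2 := by
          have : 0 ≤ L ^ 6 * truncNorm v ^ 2 := by positivity
          nlinarith
  · rw [integral_const_mul]
    gcongr
    refine (integral_truncNorm_smul_sum_sq_le b i j).trans (le_of_eq ?_)
    rw [show j - i = m + 1 by omega]
    push_cast
    rfl

end FirstOrder

end IsCenteredKernel

end Lindeberg

/-! ### The second-order term and the Lindeberg bound. -/

section Lindeberg

variable {E : Type*} [NormedAddCommGroup E] [NormedSpace ℝ E] [MeasurableSpace E] [BorelSpace E]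
  [SecondCountableTopology E] {m : ℕ}
  {ν : Measure E} [IsProbabilityMeasure ν] {L : ℝ} {h : E → (Fin (m + 1) → E) → ℝ}

/-- The second-order coefficient of the Lindeberg expansion at time `p + m`, when the walk at time
`p + k` is at `x k`. -/
noncomputable def secondOrderCoeff (ν : Measure E) (h : E → (Fin (m + 1) → E) → ℝ) (p : ℕ)
    (x : ℕ → E) (y : ℕ → E) : ℝ :=
  h (x m) (seqBlock m (p + m) y) ^ 2 / 2 + h (x m) (seqBlock m (p + m) y) *
    (∑ k ∈ Finset.range m, h (x k) (seqBlock m (p + k) y)) - asympVar ν h (x m) / 2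

namespace IsCenteredKernel

lemma abs_sum_le (hh : IsCenteredKernel ν L h) (p : ℕ) (x : ℕ → E) (y : ℕ → E) :
    |∑ k ∈ Finset.range m, h (x k) (seqBlock m (p + k) y)| ≤ m * L := by
  refine (Finset.abs_sum_le_sum_abs _ _).trans ((Finset.sum_le_card_nsmul _ _ L fun l _ =>
    hh.abs_le _ _).trans ?_)
  simp

lemma abs_secondOrderCoeff_le (hh : IsCenteredKernel ν L h) (hL1 : 1 ≤ L) (hmL : m ≤ L)
    (hq : HasBoundedDiffs L (asympVar ν h)) (p : ℕ) (x : ℕ → E) (y : ℕ → E) :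
    |secondOrderCoeff ν h p x y| ≤ 2 * L ^ 3 := by
  have h1 := hh.abs_le (x m) (seqBlock m (p + m) y)
  have h2 := hh.abs_sum_le p x y
  have h3 := hq.bound (x m)
  have e1 : |h (x m) (seqBlock m (p + m) y) ^ 2 / 2| ≤ L ^ 3 / 2 := by
    rw [abs_div, abs_two, abs_pow]
    gcongr
    calc |h (x m) (seqBlock m (p + m) y)| ^ 2 ≤ L ^ 2 := by gcongr
      _ ≤ L ^ 3 := pow_le_pow_right₀ hL1 (by norm_num)
  have e2 : |h (x m) (seqBlock m (p + m) y) *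
      (∑ k ∈ Finset.range m, h (x k) (seqBlock m (p + k) y))| ≤ L ^ 3 := by
    rw [abs_mul]
    calc _ ≤ L * (L * L) := by
          gcongr
          exact h2.trans (by gcongr)
      _ = L ^ 3 := by ring
  have e3 : |asympVar ν h (x m) / 2| ≤ L ^ 3 / 2 := by
    rw [abs_div, abs_two]
    gcongr
    calc _ ≤ L ^ 1 := by simpa using h3
      _ ≤ L ^ 3 := pow_le_pow_right₀ hL1 (by norm_num)
  rw [secondOrderCoeff]
  refine (abs_sub _ _).trans ((add_le_add (abs_add_le _ _) le_rfl).trans ?_)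
  linarith

/-- Freezing the positions costs `L ^ 2 * w` in the square, `2 * L ^ 3 * w` in the cross term and `L
* w / 2` in the variance, all absorbed in `4 * L ^ 3 * w`. -/
lemma abs_secondOrderCoeff_sub_le (hh : IsCenteredKernel ν L h) (hL1 : 1 ≤ L) (hmL : m ≤ L)
    (hq : HasBoundedDiffs L (asympVar ν h)) (p : ℕ) (x : ℕ → E) (x₀ : E) (y : ℕ → E) {w : ℝ}
    (hw : ∀ k ≤ m, truncNorm (x k - x₀) ≤ w) :
    |secondOrderCoeff ν h p x y - secondOrderCoeff ν h p (fun _ => x₀) y| ≤ 4 * L ^ 3 * w := by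
  have hL := hh.nonneg
  have hw0 : 0 ≤ w := (truncNorm_nonneg _).trans (hw 0 (Nat.zero_le _))
  have hd (k : ℕ) (hk : k ≤ m) (z : Fin (m + 1) → E) : |h (x k) z - h x₀ z| ≤ L * w :=
    ((hh.hasBoundedDiffs z).diff' x₀ (x k)).trans (by gcongr; exact hw k hk)
  set a := h (x m) (seqBlock m (p + m) y) with ha
  set a₀ := h x₀ (seqBlock m (p + m) y) with ha₀
  set B := ∑ k ∈ Finset.range m, h (x k) (seqBlock m (p + k) y) with hB
  set B₀ := ∑ k ∈ Finset.range m, h x₀ (seqBlock m (p + k) y) with hB₀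
  have h1 : |a - a₀| ≤ L * w := hd m le_rfl _
  have h2 : |B - B₀| ≤ L * (L * w) := by
    rw [hB, hB₀, ← Finset.sum_sub_distrib]
    refine (Finset.abs_sum_le_sum_abs _ _).trans ((Finset.sum_le_card_nsmul _ _ (L * w)
      fun l hl => hd l (Finset.mem_range.1 hl).le _).trans ?_)
    rw [nsmul_eq_mul, Finset.card_range]
    gcongr
  have h3 : |asympVar ν h (x m) - asympVar ν h x₀| ≤ L * w :=
    (hq.diff' x₀ (x m)).trans (by gcongr; exact hw m le_rfl)
  have ha1 : |a| ≤ L := hh.abs_le _ _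
  have ha2 : |a₀| ≤ L := hh.abs_le _ _
  have hB2 : |B₀| ≤ L * L := (hh.abs_sum_le p (fun _ => x₀) y).trans (by gcongr)
  have e : secondOrderCoeff ν h p x y - secondOrderCoeff ν h p (fun _ => x₀) y =
      (a - a₀) * ((a + a₀) / 2) + (a * (B - B₀) + (a - a₀) * B₀)
        - (asympVar ν h (x m) - asympVar ν h x₀) / 2 := by
    simp only [secondOrderCoeff, ← ha, ← ha₀, ← hB, ← hB₀]
    ring
  have f1 : |(a - a₀) * ((a + a₀) / 2)| ≤ (L * w) * L := by
    rw [abs_mul]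
    gcongr
    rw [abs_div, abs_two]
    linarith [abs_add_le a a₀]
  have f2 : |a * (B - B₀)| ≤ L * (L * (L * w)) := by
    rw [abs_mul]
    gcongr
  have f3 : |(a - a₀) * B₀| ≤ (L * w) * (L * L) := by
    rw [abs_mul]
    gcongr
  rw [e]
  refine (abs_sub _ _).trans ((add_le_add ((abs_add_le _ _).trans (add_le_add f1
    ((abs_add_le _ _).trans (add_le_add f2 f3)))) (le_of_eq (abs_div _ _))).trans ?_)
  rw [abs_two]
  have g1 : L ^ 2 * w ≤ L ^ 3 * w := by
    gcongr
    · norm_num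
  have g2 : L * w ≤ L ^ 3 * w := by
    gcongr
    exact le_self_pow₀ hL1 (by norm_num)
  have : 0 ≤ L * w := by positivity
  nlinarith

variable {f : ℕ → ℝ → ℝ} {b r : ℝ} {N p : ℕ}

lemma measurable_secondOrderCoeff (hh : IsCenteredKernel ν L h) (p : ℕ) {x : ℕ → (ℕ → E) → E}
    (hx : ∀ k, Measurable (x k)) : Measurable fun y => secondOrderCoeff ν h p (fun k => x k y) y := by
  have hs (k : ℕ) : Measurable fun y => h (x k y) (seqBlock m (p + k) y) :=
    hh.measurable.comp ((hx k).prodMk (_root_.measurable_seqBlock m (p + k)))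
  unfold secondOrderCoeff
  exact ((((hs m).pow_const 2).div_const 2).add
    ((hs m).mul (Finset.measurable_sum _ fun k _ => hs k))).sub
      ((hh.measurable_asympVar.comp (hx m)).div_const 2)

/-- The window `[p, p + 2 m + 1)` contains every entry of the blocks that start at `p, …, p + m`,
and no other factor depends on it. Averaging over it reduces to `integral_frozen_eq_zero` at the
position reached at time `p`. -/
lemma integral_second_order_eq_zero (hh : IsCenteredKernel ν L h) (hL1 : 1 ≤ L) (hmL : m ≤ L)
    (hq : HasBoundedDiffs L (asympVar ν h)) {φ : ℝ → ℝ} (hc : Continuous φ)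
    (hb : ∀ x, |φ x| ≤ 1) (b r : ℝ) (N : ℕ) {p p' : ℕ} (hp : p' + m ≤ p) :
    ∫ y, secondOrderCoeff ν h p (fun _ => walk b p y) y *
      gaussSmooth φ (partialSum h b r p' y)
        (remVar (asympVar ν h) b r N (p + m + m + 1) (splice p (p + m + m + 1) y 0)) ∂iidLaw ν
      = 0 := by
  set j := p + m + m + 1 with hj
  have hs : Measurable fun y : ℕ → E => splice p j y 0 :=
    (measurable_splice p j).comp (measurable_id.prodMk measurable_const)
  have hm : Measurable fun y : ℕ → E => gaussSmooth φ (partialSum h b r p' y)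
      (remVar (asympVar ν h) b r N j (splice p j y 0)) :=
    (continuous_gaussSmooth hc hb).measurable.comp
      ((measurable_partialSum hh.measurable b r p').prodMk
        ((measurable_remVar hh.measurable_asympVar b r N _).comp hs))
  refine integral_mul_eq_zero_of_splice (i := p) (j := j) ?_ (fun y y' => ?_) fun y => ?_
  · refine Integrable.of_bound ((hh.measurable_secondOrderCoeff p
      fun _ => measurable_walk b p).mul hm).aestronglyMeasurable (2 * L ^ 3)
      (ae_of_all _ fun y => ?_)
    rw [norm_mul, ← mul_one (2 * L ^ 3)]
    exact mul_le_mul (hh.abs_secondOrderCoeff_le hL1 hmL hq _ _ _) (abs_gaussSmooth_le hb _ _)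
      (norm_nonneg _) (mul_nonneg zero_le_two (pow_nonneg hh.nonneg 3))
  · rw [partialSum_splice h b r y y' hp]
    congr 2
    ext l
    by_cases hl : p ≤ l ∧ l < j
    · simp [splice_of_mem _ _ hl]
    · simp [splice_of_notMem _ _ hl]
  · rw [← hh.integral_frozen_eq_zero (walk b p y) (i := p + m) (by omega)]
    congr 1
    ext y'
    have hk (k : ℕ) (hk : k ≤ m) : seqBlock m (p + k) (splice p j y y') = seqBlock m (p + k) y' :=
      seqBlock_splice_of_subset y y' (by omega) (by omega)
    rw [secondOrderCoeff, walk_splice_of_le b y _ le_rfl, hk m le_rfl, Nat.add_sub_cancel]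
    congr 3
    exact Finset.sum_congr rfl fun k hk' => by rw [hk k (Finset.mem_range.1 hk').le]

/-- Two replacements lead to the centred version: freezing the positions in the coefficient, and
blanking the window in the remaining variance. Both are controlled by the sum of the truncated step
norms over the window, whose mean is `2 m + 1 ≤ 3 L` times the mean of a single step. -/
lemma abs_integral_second_order_le (hh : IsCenteredKernel ν L h) (hL1 : 1 ≤ L) (hmL : m ≤ L)
    (hq : HasBoundedDiffs L (asympVar ν h)) (hf : BoundedDerivs 2 f)
    (hN : N * r ^ 2 ≤ L) {p p' : ℕ} (hp : p' + m ≤ p) :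
    |∫ y, secondOrderCoeff ν h p (fun k => walk b (p + k) y) y *
      gaussSmooth (f 0) (partialSum h b r p' y)
        (remVar (asympVar ν h) b r N (p + m + m + 1) y) ∂iidLaw ν| ≤
      18 * L ^ 6 * ∫ x, truncNorm (b • x) ∂ν := by
  have hc := hf.continuous (l := 0) (by norm_num)
  have hb := hf.bound 0 (by norm_num)
  have hL := hh.nonneg
  set j := p + m + m + 1 with hj
  have hs : Measurable fun y : ℕ → E => splice p j y 0 :=
    (measurable_splice p j).comp (measurable_id.prodMk measurable_const)
  set B : (ℕ → E) → ℝ := fun y => secondOrderCoeff ν h p (fun k => walk b (p + k) y) y with hB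
  set B₀ : (ℕ → E) → ℝ := fun y => secondOrderCoeff ν h p (fun _ => walk b p y) y with hB₀
  set Θ : (ℕ → E) → ℝ := fun y => gaussSmooth (f 0) (partialSum h b r p' y)
        (remVar (asympVar ν h) b r N j y) with hΘ
  have hS (y y' : ℕ → E) : partialSum h b r p' (splice p j y y') = partialSum h b r p' y :=
    partialSum_splice h b r y y' hp
  have hBm : Measurable B := hh.measurable_secondOrderCoeff p fun k => measurable_walk b (p + k)
  have hB₀m : Measurable B₀ := hh.measurable_secondOrderCoeff p fun _ => measurable_walk b p
  have hΘm : Measurable Θ := hh.measurable_smooth hc hb b r N p' j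
  have hΘ1 (y : ℕ → E) : |Θ y| ≤ 1 := abs_gaussSmooth_le hb _ _
  have hint {F G : (ℕ → E) → ℝ} (hF : Measurable F) (hG : Measurable G)
      (hFb : ∀ y, |F y| ≤ 2 * L ^ 3) (hGb : ∀ y, |G y| ≤ 1) :
      Integrable (fun y => F y * G y) (iidLaw ν) :=
    Integrable.of_bound (hF.mul hG).aestronglyMeasurable (2 * L ^ 3) (ae_of_all _ fun y => by
      rw [norm_mul, ← mul_one (2 * L ^ 3)]
      exact mul_le_mul (hFb y) (hGb y) (norm_nonneg _) (by positivity))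
  have hBb (y : ℕ → E) : |B y| ≤ 2 * L ^ 3 := hh.abs_secondOrderCoeff_le hL1 hmL hq _ _ _
  have hB₀b (y : ℕ → E) : |B₀ y| ≤ 2 * L ^ 3 := hh.abs_secondOrderCoeff_le hL1 hmL hq _ _ _
  have e0 : ∫ y, B₀ y * Θ (splice p j y 0) ∂iidLaw ν = 0 := by
    simp only [hΘ, hS]
    exact hh.integral_second_order_eq_zero hL1 hmL hq hc hb b r N hp
  change |∫ y, B y * Θ y ∂iidLaw ν| ≤ _
  rw [← sub_zero (∫ y, B y * Θ y ∂iidLaw ν), ← e0, ← integral_sub (hint hBm hΘm hBb hΘ1)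
    (hint (G := fun y => Θ (splice p j y 0)) hB₀m (hΘm.comp hs) hB₀b fun y => hΘ1 _)]
  have hi : Integrable (fun y => 6 * L ^ 5 * ∑ k ∈ Finset.Ico p j, truncNorm (b • y k))
      (iidLaw ν) :=
    (integrable_finsetSum _ fun k _ => integrable_truncNorm (by fun_prop)).const_mul _
  refine (abs_integral_le_of_abs_le_integrable hi fun y => ?_).trans ?_
  · set w := ∑ k ∈ Finset.Ico p j, truncNorm (b • y k) with hw
    have hwk (k : ℕ) (hk : p + k ≤ j) : truncNorm (walk b (p + k) y - walk b p y) ≤ w := by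
      rw [walk_sub_walk b y (Nat.le_add_right p k)]
      refine (truncNorm_sum_le _ _).trans (Finset.sum_le_sum_of_subset_of_nonneg ?_
        fun _ _ _ => truncNorm_nonneg _)
      exact Finset.Ico_subset_Ico le_rfl hk
    have hw0 : 0 ≤ w := Finset.sum_nonneg fun _ _ => truncNorm_nonneg _
    have h1 : |B y - B₀ y| ≤ 4 * L ^ 3 * w :=
      hh.abs_secondOrderCoeff_sub_le hL1 hmL hq p _ _ y fun k hk => hwk k (by omega)
    have h2 : |Θ y - Θ (splice p j y 0)| ≤ L ^ 2 * w := by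
      simp only [hΘ, hS]
      refine (hf.abs_gaussSmooth_sub_le _ (remVar_nonneg hh.asympVar_nonneg _ _ _ _ _)
        (remVar_nonneg hh.asympVar_nonneg _ _ _ _ _)).trans ?_
      refine (abs_remVar_sub_le_of_walk hq b hN
        fun l hl => walk_eq_splice_zero_add b y (by omega) hl).trans ?_
      gcongr
      rw [Finset.smul_sum]
      exact truncNorm_sum_le _ _
    have e : B y * Θ y - B₀ y * Θ (splice p j y 0) =
      (B y - B₀ y) * Θ y + B₀ y * (Θ y - Θ (splice p j y 0)) := by ring
    rw [e]
    refine (abs_add_le _ _).trans ?_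
    rw [abs_mul, abs_mul]
    calc _ ≤ (4 * L ^ 3 * w) * 1 + (2 * L ^ 3) * (L ^ 2 * w) := by
          gcongr
          · exact hΘ1 y
          · exact hB₀b y
      _ = (4 * L ^ 3 + 2 * L ^ 5) * w := by ring
      _ ≤ (4 * L ^ 5 + 2 * L ^ 5) * w := by
        gcongr
        norm_num
      _ = _ := by ring
  · rw [integral_const_mul]
    have := integral_sum_truncNorm (ν := ν) b p j 1
    simp only [pow_one] at this
    rw [this, show j - p = 2 * m + 1 by omega]
    have hκ : 0 ≤ ∫ x, truncNorm (b • x) ∂ν := integral_nonneg fun _ => truncNorm_nonneg _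
    calc _ ≤ 6 * L ^ 5 * ((3 * L) * ∫ x, truncNorm (b • x) ∂ν) := by
          gcongr
          push_cast
          linarith
      _ = _ := by ring

/-- The Lindeberg bound: if the first-order terms are at most `ε`, then the law of the normalised
sum is close to a Gaussian mixture. -/
theorem abs_integral_partialSum_sub_le (hh : IsCenteredKernel ν L h) (hL1 : 1 ≤ L) (hmL : m ≤ L)
    (hL4 : gaussFourthMoment ≤ L) (hq : HasBoundedDiffs L (asympVar ν h)) (hf : BoundedDerivs 5 f)
    (hr : 0 < r) (hr1 : r ≤ 1) (hN : N * r ^ 2 ≤ L) {ε : ℝ}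
    (hε : ∀ p, |∫ y, h (walk b (p + m + m) y) (seqBlock m (p + m + m) y) *
      gaussSmooth (f 1) (partialSum h b r (p + m) y)
        (remVar (asympVar ν h) b r N (p + m + m + m + 1) y) ∂iidLaw ν| ≤ ε) :
    |∫ y, f 0 (partialSum h b r N y) ∂iidLaw ν -
      ∫ y, gaussSmooth (f 0) 0 (remVar (asympVar ν h) b r N 0 y) ∂iidLaw ν| ≤
      18 * L ^ 7 * (r + (∫ x, truncNorm (b • x) ∂ν) + ε / r) := by
  have hL := hh.nonneg
  have hc (l : ℕ) (hl : l ≤ 5) := hf.continuous hl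
  have hb (l : ℕ) (hl : l ≤ 5) := hf.bound l hl
  set κ := ∫ x, truncNorm (b • x) ∂ν with hκ
  have hκ0 : 0 ≤ κ := integral_nonneg fun _ => truncNorm_nonneg _
  have hε0 : 0 ≤ ε := (abs_nonneg _).trans (hε 0)
  set q := asympVar ν h with hqdef
  have hq0 : ∀ x, 0 ≤ q x := hh.asympVar_nonneg
  have hqm : Measurable q := hh.measurable_asympVar
  -- The interpolation: `D N` is `f 0` at the full sum, and `D 0` is the smoothed function at `0`
  -- with the whole variance.
  set D : ℕ → (ℕ → E) → ℝ := fun i y =>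
    gaussSmooth (f 0) (partialSum h b r i y) (remVar q b r N i y) with hD
  have hDm (i : ℕ) : Measurable (D i) := hh.measurable_smooth (hc 0 (by norm_num))
    (hb 0 (by norm_num)) b r N i i
  have hDi (i : ℕ) : Integrable (D i) (iidLaw ν) :=
    Integrable.of_bound (hDm i).aestronglyMeasurable 1
      (ae_of_all _ fun y => abs_gaussSmooth_le (hb 0 (by norm_num)) _ _)
  have hζ (i : ℕ) (y : ℕ → E) : |r * h (walk b i y) (seqBlock m i y)| ≤ L * r := by
    rw [abs_mul, abs_of_pos hr, mul_comm]
    gcongr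
    exact hh.abs_le _ _
  have hqle (x : E) : r ^ 2 * q x ≤ L * r ^ 2 := by
    rw [mul_comm]
    gcongr
    exact (le_abs_self _).trans (hq.bound x)
  have hrr : r ^ 2 ≤ r := by nlinarith
  have hpart (i : ℕ) (y : ℕ → E) :
      |partialSum h b r (i + m) y - partialSum h b r i y| ≤ L ^ 2 * r := by
    rw [partialSum_add_sub, abs_mul, abs_of_pos hr]
    have := hh.abs_sum_le i (fun k => walk b (i + k) y) y
    calc _ ≤ r * (L * L) := by
          gcongr
          exact this.trans (by gcongr)
      _ = _ := by ring
  -- This crude bound serves for the first `2 m` indices, where no sum lagging by `2 m` exists.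
  -- There are at most `2 L` of them, so they cost only `O(r)`.
  have hsmall (i : ℕ) (hi : i < N) : |∫ y, (D (i + 1) y - D i y) ∂iidLaw ν| ≤ 2 * L * r := by
    refine abs_integral_le_of_abs_le fun y => ?_
    simp only [hD]
    rw [partialSum_succ, remVar_eq_succ_add q b r hi]
    have h1 := (hf.mono (by norm_num)).gaussSmooth_taylor_one (partialSum h b r i y)
      (r * h (walk b i y) (seqBlock m i y)) (remVar q b r N (i + 1) y)
    have hqn : 0 ≤ r ^ 2 * q (walk b i y) := mul_nonneg (sq_nonneg r) (hq0 _)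
    have h2 := (hf.mono (by norm_num)).abs_gaussSmooth_add_sub_le (partialSum h b r i y)
      (remVar_nonneg hq0 b r N (i + 1) y) hqn
    have h3 := hζ i y
    have h4 := hqle (walk b i y)
    have h5 : L * r ^ 2 ≤ L * r := by gcongr
    have h6 := h1.trans h3
    rw [_root_.abs_le] at h6 h2 ⊢
    constructor <;> linarith
  have hbig (p : ℕ) (hp : p + m + m < N) :
      |∫ y, (D (p + m + m + 1) y - D (p + m + m) y) ∂iidLaw ν| ≤
        r * ε + r ^ 2 * (18 * L ^ 6 * κ) + 11 * L ^ 5 * r ^ 3 := by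
    set i := p + m + m with hi
    set A : (ℕ → E) → ℝ := fun y => h (walk b i y) (seqBlock m i y) *
      gaussSmooth (f 1) (partialSum h b r (p + m) y) (remVar q b r N (i + m + 1) y) with hA
    set B : (ℕ → E) → ℝ := fun y =>
      secondOrderCoeff ν h (p + m) (fun k => walk b (p + m + k) y) y *
      gaussSmooth (f 2) (partialSum h b r p y) (remVar q b r N (i + m + 1) y) with hB
    have hAm : Measurable A := (hh.measurable_summand b i).mul
      (hh.measurable_smooth (hc 1 (by norm_num)) (hb 1 (by norm_num)) b r N (p + m) (i + m + 1))
    have hBm : Measurable B := (hh.measurable_secondOrderCoeff (p + m)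
      fun k => measurable_walk b (p + m + k)).mul
      (hh.measurable_smooth (hc 2 (by norm_num)) (hb 2 (by norm_num)) b r N p (i + m + 1))
    have hAi : Integrable A (iidLaw ν) :=
      Integrable.of_bound hAm.aestronglyMeasurable L (ae_of_all _ fun y => by
        rw [norm_mul, ← mul_one L]
        exact mul_le_mul (hh.abs_le _ _) (abs_gaussSmooth_le (hb 1 (by norm_num)) _ _)
          (norm_nonneg _) hL)
    have hBi : Integrable B (iidLaw ν) :=
      Integrable.of_bound hBm.aestronglyMeasurable (2 * L ^ 3) (ae_of_all _ fun y => by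
        rw [norm_mul, ← mul_one (2 * L ^ 3)]
        exact mul_le_mul (hh.abs_secondOrderCoeff_le hL1 hmL hq _ _ _)
          (abs_gaussSmooth_le (hb 2 (by norm_num)) _ _) (norm_nonneg _) (by positivity))
    have hstep (y : ℕ → E) :
        |D (i + 1) y - D i y - (r * A y + r ^ 2 * B y)| ≤ 11 * L ^ 5 * r ^ 3 := by
      -- With `i = p + 2 m`, the sum at `p + m` does not see the block at `i`, and the sum at `p`
      -- sees none of the blocks at `p + m, …, i` that form the second-order coefficient. Starting
      -- the variance at `i + m + 1` omits the positions inside the current block.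
      have h1 := hf.abs_lindeberg_step_le (s₀ := partialSum h b r p y)
        (s₁ := partialSum h b r (p + m) y) (s := partialSum h b r i y)
        (z := r * h (walk b i y) (seqBlock m i y)) (v₀ := remVar q b r N (i + 1) y)
        (v := remVar q b r N (i + m + 1) y) (q := r ^ 2 * q (walk b i y)) hL1 hL4 hr.le hr1
        (remVar_nonneg hq0 _ _ _ _ _) (remVar_nonneg hq0 _ _ _ _ _)
        (mul_nonneg (sq_nonneg r) (hq0 _)) (hζ i y) (hpart (p + m) y) (hpart p y)
        (by
          have := abs_remVar_sub_le hq.bound b r N (i + 1) m y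
          rw [show i + 1 + m = i + m + 1 by omega] at this
          refine this.trans ?_
          rw [mul_comm, sq L]
          gcongr) (hqle _)
      rw [← partialSum_succ, ← remVar_eq_succ_add q b r hp] at h1
      convert h1 using 2
      have hc2 : r ^ 2 * secondOrderCoeff ν h (p + m) (fun k => walk b (p + m + k) y) y =
          (r * h (walk b i y) (seqBlock m i y)) ^ 2 / 2 + r * h (walk b i y) (seqBlock m i y) *
          (partialSum h b r i y - partialSum h b r (p + m) y) - r ^ 2 * q (walk b i y) / 2 := by
        rw [hi, partialSum_add_sub, secondOrderCoeff]
        ring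
      simp only [hD, hA, hB]
      rw [← hc2]
      ring
    have hi1 : Integrable (fun y => D (i + 1) y - D i y) (iidLaw ν) := (hDi _).sub (hDi _)
    have hi2 : Integrable (fun y => r * A y + r ^ 2 * B y) (iidLaw ν) :=
      (hAi.const_mul r).add (hBi.const_mul _)
    have e : ∫ y, (D (i + 1) y - D i y) ∂iidLaw ν =
        ∫ y, (D (i + 1) y - D i y - (r * A y + r ^ 2 * B y)) ∂iidLaw ν +
          (r * ∫ y, A y ∂iidLaw ν + r ^ 2 * ∫ y, B y ∂iidLaw ν) := by
      rw [integral_sub hi1 hi2, integral_add (hAi.const_mul r) (hBi.const_mul _),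
        integral_const_mul, integral_const_mul]
      ring
    have hA1 : |r * ∫ y, A y ∂iidLaw ν| ≤ r * ε := by
      rw [abs_mul, abs_of_pos hr]
      gcongr
      exact hε p
    have hB1 : |r ^ 2 * ∫ y, B y ∂iidLaw ν| ≤ r ^ 2 * (18 * L ^ 6 * κ) := by
      rw [abs_mul, abs_of_nonneg (sq_nonneg r)]
      gcongr
      exact hh.abs_integral_second_order_le hL1 hmL hq
        (hf.shift (i := 2) (j := 2) (by norm_num)) hN (p := p + m) (p' := p) le_rfl
    rw [e]
    refine (abs_add_le _ _).trans ((add_le_add (abs_integral_le_of_abs_le hstep)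
      ((abs_add_le _ _).trans (add_le_add hA1 hB1))).trans ?_)
    linarith
  have htel : ∫ y, f 0 (partialSum h b r N y) ∂iidLaw ν -
      ∫ y, gaussSmooth (f 0) 0 (remVar q b r N 0 y) ∂iidLaw ν =
      ∑ i ∈ Finset.range N, ∫ y, (D (i + 1) y - D i y) ∂iidLaw ν := by
    have h1 : ∀ i ∈ Finset.range N, ∫ y, (D (i + 1) y - D i y) ∂iidLaw ν =
        ∫ y, D (i + 1) y ∂iidLaw ν - ∫ y, D i y ∂iidLaw ν :=
      fun i _ => integral_sub (hDi _) (hDi _)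
    rw [Finset.sum_congr rfl h1, Finset.sum_range_sub (fun i => ∫ y, D i y ∂iidLaw ν)]
    simp only [hD, remVar_self, gaussSmooth_zero]
    simp [partialSum]
  have hbound (i : ℕ) (hi : i ∈ Finset.range N) : |∫ y, (D (i + 1) y - D i y) ∂iidLaw ν| ≤
      (if i < m + m then 2 * L * r else 0) +
        (r * ε + r ^ 2 * (18 * L ^ 6 * κ) + 11 * L ^ 5 * r ^ 3) := by
    have hpos : 0 ≤ r * ε + r ^ 2 * (18 * L ^ 6 * κ) + 11 * L ^ 5 * r ^ 3 := by positivity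
    split_ifs with him
    · exact (hsmall i (Finset.mem_range.1 hi)).trans (by linarith)
    · obtain ⟨p, rfl⟩ := Nat.exists_eq_add_of_le (not_lt.1 him)
      have hlt := Finset.mem_range.1 hi
      rw [show m + m + p = p + m + m by omega] at hlt ⊢
      rw [zero_add]
      exact hbig p hlt
  rw [htel]
  refine (Finset.abs_sum_le_sum_abs _ _).trans ((Finset.sum_le_sum hbound).trans ?_)
  rw [Finset.sum_add_distrib, ← Finset.sum_filter, Finset.sum_const, Finset.sum_const,
    Finset.card_range, nsmul_eq_mul, nsmul_eq_mul]
  have hcard : (((Finset.range N).filter fun i => i < m + m).card : ℝ) ≤ 2 * L := by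
    have : ((Finset.range N).filter fun i => i < m + m) ⊆ Finset.range (m + m) := by
      intro i
      simp
    have h2 : (((Finset.range N).filter fun i => i < m + m).card : ℝ) ≤ (m + m : ℕ) := by
      exact_mod_cast (Finset.card_le_card this).trans (by simp)
    push_cast at h2
    linarith
  have e1 : ((Finset.range N).filter fun i => i < m + m).card * (2 * L * r) ≤ 4 * L ^ 7 * r := by
    calc _ ≤ 2 * L * (2 * L * r) := by gcongr
      _ = 4 * L ^ 2 * r := by ring
      _ ≤ 4 * L ^ 7 * r := by
        gcongr
        norm_num
  have e2 : N * (r * ε + r ^ 2 * (18 * L ^ 6 * κ) + 11 * L ^ 5 * r ^ 3) ≤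
      L ^ 7 * (ε / r) + 18 * L ^ 7 * κ + 11 * L ^ 7 * r := by
    -- Only `N * r ^ 2` is bounded, so a first-order error `ε` per step is amplified to `ε / r` in
    -- total.
    have : N * (r * ε + r ^ 2 * (18 * L ^ 6 * κ) + 11 * L ^ 5 * r ^ 3) =
        (N * r ^ 2) * (ε / r + 18 * L ^ 6 * κ + 11 * L ^ 5 * r) := by
      field_simp
    rw [this]
    calc _ ≤ L * (ε / r + 18 * L ^ 6 * κ + 11 * L ^ 5 * r) := by gcongr
      _ = L ^ 1 * (ε / r) + 18 * L ^ 7 * κ + 11 * L ^ 6 * r := by ring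
      _ ≤ _ := by
        have g1 : L ^ 1 ≤ L ^ 7 := pow_le_pow_right₀ hL1 (by norm_num)
        have g2 : L ^ 6 ≤ L ^ 7 := pow_le_pow_right₀ hL1 (by norm_num)
        gcongr
  have e3 : 0 ≤ L ^ 7 * (ε / r) := by positivity
  have e4 : 0 ≤ L ^ 7 * r := by positivity
  linarith

end IsCenteredKernel

end Lindeberg

/-! ### Truncated moments of symmetric stable laws -/

/-- By Fubini both sides are the double integral of `exp (i x y)`. With one law Gaussian, a stable
law can be tested through its characteristic function alone, without a density. -/
lemma integral_charFun_comm (μ ρ : Measure ℝ) [IsProbabilityMeasure μ] [IsProbabilityMeasure ρ] :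
    ∫ x, charFun μ x ∂ρ = ∫ x, charFun ρ x ∂μ := by
  simp_rw [charFun_apply_real]
  rw [integral_integral_swap]
  · congr 1
    ext x
    congr 1
    ext y
    rw [mul_comm (y : ℂ) (x : ℂ)]
  · refine Integrable.of_bound (Measurable.aestronglyMeasurable (by fun_prop)) 1
      (ae_of_all _ fun p => ?_)
    have := Complex.norm_exp_ofReal_mul_I (p.1 * p.2)
    push_cast at this
    exact this.le

/-- From `exp (-u) ≤ (1 + u)⁻¹` the right side is at least `3 x ^ 2 / (2 + x ^ 2)`; the factor `3`
is what makes this reach `1` at `x ^ 2 = 1`. -/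
lemma min_one_sq_le (x : ℝ) : min 1 (x ^ 2) ≤ 3 * (1 - Real.exp (-(x ^ 2 / 2))) := by
  have h1 : Real.exp (-(x ^ 2 / 2)) ≤ (1 + x ^ 2 / 2)⁻¹ := by
    rw [Real.exp_neg]
    exact inv_anti₀ (by positivity) (by linarith [Real.add_one_le_exp (x ^ 2 / 2)])
  have h2 : min 1 (x ^ 2) ≤ 3 * (1 - (1 + x ^ 2 / 2)⁻¹) := by
    have h3 : 3 * (1 - (1 + x ^ 2 / 2)⁻¹) = 3 * x ^ 2 / (2 + x ^ 2) := by
      field_simp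
      ring
    rw [h3, le_div_iff₀ (by positivity)]
    rcases le_total 1 (x ^ 2) with h | h
    · rw [min_eq_left h]
      linarith
    · rw [min_eq_right h]
      nlinarith [sq_nonneg x]
  linarith

/-- The truncated second moment of a symmetric stable law with scale parameter `s`. -/
lemma integral_min_one_sq_le {ρ : Measure ℝ} [IsProbabilityMeasure ρ] {α s : ℝ} (hα : 0 < α)
    (hα' : α ≤ 2) (hs : 0 ≤ s)
    (hρ : ∀ β, charFun ρ β = Complex.exp ((-(s * |β| ^ α) : ℝ) : ℂ)) :
    ∫ x, min 1 (x ^ 2) ∂ρ ≤ 6 * s := by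
  have hint (F : ℝ → ℝ) (hF : Measurable F) (μ : Measure ℝ) [IsProbabilityMeasure μ]
      (h0 : ∀ x, 0 ≤ F x) : Integrable (fun x => Real.exp (-F x)) μ :=
    Integrable.of_bound (by fun_prop) 1 (ae_of_all _ fun x => by
      rw [Real.norm_of_nonneg (Real.exp_pos _).le]
      exact Real.exp_le_one_iff.2 (by linarith [h0 x]))
  have h1 : ∫ x, Real.exp (-(x ^ 2 / 2)) ∂ρ =
      ∫ β, Real.exp (-(s * |β| ^ α)) ∂gaussianReal 0 1 := by
    have h := integral_charFun_comm (gaussianReal 0 1) ρ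
    simp_rw [hρ, charFun_gaussianReal] at h
    have e (x : ℝ) : Complex.exp ((x : ℂ) * ((0 : ℝ) : ℂ) * Complex.I -
        ((1 : ℝ≥0) : ℂ) * (x : ℂ) ^ 2 / 2) = ((Real.exp (-(x ^ 2 / 2)) : ℝ) : ℂ) := by
      push_cast
      congr 1
      simp
    simp_rw [e, ← Complex.ofReal_exp, integral_complex_ofReal] at h
    exact_mod_cast h
  have hi1 : Integrable (fun x : ℝ => Real.exp (-(x ^ 2 / 2))) ρ :=
    hint (fun x => x ^ 2 / 2) (by fun_prop) ρ (fun x => by positivity)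
  have hi2 : Integrable (fun β : ℝ => Real.exp (-(s * |β| ^ α))) (gaussianReal 0 1) :=
    hint (fun β => s * |β| ^ α) (by fun_prop) _ (fun x => by positivity)
  -- Uses `1 - exp (-u) ≤ u` and `|β| ^ α ≤ 1 + β ^ 2`, whose Gaussian mean is `2`. The assumption
  -- `α ≤ 2` enters here.
  have h2 : 1 - ∫ β, Real.exp (-(s * |β| ^ α)) ∂gaussianReal 0 1 ≤ 2 * s := by
    have e : 1 - ∫ β, Real.exp (-(s * |β| ^ α)) ∂gaussianReal 0 1 =
        ∫ β, (1 - Real.exp (-(s * |β| ^ α))) ∂gaussianReal 0 1 := by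
      rw [integral_sub (integrable_const _) hi2]
      simp
    have e2 : ∫ β : ℝ, s * (1 + β ^ 2) ∂gaussianReal 0 1 = 2 * s := by
      rw [integral_const_mul, integral_add (integrable_const _) (integrable_pow_gaussianReal 2),
        integral_pow_two_gaussianReal]
      simp
      ring
    rw [e, ← e2]
    refine integral_mono ((integrable_const _).sub' hi2)
      (((integrable_const _).add (integrable_pow_gaussianReal 2)).const_mul s) fun β => ?_
    have h3 : 1 - Real.exp (-(s * |β| ^ α)) ≤ s * |β| ^ α := by
      linarith [Real.add_one_le_exp (-(s * |β| ^ α))]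
    refine h3.trans (mul_le_mul_of_nonneg_left ?_ hs)
    rcases le_total |β| 1 with h | h
    · have := Real.rpow_le_one (abs_nonneg β) h hα.le
      nlinarith [sq_nonneg β]
    · have := Real.rpow_le_rpow_of_exponent_le h hα'
      rw [Real.rpow_two, sq_abs] at this
      linarith
  calc ∫ x, min 1 (x ^ 2) ∂ρ ≤ ∫ x, 3 * (1 - Real.exp (-(x ^ 2 / 2))) ∂ρ := by
        refine integral_mono ?_ (((integrable_const _).sub' hi1).const_mul 3) min_one_sq_le
        exact Integrable.of_bound (by fun_prop) 1 (ae_of_all _ fun x => by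
          rw [Real.norm_of_nonneg (le_min zero_le_one (sq_nonneg x))]
          exact min_le_left _ _)
    _ = 3 * (1 - ∫ x, Real.exp (-(x ^ 2 / 2)) ∂ρ) := by
        rw [integral_const_mul, integral_sub (integrable_const _) hi1]
        simp
    _ ≤ 6 * s := by
        rw [h1]
        linarith

lemma truncNorm_sq_eq {E : Type*} [NormedAddCommGroup E] (v : E) :
    truncNorm v ^ 2 = min 1 (‖v‖ ^ 2) := by
  unfold truncNorm
  rcases le_total 1 ‖v‖ with h | h
  · rw [min_eq_left h, min_eq_left (one_le_pow₀ h), one_pow]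
  · rw [min_eq_right h, min_eq_right (pow_le_one₀ (norm_nonneg v) h)]

/-- The truncated squared norm is at most the sum of the truncated squared coordinates, so only the
one-dimensional marginals matter. -/
lemma integral_truncNorm_sq_le_of_charFun {d : ℕ} {ρ : Measure (EuclideanSpace ℝ (Fin d))}
    [IsProbabilityMeasure ρ] {α s : ℝ} (hα : 0 < α) (hα' : α ≤ 2) (hs : 0 ≤ s)
    (hρ : ∀ (l : Fin d) (β : ℝ),
      charFun (ρ.map fun x => x l) β = Complex.exp ((-(s * |β| ^ α) : ℝ) : ℂ)) :
    ∫ x, truncNorm x ^ 2 ∂ρ ≤ 6 * d * s := by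
  have hint (l : Fin d) : Integrable (fun x : EuclideanSpace ℝ (Fin d) => min 1 (x l ^ 2)) ρ :=
    Integrable.of_bound (by fun_prop) 1 (ae_of_all _ fun x => by
      rw [Real.norm_of_nonneg (le_min zero_le_one (sq_nonneg _))]
      exact min_le_left _ _)
  calc ∫ x, truncNorm x ^ 2 ∂ρ ≤ ∫ x, ∑ l, min 1 (x l ^ 2) ∂ρ := by
        refine integral_mono (integrable_truncNorm_pow measurable_id 2)
          (integrable_finsetSum _ fun l _ => hint l) fun x => ?_
        rw [truncNorm_sq_eq, EuclideanSpace.norm_sq_eq]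
        simp only [Real.norm_eq_abs, sq_abs]
        by_cases h : ∃ l, 1 ≤ x l ^ 2
        · obtain ⟨l, hl⟩ := h
          refine (min_le_left _ _).trans ?_
          refine (min_eq_left hl).ge.trans ?_
          exact Finset.single_le_sum (f := fun l => min 1 (x l ^ 2))
            (fun i _ => le_min zero_le_one (sq_nonneg _)) (Finset.mem_univ l)
        · push Not at h
          refine (min_le_right _ _).trans (Finset.sum_le_sum fun l _ => ?_)
          rw [min_eq_right (h l).le]
    _ = ∑ l, ∫ x, min 1 (x l ^ 2) ∂ρ := integral_finsetSum _ fun l _ => hint l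
    _ ≤ ∑ l : Fin d, 6 * s := by
        refine Finset.sum_le_sum fun l _ => ?_
        have : IsProbabilityMeasure (ρ.map fun x : EuclideanSpace ℝ (Fin d) => x l) :=
          Measure.isProbabilityMeasure_map (by fun_prop)
        have h := integral_min_one_sq_le hα hα' hs (hρ l)
        rwa [integral_map (by fun_prop) (by fun_prop)] at h
    _ = 6 * d * s := by
        simp
        ring

/-! ### From truncated second moments to truncated first moments. -/

section Dyadic

variable {E : Type*} [NormedAddCommGroup E] [NormedSpace ℝ E]

/-- For `‖u‖ ≤ 1/2` doubling `u` exactly doubles the truncated norm; otherwise the truncated norm is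
at least `1/2` and twice its square dominates it. -/
lemma truncNorm_le_dyadic_step (u : E) :
    truncNorm u ≤ 2 * truncNorm u ^ 2 + 2⁻¹ * truncNorm ((2 : ℝ) • u) := by
  have h0 := truncNorm_nonneg u
  have h0' := truncNorm_nonneg ((2 : ℝ) • u)
  rcases le_total ‖u‖ 2⁻¹ with h | h
  · have h1 : truncNorm u = ‖u‖ := min_eq_right (h.trans (by norm_num))
    have h2 : truncNorm ((2 : ℝ) • u) = 2 * ‖u‖ := by
      rw [truncNorm, norm_smul, Real.norm_two]
      exact min_eq_right (by linarith)
    rw [h1, h2]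
    nlinarith [sq_nonneg ‖u‖]
  · have h1 : 2⁻¹ ≤ truncNorm u := le_min (by norm_num) h
    nlinarith

lemma truncNorm_le_dyadic_sum (v : E) (K : ℕ) :
    truncNorm v ≤ 2 * ∑ k ∈ Finset.range K, (2⁻¹ : ℝ) ^ k * truncNorm ((2 : ℝ) ^ k • v) ^ 2 +
      (2⁻¹ : ℝ) ^ K * truncNorm ((2 : ℝ) ^ K • v) := by
  induction K with
  | zero => simp
  | succ K ih =>
    have h := truncNorm_le_dyadic_step ((2 : ℝ) ^ K • v)
    rw [smul_smul, ← pow_succ'] at h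
    have hp : (0 : ℝ) < 2⁻¹ ^ K := by positivity
    rw [Finset.sum_range_succ, pow_succ (2⁻¹ : ℝ)]
    have := mul_le_mul_of_nonneg_left h hp.le
    linarith

variable [MeasurableSpace E] [BorelSpace E] [SecondCountableTopology E] {ν : Measure E}
  [IsProbabilityMeasure ν] {A α b : ℝ}

/-- The term at scale `2 ^ k` contributes `2 ^ (-k) * (2 ^ k * b) ^ α`, a geometric sequence of
ratio `2 ^ (α - 1)`. The three regimes of `α` are those in which this ratio is below, equal to or
above `1`. -/
lemma integral_truncNorm_le_dyadic_sum
    (hA : ∀ b : ℝ, 0 ≤ b → ∫ x, truncNorm (b • x) ^ 2 ∂ν ≤ A * b ^ α) (hb : 0 ≤ b) (K : ℕ) :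
    ∫ x, truncNorm (b • x) ∂ν ≤
      2 * A * b ^ α * ∑ k ∈ Finset.range K, ((2 : ℝ) ^ (α - 1)) ^ k + 2⁻¹ ^ K := by
  have hi (k : ℕ) : Integrable (fun x => (2⁻¹ : ℝ) ^ k * truncNorm ((2 : ℝ) ^ k • b • x) ^ 2) ν :=
    (integrable_truncNorm_pow (by fun_prop) 2).const_mul _
  have hi2 : Integrable (fun x => (2⁻¹ : ℝ) ^ K * truncNorm ((2 : ℝ) ^ K • b • x)) ν :=
    (integrable_truncNorm (by fun_prop)).const_mul _
  calc ∫ x, truncNorm (b • x) ∂ν ≤ ∫ x, (2 * ∑ k ∈ Finset.range K,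
        (2⁻¹ : ℝ) ^ k * truncNorm ((2 : ℝ) ^ k • b • x) ^ 2 +
          (2⁻¹ : ℝ) ^ K * truncNorm ((2 : ℝ) ^ K • b • x)) ∂ν :=
        integral_mono (integrable_truncNorm (by fun_prop))
          (((integrable_finsetSum _ fun k _ => hi k).const_mul 2).add hi2)
          fun x => truncNorm_le_dyadic_sum (b • x) K
    _ = 2 * ∑ k ∈ Finset.range K, (2⁻¹ : ℝ) ^ k * ∫ x, truncNorm (((2 : ℝ) ^ k * b) • x) ^ 2 ∂ν +
          (2⁻¹ : ℝ) ^ K * ∫ x, truncNorm ((2 : ℝ) ^ K • b • x) ∂ν := by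
        rw [integral_add ((integrable_finsetSum _ fun k _ => hi k).const_mul 2) hi2,
          integral_const_mul, integral_finsetSum _ fun k _ => hi k, integral_const_mul]
        simp_rw [integral_const_mul, smul_smul]
    _ ≤ 2 * ∑ k ∈ Finset.range K, (A * b ^ α) * ((2 : ℝ) ^ (α - 1)) ^ k +
          (2⁻¹ : ℝ) ^ K * 1 := by
        refine add_le_add (mul_le_mul_of_nonneg_left (Finset.sum_le_sum fun k _ => ?_) zero_le_two)
          (mul_le_mul_of_nonneg_left ?_ (by positivity))
        · calc (2⁻¹ : ℝ) ^ k * ∫ x, truncNorm (((2 : ℝ) ^ k * b) • x) ^ 2 ∂ν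
              ≤ (2⁻¹ : ℝ) ^ k * (A * ((2 : ℝ) ^ k * b) ^ α) := by
                gcongr
                exact hA _ (by positivity)
            _ = (A * b ^ α) * ((2 : ℝ) ^ (α - 1)) ^ k := by
                rw [Real.mul_rpow (by positivity) hb, ← Real.rpow_natCast, ← Real.rpow_natCast,
                  ← Real.rpow_natCast, ← Real.rpow_mul (by norm_num), ← Real.rpow_mul (by norm_num),
                  Real.inv_rpow (by norm_num), ← Real.rpow_neg (by norm_num),
                  show (α - 1) * (k : ℝ) = -(k : ℝ) + k * α by ring,
                  Real.rpow_add (by norm_num)]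
                ring
        · calc _ ≤ ∫ x, (1 : ℝ) ∂ν := integral_mono (integrable_truncNorm (by fun_prop))
                (integrable_const _) fun x => truncNorm_le_one _
            _ = 1 := by simp
    _ = _ := by
        rw [← Finset.mul_sum, mul_one]
        ring

lemma const_nonneg_of_integral_truncNorm_sq_le
    (hA : ∀ b : ℝ, 0 ≤ b → ∫ x, truncNorm (b • x) ^ 2 ∂ν ≤ A * b ^ α) : 0 ≤ A := by
  have := hA 1 zero_le_one
  rw [Real.one_rpow, mul_one] at this
  exact (integral_nonneg fun _ => sq_nonneg _).trans this

/-- The ratio is below `1`, so the number of scales tends to infinity and the geometric series is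
summed. -/
lemma integral_truncNorm_le_of_lt_one (hα : α < 1)
    (hA : ∀ b : ℝ, 0 ≤ b → ∫ x, truncNorm (b • x) ^ 2 ∂ν ≤ A * b ^ α) (hb : 0 ≤ b) :
    ∫ x, truncNorm (b • x) ∂ν ≤ 2 * A * (1 - (2 : ℝ) ^ (α - 1))⁻¹ * b ^ α := by
  have hA0 := const_nonneg_of_integral_truncNorm_sq_le hA
  have hq0 : (0 : ℝ) ≤ (2 : ℝ) ^ (α - 1) := by positivity
  have hq1 : (2 : ℝ) ^ (α - 1) < 1 := Real.rpow_lt_one_of_one_lt_of_neg (by norm_num) (by linarith)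
  have hlim : Tendsto (fun K : ℕ => 2 * A * b ^ α * (1 - (2 : ℝ) ^ (α - 1))⁻¹ + 2⁻¹ ^ K) atTop
      (𝓝 (2 * A * b ^ α * (1 - (2 : ℝ) ^ (α - 1))⁻¹ + 0)) :=
    tendsto_const_nhds.add (tendsto_pow_atTop_nhds_zero_of_lt_one (by norm_num) (by norm_num))
  rw [add_zero] at hlim
  refine (ge_of_tendsto' hlim fun K => ?_).trans_eq (by ring)
  refine (integral_truncNorm_le_dyadic_sum hA hb K).trans ?_
  gcongr
  exact (summable_geometric_of_lt_one hq0 hq1).sum_le_tsum _ (fun _ _ => by positivity) |>.trans_eq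
    (tsum_geometric_of_lt_one hq0 hq1)

lemma integral_truncNorm_le_of_one_lt (hα : 1 < α)
    (hA : ∀ b : ℝ, 0 ≤ b → ∫ x, truncNorm (b • x) ^ 2 ∂ν ≤ A * b ^ α) (hb : 0 < b) (hb1 : b ≤ 1) :
    ∫ x, truncNorm (b • x) ∂ν ≤
      (2 * A * ((2 : ℝ) ^ (α - 1) * ((2 : ℝ) ^ (α - 1) - 1)⁻¹) + 1) * b := by
  have hA0 := const_nonneg_of_integral_truncNorm_sq_le hA
  set Q := (2 : ℝ) ^ (α - 1) with hQ
  have hq1 : 1 < Q := Real.one_lt_rpow (by norm_num) (by linarith)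
  -- The scales stop where `2 ^ K * b` is about `1`. The growing geometric sum is comparable to its
  -- last term, of order `b ^ (1 - α)`, and the remainder `2 ^ (-K - 1)` is at most `b`.
  obtain ⟨K, hK1, hK2⟩ := exists_nat_pow_near (one_le_inv_iff₀.2 ⟨hb, hb1⟩) one_lt_two
  refine (integral_truncNorm_le_dyadic_sum hA hb.le (K + 1)).trans ?_
  rw [geom_sum_eq hq1.ne']
  have hQK : Q ^ (K + 1) ≤ Q * b ^ (1 - α) := by
    rw [pow_succ']
    gcongr
    calc Q ^ K = ((2 : ℝ) ^ K) ^ (α - 1) := by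
          rw [hQ, ← Real.rpow_natCast, ← Real.rpow_natCast, ← Real.rpow_mul (by norm_num),
            ← Real.rpow_mul (by norm_num), mul_comm]
      _ ≤ b⁻¹ ^ (α - 1) := by
          gcongr
      _ = b ^ (1 - α) := by
          rw [Real.inv_rpow hb.le, ← Real.rpow_neg hb.le, neg_sub]
  have h2 : (2⁻¹ : ℝ) ^ (K + 1) ≤ b := by
    rw [inv_pow]
    exact inv_le_of_inv_le₀ hb hK2.le
  have hq2 : 0 < Q - 1 := by linarith
  calc _ ≤ 2 * A * b ^ α * ((Q * b ^ (1 - α)) / (Q - 1)) + b := by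
        have : Q ^ (K + 1) - 1 ≤ Q * b ^ (1 - α) := by linarith
        gcongr
    _ = 2 * A * (b ^ α * b ^ (1 - α)) * (Q / (Q - 1)) + b := by ring
    _ = _ := by
        rw [← Real.rpow_add hb, show α + (1 - α) = 1 by ring, Real.rpow_one]
        ring

/-- All scales contribute equally, and about `log₂ n` of them are needed before the remainder falls
below `1 / n`. The assumption `2 ≤ n` lets `log n` absorb the additive constants. -/
lemma integral_truncNorm_le_of_eq_one
    (hA : ∀ b : ℝ, 0 ≤ b → ∫ x, truncNorm (b • x) ^ 2 ∂ν ≤ A * b) {n : ℕ} (hn : 2 ≤ n) :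
    ∫ x, truncNorm ((n : ℝ)⁻¹ • x) ∂ν ≤ (4 * A + 1) / Real.log 2 * (Real.log n / n) := by
  have hA' : ∀ b : ℝ, 0 ≤ b → ∫ x, truncNorm (b • x) ^ 2 ∂ν ≤ A * b ^ (1 : ℝ) := by simpa using hA
  have hA0 := const_nonneg_of_integral_truncNorm_sq_le hA'
  have hn0 : (0 : ℝ) < n := by positivity
  have hl2 : 0 < Real.log 2 := Real.log_pos (by norm_num)
  have h := integral_truncNorm_le_dyadic_sum hA' (inv_nonneg.2 hn0.le) (Nat.log 2 n + 1)
  refine h.trans ?_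
  simp only [sub_self, Real.rpow_zero, one_pow, Finset.sum_const, Finset.card_range, nsmul_eq_mul,
    mul_one, Real.rpow_one]
  have h1 : (2⁻¹ : ℝ) ^ (Nat.log 2 n + 1) ≤ (n : ℝ)⁻¹ := by
    rw [inv_pow]
    refine inv_anti₀ hn0 ?_
    exact_mod_cast (Nat.lt_pow_succ_log_self (by norm_num) n).le
  have h2 : (Nat.log 2 n : ℝ) * Real.log 2 ≤ Real.log n := by
    rw [← Real.log_pow]
    exact Real.log_le_log (by positivity) (by exact_mod_cast Nat.pow_log_le_self 2 (by omega))
  have h3 : Real.log 2 ≤ Real.log n := Real.log_le_log (by norm_num) (by exact_mod_cast hn)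
  have h4 : ((Nat.log 2 n + 1 : ℕ) : ℝ) ≤ 2 * (Real.log n / Real.log 2) := by
    rw [← mul_div_assoc, le_div_iff₀ hl2]
    push_cast
    linarith
  have h5 : 1 ≤ Real.log n / Real.log 2 := by rwa [le_div_iff₀ hl2, one_mul]
  calc _ ≤ 2 * A * (n : ℝ)⁻¹ * (2 * (Real.log n / Real.log 2)) + (n : ℝ)⁻¹ * 1 := by
        rw [mul_one]
        gcongr
    _ ≤ 2 * A * (n : ℝ)⁻¹ * (2 * (Real.log n / Real.log 2)) +
          (n : ℝ)⁻¹ * (Real.log n / Real.log 2) := by gcongr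
    _ = _ := by ring

lemma integral_truncNorm_le_sqrt {α' : Type*} [MeasurableSpace α'] {μ : Measure α'}
    [IsProbabilityMeasure μ] {F : α' → E} (hF : Measurable F) :
    ∫ x, truncNorm (F x) ∂μ ≤ √(∫ x, truncNorm (F x) ^ 2 ∂μ) := by
  refine Real.le_sqrt_of_sq_le ?_
  have h := variance_nonneg (fun x => truncNorm (F x)) μ
  have hm : MemLp (fun x => truncNorm (F x)) 2 μ :=
    MemLp.of_bound (measurable_truncNorm.comp hF).aestronglyMeasurable 1
      (ae_of_all _ fun x => abs_truncNorm_le_one _)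
  rw [variance_eq_sub hm] at h
  simpa using h

end Dyadic

/-! ### Existence of Brownian motion by the Schauder expansion -/

/-- The length of `[0, t] ∩ [j 2⁻ᵏ, (j + 1) 2⁻ᵏ]`. -/
noncomputable def dyadicLen (k j : ℕ) (t : ℝ) : ℝ :=
  min t (((j : ℝ) + 1) / 2 ^ k) - min t ((j : ℝ) / 2 ^ k)

lemma dyadicLen_nonneg (k j : ℕ) (t : ℝ) : 0 ≤ dyadicLen k j t := by
  unfold dyadicLen
  have : (j : ℝ) / 2 ^ k ≤ ((j : ℝ) + 1) / 2 ^ k := by gcongr; linarith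
  have := min_le_min (le_refl t) this
  linarith

lemma dyadicLen_le (k j : ℕ) (t : ℝ) : dyadicLen k j t ≤ (2 ^ k)⁻¹ := by
  unfold dyadicLen
  have h : ((j : ℝ) + 1) / 2 ^ k = (j : ℝ) / 2 ^ k + (2 ^ k)⁻¹ := by
    rw [add_div, one_div]
  have hp : (0 : ℝ) ≤ (2 ^ k)⁻¹ := by positivity
  rw [h]
  rcases le_total t ((j : ℝ) / 2 ^ k) with h1 | h1
  · rw [min_eq_left h1, min_eq_left (by linarith)]; linarith
  · rw [min_eq_right h1]
    have := min_le_right t ((j : ℝ) / 2 ^ k + (2 ^ k)⁻¹)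
    linarith

lemma dyadicLen_split (k j : ℕ) (t : ℝ) :
    dyadicLen k j t = dyadicLen (k + 1) (2 * j) t + dyadicLen (k + 1) (2 * j + 1) t := by
  unfold dyadicLen
  have h1 : ((2 * j : ℕ) : ℝ) / 2 ^ (k + 1) = j / 2 ^ k := by
    push_cast; rw [pow_succ']; field_simp
  have h2 : (((2 * j + 1 : ℕ) : ℝ) + 1) / 2 ^ (k + 1) = (j + 1) / 2 ^ k := by
    push_cast; rw [pow_succ']; field_simp; ring
  have h3 : (((2 * j : ℕ) : ℝ) + 1) = ((2 * j + 1 : ℕ) : ℝ) := by push_cast; ring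
  rw [h1, h2, h3]; ring

lemma dyadicLen_of_le {k j : ℕ} {t : ℝ} (h : t ≤ j / 2 ^ k) : dyadicLen k j t = 0 := by
  unfold dyadicLen
  have : (j : ℝ) / 2 ^ k ≤ ((j : ℝ) + 1) / 2 ^ k := by gcongr; linarith
  rw [min_eq_left h, min_eq_left (h.trans this), sub_self]

lemma dyadicLen_of_ge {k j : ℕ} {t : ℝ} (h : ((j : ℝ) + 1) / 2 ^ k ≤ t) :
    dyadicLen k j t = (2 ^ k)⁻¹ := by
  unfold dyadicLen
  have : (j : ℝ) / 2 ^ k ≤ ((j : ℝ) + 1) / 2 ^ k := by gcongr; linarith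
  rw [min_eq_right h, min_eq_right (this.trans h), add_div, one_div]; ring

lemma continuous_dyadicLen (k j : ℕ) : Continuous (dyadicLen k j) := by
  unfold dyadicLen; fun_prop

lemma sum_dyadicLen {M : ℕ} {t : ℝ} (ht : 0 ≤ t) (htM : t ≤ M) (k : ℕ) :
    ∑ j ∈ Finset.range (M * 2 ^ k), dyadicLen k j t = t := by
  have : ∀ j : ℕ, dyadicLen k j t
      = (fun i : ℕ => min t ((i : ℝ) / 2 ^ k)) (j + 1) - (fun i : ℕ => min t ((i : ℝ) / 2 ^ k)) j := by
    intro j; simp [dyadicLen]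
  simp_rw [this]
  rw [Finset.sum_range_sub fun i : ℕ => min t ((i : ℝ) / 2 ^ k)]
  have h2 : ((M * 2 ^ k : ℕ) : ℝ) / 2 ^ k = M := by push_cast; field_simp
  simp only [h2]
  simp [ht, htM]

lemma eq_floor_of_div_lt_of_lt_div {k j : ℕ} {s t : ℝ} (hst : s ≤ t) (h1 : j / 2 ^ k < s)
    (h2 : t < ((j : ℝ) + 1) / 2 ^ k) : j = ⌊s * 2 ^ k⌋₊ := by
  symm
  rw [div_lt_iff₀ (by positivity)] at h1
  rw [lt_div_iff₀ (by positivity)] at h2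
  have : s * 2 ^ k ≤ t * 2 ^ k := by gcongr
  rw [Nat.floor_eq_iff (by have : (0 : ℝ) ≤ j := by positivity
                           linarith)]
  exact ⟨h1.le, by linarith⟩

/-- A dyadic interval lying entirely before `t` or entirely after `s` gives no error. The only
exception is an interval containing both `s` and `t`, of which there is at most one per level. -/
lemma abs_sum_dyadicLen_mul_sub_le {M : ℕ} {s t : ℝ} (hs : 0 ≤ s) (hst : s ≤ t) (htM : t ≤ M)
    (k : ℕ) :
    |2 ^ k * ∑ j ∈ Finset.range (M * 2 ^ k), dyadicLen k j s * dyadicLen k j t - s|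
      ≤ (2 ^ k)⁻¹ := by
  have hp : (0 : ℝ) < 2 ^ k := by positivity
  have h1 : 2 ^ k * ∑ j ∈ Finset.range (M * 2 ^ k), dyadicLen k j s * dyadicLen k j t - s
      = ∑ j ∈ Finset.range (M * 2 ^ k), dyadicLen k j s * (2 ^ k * dyadicLen k j t - 1) := by
    conv_lhs => rw [← sum_dyadicLen (M := M) hs (hst.trans htM) k]
    rw [sum_dyadicLen (M := M) hs (hst.trans htM) k]
    simp_rw [mul_sub, mul_one, Finset.sum_sub_distrib, sum_dyadicLen (M := M) hs (hst.trans htM) k,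
      Finset.mul_sum]
    congr 1
    exact Finset.sum_congr rfl fun j _ => by ring
  rw [h1]
  refine (Finset.abs_sum_le_sum_abs _ _).trans ?_
  have h2 : ∀ j ∈ Finset.range (M * 2 ^ k), |dyadicLen k j s * (2 ^ k * dyadicLen k j t - 1)|
      ≤ if j = ⌊s * 2 ^ k⌋₊ then ((2 : ℝ) ^ k)⁻¹ else 0 := by
    intro j _
    split_ifs with hj
    · rw [abs_mul, abs_of_nonneg (dyadicLen_nonneg _ _ _)]
      have h3 : |2 ^ k * dyadicLen k j t - 1| ≤ 1 := by
        have a := dyadicLen_nonneg k j t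
        have b := mul_le_mul_of_nonneg_left (dyadicLen_le k j t) hp.le
        rw [mul_inv_cancel₀ hp.ne'] at b
        rw [abs_le]; constructor <;> nlinarith
      calc _ ≤ (2 ^ k)⁻¹ * 1 := mul_le_mul (dyadicLen_le _ _ _) h3 (abs_nonneg _) (by positivity)
        _ = _ := mul_one _
    · rcases le_or_gt s (j / 2 ^ k) with h3 | h3
      · rw [dyadicLen_of_le h3]; simp
      · rcases le_or_gt (((j : ℝ) + 1) / 2 ^ k) t with h4 | h4
        · rw [dyadicLen_of_ge h4, mul_inv_cancel₀ hp.ne']; simp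
        · exact absurd (eq_floor_of_div_lt_of_lt_div hst h3 h4) hj
  refine (Finset.sum_le_sum h2).trans ?_
  rw [Finset.sum_ite_eq']
  split_ifs
  · exact le_rfl
  · positivity

/-- The Schauder functions: primitives of the Haar functions on `[0, ∞)`. -/
noncomputable def schauder : ℕ → ℕ → ℝ → ℝ
  | 0, j, t => dyadicLen 0 j t
  | k + 1, j, t => √(2 ^ k) * (dyadicLen (k + 1) (2 * j) t - dyadicLen (k + 1) (2 * j + 1) t)

lemma continuous_schauder (k j : ℕ) : Continuous (schauder k j) := by
  cases k with
  | zero => exact continuous_dyadicLen 0 j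
  | succ k =>
    exact continuous_const.mul ((continuous_dyadicLen _ _).sub (continuous_dyadicLen _ _))

lemma schauder_succ_eq_zero {k j : ℕ} {t : ℝ} (h : j ≠ ⌊t * 2 ^ k⌋₊) :
    schauder (k + 1) j t = 0 := by
  have e1 : ((2 * j : ℕ) : ℝ) / 2 ^ (k + 1) = j / 2 ^ k := by
    push_cast; rw [pow_succ']; field_simp
  have e2 : (((2 * j + 1 : ℕ) : ℝ) + 1) / 2 ^ (k + 1) = (j + 1) / 2 ^ k := by
    push_cast; rw [pow_succ']; field_simp; ring
  have e3 : (((2 * j : ℕ) : ℝ)) ≤ ((2 * j + 1 : ℕ) : ℝ) := by push_cast; linarith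
  have e4 : (((2 * j : ℕ) : ℝ)) + 1 ≤ ((2 * j + 1 : ℕ) : ℝ) + 1 := by linarith
  simp only [schauder]
  rcases le_or_gt t (j / 2 ^ k) with h3 | h3
  · rw [dyadicLen_of_le (h3.trans e1.ge), dyadicLen_of_le]
    · simp
    · refine (h3.trans e1.ge).trans ?_
      gcongr
  · rcases le_or_gt (((j : ℝ) + 1) / 2 ^ k) t with h4 | h4
    · rw [dyadicLen_of_ge (e2.le.trans h4), dyadicLen_of_ge]
      · simp
      · refine le_trans ?_ (e2.le.trans h4)
        gcongr
    · exact absurd (eq_floor_of_div_lt_of_lt_div le_rfl h3 h4) h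

lemma abs_schauder_succ_le (k j : ℕ) (t : ℝ) : |schauder (k + 1) j t| ≤ (√(2 ^ k))⁻¹ := by
  simp only [schauder]
  have a1 := dyadicLen_nonneg (k + 1) (2 * j) t
  have a2 := dyadicLen_nonneg (k + 1) (2 * j + 1) t
  have a3 := dyadicLen_split k j t
  have a4 := dyadicLen_le k j t
  have hs : 0 < √((2 : ℝ) ^ k) := Real.sqrt_pos.2 (by positivity)
  have h : |dyadicLen (k + 1) (2 * j) t - dyadicLen (k + 1) (2 * j + 1) t| ≤ (2 ^ k)⁻¹ := by
    rw [abs_le]; constructor <;> linarith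
  rw [abs_mul, abs_of_pos hs]
  calc _ ≤ √(2 ^ k) * (2 ^ k)⁻¹ := by gcongr
    _ = √(2 ^ k) * (√(2 ^ k) * √(2 ^ k))⁻¹ := by rw [Real.mul_self_sqrt (by positivity)]
    _ = _ := by field_simp

lemma sum_range_two_mul (f : ℕ → ℝ) (J : ℕ) :
    ∑ i ∈ Finset.range (2 * J), f i = ∑ j ∈ Finset.range J, (f (2 * j) + f (2 * j + 1)) := by
  induction J with
  | zero => simp
  | succ J ih => rw [Finset.sum_range_succ, ← ih, mul_add, mul_one, Finset.sum_range_succ,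
      Finset.sum_range_succ]; ring

/-- Parseval for the Haar basis up to level `n`. Passing to the next level uses `(a + b)(c + d) + (a
- b)(c - d) = 2 (a c + b d)`. The truncated subtraction in `2 ^ (k - 1)` gives `M` functions both at
level `0` and at level `1`, as it should. -/
lemma sum_schauder_mul (M n : ℕ) (s t : ℝ) :
    ∑ k ∈ Finset.range (n + 1), ∑ j ∈ Finset.range (M * 2 ^ (k - 1)),
      schauder k j s * schauder k j t
      = 2 ^ n * ∑ j ∈ Finset.range (M * 2 ^ n), dyadicLen n j s * dyadicLen n j t := by
  induction n with
  | zero => simp [schauder]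
  | succ n ih =>
    rw [Finset.sum_range_succ, ih, show M * 2 ^ (n + 1) = 2 * (M * 2 ^ n) by ring,
      sum_range_two_mul, Finset.mul_sum, Finset.mul_sum, Nat.add_sub_cancel, ← Finset.sum_add_distrib]
    refine Finset.sum_congr rfl fun j _ => ?_
    have hs : √((2 : ℝ) ^ n) * √((2 : ℝ) ^ n) = 2 ^ n := Real.mul_self_sqrt (by positivity)
    rw [dyadicLen_split n j s, dyadicLen_split n j t]
    simp only [schauder]
    linear_combination ((dyadicLen (n + 1) (2 * j) s - dyadicLen (n + 1) (2 * j + 1) s) *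
      (dyadicLen (n + 1) (2 * j) t - dyadicLen (n + 1) (2 * j + 1) t)) * hs

lemma tendsto_sum_schauder_mul {M : ℕ} {s t : ℝ} (hs : 0 ≤ s) (ht : 0 ≤ t) (hsM : s ≤ M)
    (htM : t ≤ M) :
    Tendsto (fun n => ∑ k ∈ Finset.range n, ∑ j ∈ Finset.range (M * 2 ^ (k - 1)),
      schauder k j s * schauder k j t) atTop (𝓝 (min s t)) := by
  wlog hst : s ≤ t generalizing s t
  · have := this ht hs htM hsM (le_of_not_ge hst)
    simp_rw [mul_comm (schauder _ _ s), min_comm s t]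
    exact this
  rw [← tendsto_add_atTop_iff_nat 1, min_eq_left hst]
  simp_rw [sum_schauder_mul]
  refine tendsto_iff_dist_tendsto_zero.2 (squeeze_zero (fun _ => dist_nonneg)
    (fun n => ?_) (tendsto_inv_atTop_zero.comp (tendsto_pow_atTop_atTop_of_one_lt one_lt_two)))
  exact abs_sum_dyadicLen_mul_sub_le hs hst htM n

/-- The `k`-th level of the Schauder expansion on `[0, M]`. -/
noncomputable def schauderLevel (M k : ℕ) (t : ℝ) (ω : ℕ × ℕ → ℝ) : ℝ :=
  ∑ j ∈ Finset.range (M * 2 ^ (k - 1)), schauder k j t * ω (k, j)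

lemma schauder_eq_zero_of_le {M k j : ℕ} {t : ℝ} (htM : t ≤ M)
    (hj : M * 2 ^ (k - 1) ≤ j) : schauder k j t = 0 := by
  have hj' : (M : ℝ) * 2 ^ (k - 1) ≤ j := by exact_mod_cast hj
  cases k with
  | zero =>
    simp only [schauder]
    apply dyadicLen_of_le
    rw [pow_zero, div_one]
    rw [Nat.zero_sub, pow_zero, mul_one] at hj'
    exact htM.trans hj'
  | succ k =>
    simp only [Nat.add_sub_cancel] at hj'
    have h : (2 : ℝ) ^ (k + 1) = 2 * 2 ^ k := by ring
    simp only [schauder]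
    rw [dyadicLen_of_le, dyadicLen_of_le]
    · simp
    · rw [le_div_iff₀ (by positivity)]
      push_cast
      rw [h]
      nlinarith [show (0 : ℝ) < 2 ^ k by positivity]
    · rw [le_div_iff₀ (by positivity)]
      push_cast
      rw [h]
      nlinarith [show (0 : ℝ) < 2 ^ k by positivity]

lemma schauderLevel_eq {M M' k : ℕ} {t : ℝ} (htM : t ≤ M) (hM : M ≤ M')
    (ω : ℕ × ℕ → ℝ) : schauderLevel M' k t ω = schauderLevel M k t ω := by
  unfold schauderLevel
  symm
  refine Finset.sum_subset (Finset.range_mono (by gcongr)) fun j _ hj => ?_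
  rw [schauder_eq_zero_of_le htM (by simpa using hj), zero_mul]

/-- Within one level the supports are disjoint, so a single coefficient contributes at each time. -/
lemma abs_schauderLevel_succ_le {M k : ℕ} {ω : ℕ × ℕ → ℝ} {c : ℝ} (hc : 0 ≤ c)
    (h : ∀ j < M * 2 ^ k, |ω (k + 1, j)| ≤ c) (t : ℝ) :
    |schauderLevel M (k + 1) t ω| ≤ (√(2 ^ k))⁻¹ * c := by
  unfold schauderLevel
  refine (Finset.abs_sum_le_sum_abs _ _).trans ?_
  refine (Finset.sum_le_sum (g := fun j => if j = ⌊t * 2 ^ k⌋₊ then (√(2 ^ k))⁻¹ * c else 0)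
    fun j hj => ?_).trans ?_
  · split_ifs with h1
    · rw [abs_mul]
      exact mul_le_mul (abs_schauder_succ_le k j t) (h j (by simpa using hj)) (abs_nonneg _)
        (by positivity)
    · rw [schauder_succ_eq_zero h1]; simp
  · rw [Finset.sum_ite_eq']
    split_ifs
    · exact le_rfl
    · positivity

/-- A continuous function on every `[0, M]` is obtained when the coefficients grow slowly. -/
lemma exists_summable_bound_schauderLevel {M : ℕ} {ω : ℕ × ℕ → ℝ} {c : ℝ} (hc : 1 ≤ c)
    (h : ∀ k, ∀ j < M * 2 ^ k, ω (k + 1, j) ^ 4 ≤ c * 3 ^ k) :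
    ∃ u : ℕ → ℝ, Summable u ∧ ∀ k t, |schauderLevel M (k + 1) t ω| ≤ u k := by
  -- Coefficients of size `3 ^ (k / 4)` against Schauder functions of size `2 ^ (-k / 2)` leave the
  -- geometric rate `(3 / 4) ^ (1 / 4)`.
  set r : ℝ := √(√(3 / 4)) with hr
  have hr0 : 0 ≤ r := Real.sqrt_nonneg _
  have hr4 : r ^ 4 = 3 / 4 := by
    rw [show r ^ 4 = (r ^ 2) ^ 2 by ring, Real.sq_sqrt (Real.sqrt_nonneg _),
      Real.sq_sqrt (by norm_num)]
  have hr1 : r < 1 := by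
    by_contra hcon
    have := one_le_pow₀ (n := 4) (not_lt.1 hcon)
    rw [hr4] at this; norm_num at this
  refine ⟨fun k => c * r ^ k, (summable_geometric_of_lt_one hr0 hr1).mul_left c, fun k t => ?_⟩
  have hs : 0 < √((2 : ℝ) ^ k) := Real.sqrt_pos.2 (by positivity)
  have hb : ∀ j < M * 2 ^ k, |ω (k + 1, j)| ≤ √(2 ^ k) * (c * r ^ k) := by
    intro j hj
    have h1 : |ω (k + 1, j)| ^ 4 ≤ (√(2 ^ k) * (c * r ^ k)) ^ 4 := by
      have e : (√((2 : ℝ) ^ k) * (c * r ^ k)) ^ 4 = c ^ 4 * 3 ^ k := by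
        have : √((2 : ℝ) ^ k) ^ 4 = 4 ^ k := by
          rw [show √((2 : ℝ) ^ k) ^ 4 = (√((2 : ℝ) ^ k) ^ 2) ^ 2 by ring,
            Real.sq_sqrt (by positivity), ← pow_mul, mul_comm, pow_mul]; norm_num
        rw [mul_pow, mul_pow, this, ← pow_mul, mul_comm k 4, pow_mul, hr4]
        rw [mul_left_comm, ← mul_pow]; norm_num
      rw [e, Even.pow_abs (by decide)]
      refine (h k j hj).trans ?_
      gcongr
      exact le_self_pow₀ hc (by norm_num)
    exact (pow_le_pow_iff_left₀ (abs_nonneg _) (by positivity) (by norm_num)).1 h1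
  refine (abs_schauderLevel_succ_le (by positivity) hb t).trans (le_of_eq ?_)
  field_simp

/-- An almost sure limit of centred Gaussian variables is Gaussian. -/
lemma map_eq_gaussianReal_of_tendsto {Ω : Type*} [MeasurableSpace Ω] {μ : Measure Ω}
    [IsProbabilityMeasure μ] {f : ℕ → Ω → ℝ} {F : Ω → ℝ} (hf : ∀ n, Measurable (f n))
    (hF : Measurable F) {v : ℕ → ℝ≥0} {w : ℝ≥0} (hv : ∀ n, μ.map (f n) = gaussianReal 0 (v n))
    (hlim : ∀ᵐ ω ∂μ, Tendsto (fun n => f n ω) atTop (𝓝 (F ω))) (hw : Tendsto v atTop (𝓝 w)) :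
    μ.map F = gaussianReal 0 w := by
  have := Measure.isProbabilityMeasure_map (μ := μ) hF.aemeasurable
  apply Measure.ext_of_charFun
  ext β
  have h0 : ∀ {G : Ω → ℝ}, Measurable G →
      charFun (μ.map G) β = ∫ ω, Complex.exp (β * G ω * Complex.I) ∂μ := by
    intro G hG
    rw [charFun_apply_real, integral_map hG.aemeasurable]
    exact Continuous.aestronglyMeasurable (by fun_prop)
  have h1 : Tendsto (fun n => charFun (μ.map (f n)) β) atTop (𝓝 (charFun (μ.map F) β)) := by
    simp_rw [h0 (hf _), h0 hF]
    refine tendsto_integral_of_dominated_convergence (fun _ => 1)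
      (fun n => Measurable.aestronglyMeasurable
        ((by fun_prop : Continuous fun x : ℝ => Complex.exp (β * x * Complex.I)).measurable.comp
          (hf n))) (integrable_const _)
      (fun n => ae_of_all _ fun ω => ?_) ?_
    · rw [show (β : ℂ) * f n ω * Complex.I = ((β * f n ω : ℝ) : ℂ) * Complex.I by push_cast; ring,
        Complex.norm_exp_ofReal_mul_I]
    · filter_upwards [hlim] with ω hω
      exact ((by fun_prop : Continuous fun x : ℝ =>
        Complex.exp (β * x * Complex.I)).tendsto _).comp hω
  have h2 : Tendsto (fun n => charFun (μ.map (f n)) β) atTop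
      (𝓝 (charFun (gaussianReal 0 w) β)) := by
    simp_rw [hv, charFun_gaussianReal]
    exact ((by fun_prop : Continuous fun x : ℝ≥0 =>
      Complex.exp (β * (0 : ℝ) * Complex.I - x * β ^ 2 / 2)).tendsto _).comp hw
  exact tendsto_nhds_unique h1 h2

lemma map_sum_mul_of_iIndepFun {ι Ω : Type*} [MeasurableSpace Ω] {μ : Measure Ω}
    [IsProbabilityMeasure μ] {Z : ι → Ω → ℝ} (hm : ∀ i, Measurable (Z i)) (hZ : iIndepFun Z μ)
    {v : ι → ℝ≥0} (hv : ∀ i, μ.map (Z i) = gaussianReal 0 (v i)) (S : Finset ι) (c : ι → ℝ) :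
    μ.map (fun ω => ∑ i ∈ S, c i * Z i ω)
      = gaussianReal 0 (∑ i ∈ S, c i ^ 2 * v i).toNNReal := by
  have hm' : Measurable fun ω => ∑ i ∈ S, c i * Z i ω := by fun_prop
  have := Measure.isProbabilityMeasure_map (μ := μ) hm'.aemeasurable
  apply Measure.ext_of_charFun
  have hi : iIndepFun (fun i ω => c i * Z i ω) μ :=
    hZ.comp (fun i x => c i * x) (fun i => by fun_prop)
  rw [iIndepFun.charFun_map_fun_finsetSum_eq_prod (s := S) (X := fun i ω => c i * Z i ω)
    (fun p _ => (Measurable.aemeasurable (by fun_prop))) (hi.restrict _)]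
  ext β
  have h1 : ∀ i, μ.map (fun ω => c i * Z i ω) = (gaussianReal 0 (v i)).map (fun x => c i * x) := by
    intro i
    rw [← hv, Measure.map_map (by fun_prop) (hm i)]
    rfl
  simp_rw [Finset.prod_apply, h1, charFun_map_mul, charFun_gaussianReal, ← Complex.exp_sum]
  rw [Real.coe_toNNReal _ (by positivity)]
  congr 1
  push_cast
  simp only [mul_zero, zero_mul, zero_sub, Finset.sum_neg_distrib, Finset.sum_mul,
    Finset.sum_div]
  congr 1
  exact Finset.sum_congr rfl fun p _ => by ring

/-- The law of countably many independent standard Gaussian variables. -/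
noncomputable abbrev gaussianSeqLaw : Measure (ℕ × ℕ → ℝ) :=
  Measure.infinitePi fun _ => gaussianReal 0 1

lemma map_sum_mul_gaussianSeqLaw (S : Finset (ℕ × ℕ)) (c : ℕ × ℕ → ℝ) :
    gaussianSeqLaw.map (fun ω => ∑ p ∈ S, c p * ω p)
      = gaussianReal 0 (∑ p ∈ S, c p ^ 2).toNNReal := by
  have := map_sum_mul_of_iIndepFun (Z := fun (p : ℕ × ℕ) (ω : ℕ × ℕ → ℝ) => ω p)
    (μ := gaussianSeqLaw) (by fun_prop) (iIndepFun_infinitePi (X := fun p x => x) (by fun_prop))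
    (v := fun _ => 1)
    (fun p => (measurePreserving_eval_infinitePi (fun _ : ℕ × ℕ => gaussianReal 0 1) p).map_eq) S c
  simpa using this

/-- Partial sums of the Schauder expansion. -/
noncomputable def schauderSum (n : ℕ) (t : ℝ≥0) (ω : ℕ × ℕ → ℝ) : ℝ :=
  ∑ k ∈ Finset.range n, schauderLevel (⌊t⌋₊ + 1) k t ω

/-- Brownian motion, as the sum of the Schauder expansion. -/
noncomputable def schauderMotion (t : ℝ≥0) (ω : ℕ × ℕ → ℝ) : ℝ :=
  limsup (fun n => schauderSum n t ω) atTop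

lemma measurable_schauderSum (n : ℕ) (t : ℝ≥0) : Measurable (schauderSum n t) := by
  unfold schauderSum schauderLevel; fun_prop

/-- The upper limit is measurable with no exceptional set; it is a genuine limit only almost surely.
-/
lemma measurable_schauderMotion (t : ℝ≥0) : Measurable (schauderMotion t) :=
  Measurable.limsup fun n => measurable_schauderSum n t

lemma le_floor_add_one (t : ℝ≥0) : (t : ℝ) ≤ (⌊t⌋₊ + 1 : ℕ) := by
  have := (Nat.lt_floor_add_one t).le
  exact_mod_cast this

lemma schauderSum_eq {M : ℕ} {t : ℝ≥0} (ht : t ≤ M) (n : ℕ) (ω : ℕ × ℕ → ℝ) :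
    schauderSum n t ω = ∑ k ∈ Finset.range n, schauderLevel M k t ω := by
  refine Finset.sum_congr rfl fun k _ => ?_
  have ht' : (t : ℝ) ≤ M := by exact_mod_cast ht
  rcases le_total M (⌊t⌋₊ + 1) with h | h
  · exact schauderLevel_eq ht' h ω
  · exact (schauderLevel_eq (le_floor_add_one t) h ω).symm

/-- The fourth powers, weighted by `3 ^ (-k)`, have finite total mean, since level `k + 1` carries
`M * 2 ^ k` coefficients. The base `3` lies between `2`, needed for summability here, and `4`,
needed for uniform convergence of the expansion. -/
lemma ae_exists_pow_four_le (M : ℕ) : ∀ᵐ ω ∂gaussianSeqLaw, ∃ c : ℝ, 1 ≤ c ∧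
    ∀ k, ∀ j < M * 2 ^ k, ω (k + 1, j) ^ 4 ≤ c * 3 ^ k := by
  have hlaw : ∀ p : ℕ × ℕ, ∫⁻ ω, ENNReal.ofReal (ω p ^ 4) ∂gaussianSeqLaw
      = ENNReal.ofReal gaussFourthMoment := by
    intro p
    rw [gaussFourthMoment, ofReal_integral_eq_lintegral_ofReal (integrable_pow_gaussianReal 4)
      (ae_of_all _ fun x => by positivity)]
    rw [← (measurePreserving_eval_infinitePi (fun _ : ℕ × ℕ => gaussianReal 0 1) p).map_eq,
      lintegral_map (by fun_prop) (by fun_prop)]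
  let F : ℕ → (ℕ × ℕ → ℝ) → ℝ≥0∞ := fun k ω =>
    ENNReal.ofReal ((3 ^ k)⁻¹) * ∑ j ∈ Finset.range (M * 2 ^ k), ENNReal.ofReal (ω (k + 1, j) ^ 4)
  have hFm : ∀ k, Measurable (F k) := fun k => by fun_prop
  have hF : ∀ k, ∫⁻ ω, F k ω ∂gaussianSeqLaw
      = ENNReal.ofReal (M * gaussFourthMoment * (2 / 3) ^ k) := by
    intro k
    rw [lintegral_const_mul _ (by fun_prop), lintegral_finsetSum _ (by fun_prop)]
    simp_rw [hlaw]
    rw [Finset.sum_const, Finset.card_range, nsmul_eq_mul, ← ENNReal.ofReal_natCast,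
      ← ENNReal.ofReal_mul (by positivity), ← ENNReal.ofReal_mul (by positivity)]
    congr 1
    push_cast
    rw [div_pow]
    field_simp
  have hsum : ∫⁻ ω, ∑' k, F k ω ∂gaussianSeqLaw ≠ ∞ := by
    rw [lintegral_tsum fun k => (hFm k).aemeasurable]
    simp_rw [hF]
    exact ((summable_geometric_of_lt_one (by norm_num) (by norm_num)).mul_left _).tsum_ofReal_ne_top
  filter_upwards [ae_lt_top (Measurable.tsum hFm) hsum] with ω hω
  refine ⟨1 + (∑' k, F k ω).toReal, by simp, fun k j hj => ?_⟩
  have h1 : ENNReal.ofReal ((3 ^ k)⁻¹) * ENNReal.ofReal (ω (k + 1, j) ^ 4) ≤ ∑' k, F k ω := by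
    refine le_trans ?_ (ENNReal.le_tsum k)
    refine mul_le_mul_right ?_ _
    exact Finset.single_le_sum (f := fun j => ENNReal.ofReal (ω (k + 1, j) ^ 4))
      (fun _ _ => zero_le) (Finset.mem_range.2 hj)
  rw [← ENNReal.ofReal_mul (by positivity)] at h1
  have h2 := (ENNReal.ofReal_le_iff_le_toReal hω.ne).1 h1
  have h3 : (0 : ℝ) < 3 ^ k := by positivity
  rw [inv_mul_le_iff₀ h3] at h2
  nlinarith

lemma continuous_schauderLevel (M k : ℕ) (ω : ℕ × ℕ → ℝ) :
    Continuous fun t => schauderLevel M k t ω :=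
  continuous_finsetSum _ fun j _ => (continuous_schauder k j).mul continuous_const

lemma exists_continuous_tendsto_schauderLevel {M : ℕ} {ω : ℕ × ℕ → ℝ}
    (h : ∃ c : ℝ, 1 ≤ c ∧ ∀ k, ∀ j < M * 2 ^ k, ω (k + 1, j) ^ 4 ≤ c * 3 ^ k) :
    ∃ F : ℝ → ℝ, Continuous F ∧
      ∀ t, Tendsto (fun n => ∑ k ∈ Finset.range n, schauderLevel M k t ω) atTop (𝓝 (F t)) := by
  obtain ⟨c, hc, h⟩ := h
  obtain ⟨u, hu, hb⟩ := exists_summable_bound_schauderLevel hc h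
  refine ⟨fun t => (∑' k, schauderLevel M (k + 1) t ω) + schauderLevel M 0 t ω, ?_, fun t => ?_⟩
  · exact (continuous_tsum (fun k => continuous_schauderLevel M (k + 1) ω) hu
      fun k t => by simpa using hb k t).add (continuous_schauderLevel M 0 ω)
  · rw [← tendsto_add_atTop_iff_nat 1]
    simp_rw [Finset.sum_range_succ']
    have hs : Summable fun k => schauderLevel M (k + 1) t ω :=
      Summable.of_norm_bounded hu fun k => by simpa using hb k t
    exact hs.hasSum.tendsto_sum_nat.add_const _

/-- On each `[0, M]` the convergence is uniform; near `t` the process coincides with the limit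
obtained for `M = ⌊t⌋₊ + 1`. -/
lemma ae_continuous_schauderMotion : ∀ᵐ ω ∂gaussianSeqLaw,
    (Continuous fun t => schauderMotion t ω) ∧
      ∀ t, Tendsto (fun n => schauderSum n t ω) atTop (𝓝 (schauderMotion t ω)) := by
  filter_upwards [ae_all_iff.2 ae_exists_pow_four_le] with ω hω
  choose F hFc hF using fun M => exists_continuous_tendsto_schauderLevel (hω M)
  have hlim : ∀ (M : ℕ) (t : ℝ≥0), t ≤ M →
      Tendsto (fun n => schauderSum n t ω) atTop (𝓝 (F M t)) := by
    intro M t ht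
    simp_rw [schauderSum_eq ht]
    exact hF M t
  have hB : ∀ (M : ℕ) (t : ℝ≥0), t ≤ M → schauderMotion t ω = F M t :=
    fun M t ht => (hlim M t ht).limsup_eq
  have hfl : ∀ t : ℝ≥0, t < (⌊t⌋₊ + 1 : ℕ) := fun t => by
    push_cast; exact Nat.lt_floor_add_one t
  refine ⟨continuous_iff_continuousAt.2 fun t => ?_, fun t => ?_⟩
  · have : (fun s => schauderMotion s ω) =ᶠ[𝓝 t] fun s : ℝ≥0 => F (⌊t⌋₊ + 1) s := by
      filter_upwards [Iio_mem_nhds (hfl t)] with s hs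
      exact hB _ s (le_of_lt hs)
    refine ContinuousAt.congr ?_ this.symm
    exact ((hFc _).comp NNReal.continuous_coe).continuousAt
  · rw [hB _ t (hfl t).le]
    exact hlim _ t (hfl t).le

/-- A linear combination of partial expansions is a finite Gaussian sum. Its variance is a quadratic
form in the truncated Haar sums, which converge to `min s t`. -/
lemma map_sum_mul_schauderMotion (I : Finset ℝ≥0) (c : ℝ≥0 → ℝ) :
    gaussianSeqLaw.map (fun ω => ∑ t ∈ I, c t * schauderMotion t ω)
      = gaussianReal 0 (∑ s ∈ I, ∑ t ∈ I, c s * c t * min (s : ℝ) t).toNNReal := by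
  obtain ⟨M, hM⟩ : ∃ M : ℕ, ∀ t ∈ I, t ≤ M := by
    obtain ⟨b, hb⟩ := I.bddAbove
    obtain ⟨M, hM⟩ := exists_nat_ge b
    exact ⟨M, fun t ht => (hb ht).trans hM⟩
  let S : ℕ → Finset (ℕ × ℕ) := fun n =>
    (Finset.range n ×ˢ Finset.range (M * 2 ^ n)).filter fun p => p.2 < M * 2 ^ (p.1 - 1)
  have hS : ∀ n (p : ℕ × ℕ), p ∈ S n ↔ p.1 ∈ Finset.range n ∧
      p.2 ∈ Finset.range (M * 2 ^ (p.1 - 1)) := by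
    intro n p
    simp only [S, Finset.mem_filter, Finset.mem_product, Finset.mem_range]
    constructor
    · rintro ⟨⟨h1, _⟩, h3⟩; exact ⟨h1, h3⟩
    · rintro ⟨h1, h3⟩
      refine ⟨⟨h1, h3.trans_le ?_⟩, h3⟩
      gcongr
      · norm_num
      · omega
  have hsp : ∀ n (f : ℕ × ℕ → ℝ), ∑ p ∈ S n, f p = ∑ k ∈ Finset.range n,
      ∑ j ∈ Finset.range (M * 2 ^ (k - 1)), f (k, j) := fun n f =>
    Finset.sum_finset_product (S n) (Finset.range n) (fun k => Finset.range (M * 2 ^ (k - 1)))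
      (hS n)
  let e : ℕ × ℕ → ℝ := fun p => ∑ t ∈ I, c t * schauder p.1 p.2 t
  have h1 : ∀ n ω, ∑ t ∈ I, c t * schauderSum n t ω = ∑ p ∈ S n, e p * ω p := by
    intro n ω
    rw [hsp]
    simp only [e, Finset.sum_mul]
    have : ∀ t ∈ I, c t * schauderSum n t ω = ∑ k ∈ Finset.range n,
        ∑ j ∈ Finset.range (M * 2 ^ (k - 1)), c t * schauder k j t * ω (k, j) := by
      intro t ht
      rw [schauderSum_eq (hM t ht), Finset.mul_sum]
      refine Finset.sum_congr rfl fun k _ => ?_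
      rw [schauderLevel, Finset.mul_sum]
      exact Finset.sum_congr rfl fun j _ => by ring
    rw [Finset.sum_congr rfl this, Finset.sum_comm]
    exact Finset.sum_congr rfl fun k _ => Finset.sum_comm
  have h2 : ∀ n, ∑ p ∈ S n, e p ^ 2 = ∑ s ∈ I, ∑ t ∈ I, c s * c t *
      ∑ k ∈ Finset.range n, ∑ j ∈ Finset.range (M * 2 ^ (k - 1)),
        schauder k j s * schauder k j t := by
    intro n
    have h3 : ∀ s t : ℝ≥0, ∑ k ∈ Finset.range n, ∑ j ∈ Finset.range (M * 2 ^ (k - 1)),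
        schauder k j s * schauder k j t = ∑ p ∈ S n, schauder p.1 p.2 s * schauder p.1 p.2 t :=
      fun s t => (hsp n fun p => schauder p.1 p.2 s * schauder p.1 p.2 t).symm
    simp_rw [h3]
    simp only [e, sq, Finset.mul_sum]
    rw [Finset.sum_comm]
    refine Finset.sum_congr rfl fun s _ => ?_
    simp only [Finset.sum_mul]
    rw [Finset.sum_comm]
    exact Finset.sum_congr rfl fun t _ => Finset.sum_congr rfl fun p _ => by ring
  refine map_eq_gaussianReal_of_tendsto (f := fun n ω => ∑ t ∈ I, c t * schauderSum n t ω)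
    (v := fun n => (∑ p ∈ S n, e p ^ 2).toNNReal) (fun n => ?_) ?_ (fun n => ?_) ?_ ?_
  · exact Finset.measurable_fun_sum _ fun t _ => (measurable_schauderSum n t).const_mul _
  · exact Finset.measurable_fun_sum _ fun t _ => (measurable_schauderMotion t).const_mul _
  · simp_rw [h1]; exact map_sum_mul_gaussianSeqLaw _ _
  · filter_upwards [ae_continuous_schauderMotion] with ω hω
    exact tendsto_finsetSum _ fun t _ => (hω.2 t).const_mul _
  · simp_rw [h2]
    refine (continuous_real_toNNReal.tendsto _).comp ?_
    refine tendsto_finsetSum _ fun s hs => tendsto_finsetSum _ fun t ht => ?_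
    refine Tendsto.const_mul _ (tendsto_sum_schauder_mul s.2 t.2 ?_ ?_)
    · exact_mod_cast hM s hs
    · exact_mod_cast hM t ht

lemma map_schauderMotion (t : ℝ≥0) :
    gaussianSeqLaw.map (schauderMotion t) = gaussianReal 0 t := by
  have := map_sum_mul_schauderMotion {t} fun _ => 1
  simpa using this

/-- The variance of the sum of two values yields their covariance by polarisation: `3 s + t` is `s +
t` plus twice `s`. -/
lemma map_schauderMotion_add {s t : ℝ≥0} (hst : s < t) :
    gaussianSeqLaw.map (fun ω => schauderMotion s ω + schauderMotion t ω)
      = gaussianReal 0 (3 * s + t) := by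
  have := map_sum_mul_schauderMotion {s, t} fun _ => 1
  have hst' : (s : ℝ) ≤ t := by exact_mod_cast hst.le
  simp only [Finset.sum_pair hst.ne, one_mul, min_self, min_eq_left hst', min_eq_right hst'] at this
  rw [this]
  congr 1
  rw [show (s : ℝ) + s + (s + t) = ((3 * s + t : ℝ≥0) : ℝ) by push_cast; ring, Real.toNNReal_coe]

lemma isGaussianProcess_schauderMotion : IsGaussianProcess schauderMotion gaussianSeqLaw where
  hasGaussianLaw I := by
    have hm : Measurable fun ω => I.restrict (schauderMotion · ω) :=
      measurable_pi_lambda _ fun t => measurable_schauderMotion t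
    refine ⟨isGaussian_of_map_eq_gaussianReal fun L => ?_⟩
    rw [Measure.map_map (by fun_prop) hm]
    classical
    let c : ℝ≥0 → ℝ := fun t => if h : t ∈ I then L (Pi.single ⟨t, h⟩ 1) else 0
    have : (L ∘ fun ω => I.restrict (schauderMotion · ω))
        = fun ω => ∑ t ∈ I, c t * schauderMotion t ω := by
      ext ω
      rw [Function.comp_apply, ← Finset.sum_coe_sort]
      conv_lhs => rw [← Finset.univ_sum_single (I.restrict (schauderMotion · ω)), map_sum]
      refine Finset.sum_congr rfl fun t _ => ?_
      have : Pi.single t (I.restrict (schauderMotion · ω) t)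
          = schauderMotion t ω • (Pi.single t (1 : ℝ) : I → ℝ) := by
        ext i; by_cases h : i = t
        · subst h; simp
        · simp [h]
      rw [this, map_smul]
      simp [c, mul_comm]
    rw [this]
    exact ⟨0, _, map_sum_mul_schauderMotion I c⟩

theorem isBrownianReal_schauderMotion : IsBrownianReal schauderMotion gaussianSeqLaw where
  toIsPreBrownianReal := by
    have hL : ∀ t, HasLaw (schauderMotion t) (gaussianReal 0 t) gaussianSeqLaw :=
      fun t => ⟨(measurable_schauderMotion t).aemeasurable, map_schauderMotion t⟩
    have hmem : ∀ t, MemLp (schauderMotion t) 2 gaussianSeqLaw := fun t =>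
      (isGaussianProcess_schauderMotion.hasGaussianLaw_eval t).memLp_two
    have hvar : ∀ t, Var[schauderMotion t; gaussianSeqLaw] = t := fun t => by
      rw [(hL t).variance_eq]; simp
    refine isGaussianProcess_schauderMotion.isPreBrownianReal_of_covariance
      (fun t => by rw [(hL t).integral_eq]; simp) fun s t hst => ?_
    rcases hst.eq_or_lt with rfl | hst
    · rw [covariance_self (measurable_schauderMotion _).aemeasurable, hvar]
    · have h := variance_add (hmem s) (hmem t)
      have hadd : HasLaw (schauderMotion s + schauderMotion t) (gaussianReal 0 (3 * s + t))
          gaussianSeqLaw := ⟨((measurable_schauderMotion s).add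
            (measurable_schauderMotion t)).aemeasurable, map_schauderMotion_add hst⟩
      rw [hadd.variance_eq, hvar, hvar] at h
      simp at h
      linarith
  cont := by filter_upwards [ae_continuous_schauderMotion] with ω hω using hω.1

/-! ### Independence -/

/-- σ-algebras are independent when each of them is independent of those before it. -/
lemma iIndep_of_indep_iSup_lt {Ω : Type*} {mΩ : MeasurableSpace Ω} {μ : Measure Ω}
    [IsProbabilityMeasure μ] {m : ℕ → MeasurableSpace Ω}
    (h : ∀ k, Indep (m k) (⨆ j, ⨆ _ : j < k, m j) μ) : iIndep m μ := by
  rw [iIndep_iff]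
  intro s
  induction s using Finset.induction_on_max with
  | empty => intro f _; simp
  | insert a s hs ih =>
    intro f hf
    have ha : a ∉ s := fun h => lt_irrefl _ (hs a h)
    rw [Finset.prod_insert ha, Finset.set_biInter_insert,
      ← ih fun i hi => hf i (Finset.mem_insert_of_mem hi)]
    refine (Indep_iff _ _ _).1 (h a) _ _ (hf a (Finset.mem_insert_self _ _)) ?_
    refine Finset.measurableSet_biInter _ fun i hi => ?_
    exact (le_iSup₂ (f := fun j (_ : j < a) => m j) i (hs i hi)) _
      (hf i (Finset.mem_insert_of_mem hi))

lemma indep_sup_of_indep_of_indep_sup {Ω : Type*} {mΩ : MeasurableSpace Ω} {μ : Measure Ω}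
    [IsProbabilityMeasure μ] {A B C : MeasurableSpace Ω} (hA : A ≤ mΩ) (hB : B ≤ mΩ)
    (hC : C ≤ mΩ) (hAB : Indep A B μ) (hABC : Indep C (A ⊔ B) μ) : Indep A (B ⊔ C) μ := by
  -- Padding with trivial σ-algebras makes the sequential criterion `iIndep_of_indep_iSup_lt`
  -- applicable to three σ-algebras.
  let m : ℕ → MeasurableSpace Ω := fun
    | 0 => A
    | 1 => B
    | 2 => C
    | _ => ⊥
  have hm : iIndep m μ := by
    refine iIndep_of_indep_iSup_lt fun k => ?_
    match k with
    | 0 => simpa using indep_bot_right _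
    | 1 =>
      refine indep_of_indep_of_le_right hAB.symm (iSup₂_le fun j hj => ?_)
      obtain rfl : j = 0 := by omega
      exact le_rfl
    | 2 =>
      refine indep_of_indep_of_le_right hABC (iSup₂_le fun j hj => ?_)
      obtain rfl | rfl : j = 0 ∨ j = 1 := by omega
      · exact le_sup_left
      · exact le_sup_right
    | k + 3 => exact indep_bot_left _
  have h2 := indep_iSup_of_disjoint (m := m) (fun i => by
    match i with
    | 0 => exact hA
    | 1 => exact hB
    | 2 => exact hC
    | i + 3 => exact bot_le) hm (S := {0}) (T := {1, 2}) (by simp)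
  refine indep_of_indep_of_le h2 ?_ (sup_le ?_ ?_)
  · exact le_iSup₂ (f := fun i (_ : i ∈ ({0} : Set ℕ)) => m i) 0 (by simp)
  · exact le_iSup₂ (f := fun i (_ : i ∈ ({1, 2} : Set ℕ)) => m i) 1 (by simp)
  · exact le_iSup₂ (f := fun i (_ : i ∈ ({1, 2} : Set ℕ)) => m i) 2 (by simp)

lemma indep_comap_of_measurePreserving {Ω Ω' : Type*} {mΩ : MeasurableSpace Ω}
    {A B : MeasurableSpace Ω'} {mΩ' : MeasurableSpace Ω'} {μ : Measure Ω} {ν : Measure Ω'}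
    {f : Ω → Ω'} (hf : MeasurePreserving f μ ν) (hA : A ≤ mΩ') (hB : B ≤ mΩ')
    (h : Indep A B ν) : Indep (A.comap f) (B.comap f) μ := by
  rw [Indep_iff] at h ⊢
  rintro _ _ ⟨s, hs, rfl⟩ ⟨t, ht, rfl⟩
  rw [← Set.preimage_inter, hf.measure_preimage (hA _ hs).nullMeasurableSet,
    hf.measure_preimage (hB _ ht).nullMeasurableSet,
    hf.measure_preimage ((hA _ hs).inter (hB _ ht)).nullMeasurableSet, h s t hs ht]

/-! ### Extension of a filtered probability space by an independent process -/

section Extension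

variable {Ω Ω₀ : Type*} [mΩ : MeasurableSpace Ω] [mΩ₀ : MeasurableSpace Ω₀] {P : Measure Ω}
  [IsProbabilityMeasure P] {Q : Measure Ω₀} [IsProbabilityMeasure Q] {B : ℝ≥0 → Ω₀ → ℝ}

/-- The filtration on `Ω × Ω₀` generated by `𝓕` and the process `B`. -/
def prodFiltration (𝓕 : Filtration ℝ≥0 mΩ) (hB : ∀ t, Measurable (B t)) :
    Filtration ℝ≥0 (inferInstance : MeasurableSpace (Ω × Ω₀)) where
  seq t := (𝓕 t).comap Prod.fst ⊔
    (⨆ r, ⨆ _ : r ≤ t, MeasurableSpace.comap (B r) inferInstance).comap Prod.snd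
  mono' s t hst := by
    refine sup_le_sup (MeasurableSpace.comap_mono (𝓕.mono hst)) (MeasurableSpace.comap_mono ?_)
    exact iSup₂_le fun r hr => le_iSup₂ (f := fun r (_ : r ≤ t) =>
      MeasurableSpace.comap (B r) inferInstance) r (hr.trans hst)
  le' t := by
    refine sup_le ?_ ?_
    · exact (MeasurableSpace.comap_mono (𝓕.le t)).trans measurable_fst.comap_le
    · exact (MeasurableSpace.comap_mono (iSup₂_le fun r _ => (hB r).comap_le)).trans
        measurable_snd.comap_le

lemma isFilteredExtension_prodFiltration (𝓕 : Filtration ℝ≥0 mΩ) (hB : ∀ t, Measurable (B t)) :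
    IsFilteredExtension P 𝓕 (P.prod Q) (prodFiltration 𝓕 hB) Prod.fst where
  measurePreserving := measurePreserving_fst
  filtration_le _ := le_sup_left

/-- The increment is independent of the past of `B` on the second factor, and the first factor is
independent of both together. Joint independence of the three then separates the increment from the
past of `B` combined with `𝓕 s`. -/
lemma indep_comap_snd_prodFiltration (𝓕 : Filtration ℝ≥0 mΩ) (hB : ∀ t, Measurable (B t))
    (hBQ : IsPreBrownianReal B Q) {s t : ℝ≥0} (hst : s ≤ t) :
    Indep (MeasurableSpace.comap (fun ω : Ω × Ω₀ => B t ω.2 - B s ω.2) inferInstance)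
      (prodFiltration 𝓕 hB s) (P.prod Q) := by
  have hΔ : Measurable fun ω => B t ω - B s ω := (hB t).sub (hB s)
  have hpast : (⨆ r, ⨆ _ : r ≤ s, MeasurableSpace.comap (B r) inferInstance) ≤ mΩ₀ :=
    iSup₂_le fun r _ => (hB r).comap_le
  have h1 : Indep (MeasurableSpace.comap (fun ω => B t ω - B s ω) inferInstance)
      (⨆ r, ⨆ _ : r ≤ s, MeasurableSpace.comap (B r) inferInstance) Q := by
    have h := hBQ.indepFun_shift s
    rw [IndepFun_iff_Indep] at h
    refine indep_of_indep_of_le h ?_ (iSup₂_le fun r hr => ?_)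
    · have : (fun ω => B t ω - B s ω)
          = (fun x : ℝ≥0 → ℝ => x (t - s)) ∘ fun ω r => B (s + r) ω - B s ω := by
        ext ω; simp [add_tsub_cancel_of_le hst]
      rw [this, ← MeasurableSpace.comap_comp]
      exact MeasurableSpace.comap_mono (measurable_pi_apply _).comap_le
    · have : B r = (fun x : Set.Iic s → ℝ => x ⟨r, hr⟩) ∘ fun ω (t : Set.Iic s) => B t ω := by
        ext ω; simp
      rw [this, ← MeasurableSpace.comap_comp]
      exact MeasurableSpace.comap_mono (measurable_pi_apply _).comap_le
  have h2 := indep_comap_of_measurePreserving (measurePreserving_snd (μ := P) (ν := Q))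
    hΔ.comap_le hpast h1
  have h3 : Indep (mΩ.comap Prod.fst) (mΩ₀.comap Prod.snd) (P.prod Q) :=
    (IndepFun_iff_Indep _ _ _).1 (indepFun_prod (X := id) (Y := id) measurable_id measurable_id)
  rw [MeasurableSpace.comap_comp] at h2
  change Indep _ (_ ⊔ _) _
  rw [sup_comm]
  refine indep_sup_of_indep_of_indep_sup (hΔ.comp measurable_snd).comap_le
    ((MeasurableSpace.comap_mono hpast).trans measurable_snd.comap_le)
    ((MeasurableSpace.comap_mono (𝓕.le s)).trans measurable_fst.comap_le) h2 ?_
  refine indep_of_indep_of_le h3 (MeasurableSpace.comap_mono (𝓕.le s)) (sup_le ?_ ?_)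
  · change MeasurableSpace.comap ((fun ω => B t ω - B s ω) ∘ Prod.snd) _ ≤ _
    rw [← MeasurableSpace.comap_comp]
    exact MeasurableSpace.comap_mono hΔ.comap_le
  · exact MeasurableSpace.comap_mono hpast

lemma isBrownianFor_prodFiltration (𝓕 : Filtration ℝ≥0 mΩ) (hB : ∀ t, Measurable (B t))
    (hBQ : IsBrownianReal B Q) :
    IsBrownianFor (P.prod Q) (prodFiltration 𝓕 hB) fun t ω => B t ω.2 where
  brownian :=
    { hasLaw := fun I => (hBQ.hasLaw I).comp measurePreserving_snd.hasLaw
      cont := Measure.quasiMeasurePreserving_snd.ae hBQ.cont }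
  adapted t := by
    refine Measurable.mono (mb := inferInstance)
      (comap_measurable (f := B t ∘ (Prod.snd : Ω × Ω₀ → Ω₀))) ?_ le_rfl
    rw [← MeasurableSpace.comap_comp]
    refine le_trans (MeasurableSpace.comap_mono ?_) le_sup_right
    exact le_iSup₂ (f := fun r (_ : r ≤ t) => MeasurableSpace.comap (B r) inferInstance) t le_rfl
  indep_increments _ _ hst := indep_comap_snd_prodFiltration 𝓕 hB hBQ.toIsPreBrownianReal hst

end Extension

/-! ### Riemann sums of processes that are Hölder continuous in the mean -/

/-- A bounded nonnegative adapted process that is `1/2`-Hölder continuous in the mean. -/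
structure IsVarianceProcess {Ω : Type*} [mΩ : MeasurableSpace Ω] (P : Measure Ω)
    (𝓕 : Filtration ℝ≥0 mΩ) (A : ℝ≥0 → Ω → ℝ) (K D : ℝ) : Prop where
  measurable : ∀ s, Measurable[𝓕 s] (A s)
  nonneg : ∀ s ω, 0 ≤ A s ω
  le : ∀ s ω, A s ω ≤ K
  integral_abs_sub_le : ∀ s t, s ≤ t → ∫ ω, |A t ω - A s ω| ∂P ≤ D * √((t : ℝ) - s)
  aemeasurable : AEMeasurable (fun p : ℝ × Ω => A p.1.toNNReal p.2) (volume.prod P)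

/-- A process with right-continuous paths is jointly measurable. -/
lemma aemeasurable_of_continuousWithinAt_Ici {Ω : Type*} [MeasurableSpace Ω] {P : Measure Ω}
    [IsProbabilityMeasure P] {A : ℝ≥0 → Ω → ℝ} (hm : ∀ s, Measurable (A s))
    (hc : ∀ᵐ ω ∂P, ∀ s, ContinuousWithinAt (fun t => A t ω) (Set.Ici s) s) :
    AEMeasurable (fun p : ℝ × Ω => A p.1.toNNReal p.2) (volume.prod P) := by
  have hq : ∀ᵐ p ∂((volume : Measure ℝ).prod P), ∀ s,
      ContinuousWithinAt (fun t => A t p.2) (Set.Ici s) s :=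
    Measure.quasiMeasurePreserving_snd.ae hc
  -- The time is rounded up to the grid of mesh `1 / (k + 1)`. The approximating times approach from
  -- the right, so right-continuity suffices, and each approximation involves countably many
  -- sections.
  refine aemeasurable_of_tendsto_metrizable_ae atTop
    (f := fun (k : ℕ) (p : ℝ × Ω) =>
      A ((⌈p.1.toNNReal * ((k : ℝ≥0) + 1)⌉₊ : ℝ≥0) / ((k : ℝ≥0) + 1)) p.2)
    (fun k => ?_) ?_
  · have h1 : Measurable fun q : ℕ × Ω => A ((q.1 : ℝ≥0) / ((k : ℝ≥0) + 1)) q.2 :=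
      measurable_from_prod_countable_right fun i => hm (i / (k + 1))
    have h2 : Measurable fun p : ℝ × Ω => (⌈p.1.toNNReal * ((k : ℝ≥0) + 1)⌉₊, p.2) := by
      refine Measurable.prodMk ?_ measurable_snd
      exact Nat.measurable_ceil.comp ((measurable_fst.real_toNNReal).mul_const _)
    exact (h1.comp h2).aemeasurable
  · filter_upwards [hq] with p hp
    set s := p.1.toNNReal with hs
    refine (hp s).tendsto.comp (tendsto_nhdsWithin_iff.2 ⟨?_, Eventually.of_forall fun k => ?_⟩)
    · have h3 : Tendsto (fun k : ℕ => s + 1 / ((k : ℝ≥0) + 1)) atTop (𝓝 (s + 0)) :=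
        tendsto_const_nhds.add tendsto_one_div_add_atTop_nhds_zero_nat
      rw [add_zero] at h3
      refine tendsto_of_tendsto_of_tendsto_of_le_of_le tendsto_const_nhds h3 (fun k => ?_)
        (fun k => ?_)
      · simp only
        rw [le_div_iff₀ (by positivity)]
        exact Nat.le_ceil _
      · simp only
        rw [div_le_iff₀ (by positivity), add_mul, one_div, inv_mul_cancel₀ (by positivity)]
        exact (Nat.ceil_lt_add_one zero_le).le
    · simp only [Set.mem_Ici]
      rw [le_div_iff₀ (by positivity)]
      exact Nat.le_ceil _

namespace IsVarianceProcess

variable {Ω : Type*} [mΩ : MeasurableSpace Ω] {P : Measure Ω} [IsProbabilityMeasure P]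
  {𝓕 : Filtration ℝ≥0 mΩ} {A : ℝ≥0 → Ω → ℝ} {K D : ℝ}

lemma measurable' (hA : IsVarianceProcess P 𝓕 A K D) (s : ℝ≥0) : Measurable (A s) :=
  (hA.measurable s).mono (𝓕.le s) le_rfl

lemma const_nonneg (hA : IsVarianceProcess P 𝓕 A K D) : 0 ≤ K := by
  obtain ⟨ω⟩ : Nonempty Ω := nonempty_of_isProbabilityMeasure P
  exact (hA.nonneg 0 ω).trans (hA.le 0 ω)

lemma abs_le (hA : IsVarianceProcess P 𝓕 A K D) (s : ℝ≥0) (ω : Ω) : |A s ω| ≤ K := by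
  rw [abs_of_nonneg (hA.nonneg s ω)]; exact hA.le s ω

lemma integrable (hA : IsVarianceProcess P 𝓕 A K D) (s : ℝ≥0) : Integrable (A s) P :=
  Integrable.of_bound (hA.measurable' s).aestronglyMeasurable K
    (ae_of_all _ fun ω => by simpa using hA.abs_le s ω)

lemma holder_nonneg (hA : IsVarianceProcess P 𝓕 A K D) : 0 ≤ D := by
  have := hA.integral_abs_sub_le 0 1 zero_le
  simp at this
  exact (integral_nonneg fun ω => abs_nonneg _).trans this

lemma integrable_prod (hA : IsVarianceProcess P 𝓕 A K D) (u v : ℝ) :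
    Integrable (fun p : ℝ × Ω => A p.1.toNNReal p.2) ((volume.restrict (Set.Ioc u v)).prod P) := by
  refine Integrable.of_bound (AEMeasurable.aestronglyMeasurable ?_) K
    (ae_of_all _ fun p => by simpa using hA.abs_le _ p.2)
  refine hA.aemeasurable.mono_ac ?_
  exact Measure.AbsolutelyContinuous.prod Measure.absolutelyContinuous_restrict
    Measure.AbsolutelyContinuous.rfl

lemma ae_intervalIntegrable (hA : IsVarianceProcess P 𝓕 A K D) :
    ∀ᵐ ω ∂P, ∀ u v : ℝ, IntervalIntegrable (fun s => A s.toNNReal ω) volume u v := by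
  filter_upwards [hA.aemeasurable.aestronglyMeasurable.prodMk_right] with ω hω u v
  refine (intervalIntegrable_const (c := K)).mono_fun hω.restrict
    (ae_of_all _ fun s => by
      simpa [abs_of_nonneg hA.const_nonneg] using hA.abs_le s.toNNReal ω)

/-- The time integral of the process. -/
noncomputable def _root_.timeIntegral (A : ℝ≥0 → Ω → ℝ) (t : ℝ) (ω : Ω) : ℝ :=
  ∫ s in (0 : ℝ)..t, A s.toNNReal ω

lemma integrable_timeIntegral (hA : IsVarianceProcess P 𝓕 A K D) {t : ℝ} (ht : 0 ≤ t) :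
    Integrable (timeIntegral A t) P := by
  unfold timeIntegral
  simp_rw [intervalIntegral.integral_of_le ht]
  exact (hA.integrable_prod 0 t).integral_prod_right

lemma timeIntegral_nonneg (hA : IsVarianceProcess P 𝓕 A K D) {t : ℝ} (ht : 0 ≤ t) (ω : Ω) :
    0 ≤ timeIntegral A t ω :=
  intervalIntegral.integral_nonneg ht fun _ _ => hA.nonneg _ ω

lemma integrable_abs_sub (hA : IsVarianceProcess P 𝓕 A K D) (u v : ℝ) (r : ℝ≥0) :
    Integrable (fun p : ℝ × Ω => |A p.1.toNNReal p.2 - A r p.2|)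
      ((volume.restrict (Set.Ioc u v)).prod P) := by
  have h2 : Integrable (fun p : ℝ × Ω => A r p.2) ((volume.restrict (Set.Ioc u v)).prod P) :=
    Integrable.of_bound ((hA.measurable' r).comp measurable_snd).aestronglyMeasurable K
      (ae_of_all _ fun p => by simpa using hA.abs_le r p.2)
  exact ((hA.integrable_prod u v).sub' h2).abs

lemma integral_integral_abs_sub_le (hA : IsVarianceProcess P 𝓕 A K D) {u v : ℝ≥0} (huv : u ≤ v) :
    ∫ ω, (∫ s in Set.Ioc (u : ℝ) v, |A s.toNNReal ω - A u ω|) ∂P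
      ≤ ((v : ℝ) - u) * (D * √((v : ℝ) - u)) := by
  have huv' : (u : ℝ) ≤ v := by exact_mod_cast huv
  have hi := hA.integrable_abs_sub u v u
  rw [← integral_integral_swap (f := fun (s : ℝ) ω => |A s.toNNReal ω - A u ω|) hi]
  have hb : ∀ s ∈ Set.Ioc (u : ℝ) v, ∫ ω, |A s.toNNReal ω - A u ω| ∂P ≤ D * √((v : ℝ) - u) := by
    intro s hs
    have h0 : 0 ≤ s := u.2.trans hs.1.le
    have h1 : u ≤ s.toNNReal := (Real.le_toNNReal_iff_coe_le h0).2 hs.1.le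
    refine (hA.integral_abs_sub_le u s.toNNReal h1).trans ?_
    rw [Real.coe_toNNReal _ h0]
    have := hA.holder_nonneg
    have := hs.2
    gcongr
  calc _ ≤ ∫ s in Set.Ioc (u : ℝ) v, D * √((v : ℝ) - u) :=
        setIntegral_mono_on hi.integral_prod_left (integrableOn_const (by simp)) measurableSet_Ioc hb
    _ = _ := by simp [huv']

/-- The error of a Riemann sum, in the mean. -/
lemma integral_abs_sum_sub_timeIntegral_le (hA : IsVarianceProcess P 𝓕 A K D) {τ : ℕ → ℝ≥0}
    (hτ : Monotone τ) (hτ0 : τ 0 = 0) {δ : ℝ} (hδ : ∀ j, (τ (j + 1) : ℝ) - τ j ≤ δ) (N : ℕ) :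
    ∫ ω, |∑ j ∈ Finset.range N, A (τ j) ω * ((τ (j + 1) : ℝ) - τ j) - timeIntegral A (τ N) ω| ∂P
      ≤ τ N * (D * √δ) := by
  let G : ℕ → Ω → ℝ := fun j ω =>
    ∫ s in Set.Ioc (τ j : ℝ) (τ (j + 1)), |A s.toNNReal ω - A (τ j) ω|
  have hG : ∀ j, Integrable (G j) P := fun j =>
    (hA.integrable_abs_sub (τ j) (τ (j + 1)) (τ j)).integral_prod_right
  have hle : ∀ j, (τ j : ℝ) ≤ τ (j + 1) := fun j => by exact_mod_cast hτ (Nat.le_succ j)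
  calc _ ≤ ∫ ω, ∑ j ∈ Finset.range N, G j ω ∂P := by
        refine integral_mono_of_nonneg (ae_of_all _ fun ω => abs_nonneg _)
          (integrable_finsetSum _ fun j _ => hG j) ?_
        filter_upwards [hA.ae_intervalIntegrable] with ω hω
        have h1 : timeIntegral A (τ N) ω = ∑ j ∈ Finset.range N,
            ∫ s in (τ j : ℝ)..τ (j + 1), A s.toNNReal ω := by
          rw [intervalIntegral.sum_integral_adjacent_intervals (a := fun j => (τ j : ℝ))
            fun k _ => hω _ _, hτ0]
          rfl
        rw [h1, ← Finset.sum_sub_distrib]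
        refine (Finset.abs_sum_le_sum_abs _ _).trans (Finset.sum_le_sum fun j _ => ?_)
        have h2 : A (τ j) ω * ((τ (j + 1) : ℝ) - τ j) - ∫ s in (τ j : ℝ)..τ (j + 1), A s.toNNReal ω
            = -∫ s in (τ j : ℝ)..τ (j + 1), (A s.toNNReal ω - A (τ j) ω) := by
          rw [intervalIntegral.integral_sub (hω _ _) intervalIntegrable_const]
          simp; ring
        rw [h2, abs_neg]
        refine (intervalIntegral.abs_integral_le_integral_abs (hle j)).trans (le_of_eq ?_)
        rw [intervalIntegral.integral_of_le (hle j)]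
    _ = ∑ j ∈ Finset.range N, ∫ ω, G j ω ∂P := integral_finsetSum _ fun j _ => hG j
    _ ≤ ∑ j ∈ Finset.range N, ((τ (j + 1) : ℝ) - τ j) * (D * √δ) := by
        refine Finset.sum_le_sum fun j _ =>
          (hA.integral_integral_abs_sub_le (hτ (Nat.le_succ j))).trans ?_
        have h3 := hA.holder_nonneg
        have h4 := hδ j
        have h5 := sub_nonneg.2 (hle j)
        gcongr
    _ = _ := by
        rw [← Finset.sum_mul, Finset.sum_range_sub fun j => (τ j : ℝ), hτ0]
        simp

/-- The Riemann sum stops at `⌊n t⌋ / n`; the missing piece of the interval costs `K / n`, absorbed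
in `K / √n`. -/
lemma integral_abs_grid_sum_sub_timeIntegral_le (hA : IsVarianceProcess P 𝓕 A K D) (t : ℝ≥0)
    {n : ℕ} (hn : 1 ≤ n) :
    ∫ ω, |(n : ℝ)⁻¹ * ∑ j ∈ Finset.range ⌊(n : ℝ≥0) * t⌋₊, A (gridTime n j) ω
        - timeIntegral A t ω| ∂P ≤ (t * D + K) * (√n)⁻¹ := by
  set N := ⌊(n : ℝ≥0) * t⌋₊ with hN
  have hn0 : (0 : ℝ) < n := by exact_mod_cast hn
  have hn0' : (0 : ℝ≥0) < n := by exact_mod_cast hn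
  have hstep : ∀ j, (gridTime n (j + 1) : ℝ) - gridTime n j = (n : ℝ)⁻¹ := by
    intro j; simp [gridTime]; field_simp; ring
  have hmono : Monotone (gridTime n) := fun i j hij => by unfold gridTime; gcongr
  have h0 : gridTime n 0 = 0 := by simp [gridTime]
  have hNt : gridTime n N ≤ t := by
    unfold gridTime
    rw [div_le_iff₀ hn0', mul_comm]
    exact Nat.floor_le zero_le
  have hNt' : (gridTime n N : ℝ) ≤ t := by exact_mod_cast hNt
  have htN : (t : ℝ) - gridTime n N ≤ (n : ℝ)⁻¹ := by
    have h := (Nat.lt_floor_add_one ((n : ℝ≥0) * t)).le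
    have h' : (n : ℝ) * t ≤ N + 1 := by exact_mod_cast h
    have : (gridTime n N : ℝ) = N / n := by simp [gridTime]
    rw [this, sub_le_iff_le_add, ← one_div, ← add_div, le_div_iff₀ hn0]
    linarith
  have h1 := hA.integral_abs_sum_sub_timeIntegral_le hmono h0 (fun j => (hstep j).le) N
  simp_rw [hstep] at h1
  have hI1 : Integrable (fun ω => (n : ℝ)⁻¹ * ∑ j ∈ Finset.range N, A (gridTime n j) ω) P :=
    (integrable_finsetSum _ fun j _ => hA.integrable _).const_mul _
  have hIN := hA.integrable_timeIntegral (t := gridTime n N) (by positivity)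
  have hI2 : Integrable (fun ω => |∑ j ∈ Finset.range N, A (gridTime n j) ω * (n : ℝ)⁻¹
        - timeIntegral A (gridTime n N) ω|) P := by
    refine Integrable.abs ?_
    refine Integrable.sub' ?_ hIN
    exact integrable_finsetSum _ fun j _ => (hA.integrable _).mul_const _
  calc _ ≤ ∫ ω, (|∑ j ∈ Finset.range N, A (gridTime n j) ω * (n : ℝ)⁻¹
        - timeIntegral A (gridTime n N) ω| + K * (n : ℝ)⁻¹) ∂P := by
        refine integral_mono_of_nonneg (ae_of_all _ fun ω => abs_nonneg _)
          (hI2.add (integrable_const _)) ?_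
        filter_upwards [hA.ae_intervalIntegrable] with ω hω
        have h3 : timeIntegral A t ω = timeIntegral A (gridTime n N) ω
            + ∫ s in (gridTime n N : ℝ)..t, A s.toNNReal ω :=
          (intervalIntegral.integral_add_adjacent_intervals (hω _ _) (hω _ _)).symm
        have h4 : |∫ s in (gridTime n N : ℝ)..t, A s.toNNReal ω| ≤ K * (n : ℝ)⁻¹ := by
          rw [← Real.norm_eq_abs]
          refine (intervalIntegral.norm_integral_le_of_norm_le_const (C := K)
            fun s _ => by simpa using hA.abs_le s.toNNReal ω).trans ?_
          rw [abs_of_nonneg (sub_nonneg.2 hNt')]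
          exact mul_le_mul_of_nonneg_left htN hA.const_nonneg
        rw [h3, mul_comm, Finset.sum_mul, ← sub_sub]
        exact (abs_sub _ _).trans (by linarith)
    _ ≤ t * (D * √((n : ℝ)⁻¹)) + K * (n : ℝ)⁻¹ := by
        rw [integral_add hI2 (integrable_const _)]
        have := hA.holder_nonneg
        have h5 : (gridTime n N : ℝ) * (D * √((n : ℝ)⁻¹)) ≤ t * (D * √((n : ℝ)⁻¹)) := by gcongr
        simp only [integral_const, probReal_univ, one_smul]
        linarith
    _ ≤ _ := by
        have h6 : (n : ℝ)⁻¹ ≤ (√n)⁻¹ := by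
          have h7 : √(n : ℝ) ≤ n := by
            rw [Real.sqrt_le_left hn0.le]
            have : (1 : ℝ) ≤ n := by exact_mod_cast hn
            nlinarith
          exact inv_anti₀ (Real.sqrt_pos.2 hn0) h7
        have := hA.const_nonneg
        rw [Real.sqrt_inv]
        nlinarith

end IsVarianceProcess

/-! ### The stochastic integral of an independent integrand -/

lemma lintegral_sq_gaussianReal (v : ℝ≥0) :
    ∫⁻ x, ENNReal.ofReal (x ^ 2) ∂gaussianReal 0 v = v := by
  have h : MemLp id 2 (gaussianReal 0 v) := memLp_id_gaussianReal 2
  have h1 := variance_of_integral_eq_zero (X := id) (μ := gaussianReal 0 v) aemeasurable_id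
    (by simp)
  rw [variance_id_gaussianReal] at h1
  have h2 : Integrable (fun x : ℝ => x ^ 2) (gaussianReal 0 v) := h.integrable_sq
  rw [← ofReal_integral_eq_lintegral_ofReal h2 (ae_of_all _ fun x => sq_nonneg _)]
  simp only [id] at h1
  rw [← h1, ENNReal.ofReal_coe_nnreal]

lemma eLpNorm_two_le_of_lintegral_sq_le {Ω : Type*} [MeasurableSpace Ω] {μ : Measure Ω}
    {F : Ω → ℝ} {c : ℝ} (h : ∫⁻ ω, ENNReal.ofReal (F ω ^ 2) ∂μ ≤ ENNReal.ofReal c) :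
    eLpNorm F 2 μ ≤ ENNReal.ofReal (√c) := by
  rw [eLpNorm_eq_lintegral_rpow_enorm_toReal (by norm_num) (by norm_num)]
  have h1 : ∀ ω, ‖F ω‖ₑ ^ (2 : ℝ≥0∞).toReal = ENNReal.ofReal (F ω ^ 2) := by
    intro ω
    rw [ENNReal.toReal_ofNat, ENNReal.rpow_ofNat, Real.enorm_eq_ofReal_abs,
      ← ENNReal.ofReal_pow (abs_nonneg _), sq_abs]
  simp_rw [h1]
  rcases le_total 0 c with hc | hc
  · calc _ ≤ ENNReal.ofReal c ^ (1 / (2 : ℝ≥0∞).toReal) := by gcongr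
      _ = _ := by
        rw [Real.sqrt_eq_rpow, ← ENNReal.ofReal_rpow_of_nonneg hc (by norm_num)]
        simp
  · rw [ENNReal.ofReal_of_nonpos hc] at h
    rw [nonpos_iff_eq_zero.1 h]
    simp

/-- This transfers `L¹` continuity of the variance to `L²` continuity of its square root, although
the square root is not Lipschitz at zero. -/
lemma sq_sqrt_sub_sqrt_le {a b : ℝ} (ha : 0 ≤ a) (hb : 0 ≤ b) : (√a - √b) ^ 2 ≤ |a - b| := by
  have h : |√a - √b| ≤ |√a + √b| := by
    rw [abs_of_nonneg (add_nonneg (Real.sqrt_nonneg a) (Real.sqrt_nonneg b)), abs_le]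
    constructor <;> nlinarith [Real.sqrt_nonneg a, Real.sqrt_nonneg b]
  calc (√a - √b) ^ 2 = |√a - √b| * |√a - √b| := by rw [abs_mul_abs_self, sq]
    _ ≤ |√a - √b| * |√a + √b| := by gcongr
    _ = |(√a) ^ 2 - (√b) ^ 2| := by rw [← abs_mul]; congr 1; ring
    _ = _ := by rw [Real.sq_sqrt ha, Real.sq_sqrt hb]

/-- The integral of a step function with coefficients `c j` against increments of `B`. -/
def stepIntegral {Ω Ω₀ : Type*} (B : ℝ≥0 → Ω₀ → ℝ) (c : ℕ → Ω → ℝ) (τ : ℕ → ℝ≥0) (N : ℕ)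
    (p : Ω × Ω₀) : ℝ :=
  ∑ j ∈ Finset.range N, c j p.1 * (B (τ (j + 1)) p.2 - B (τ j) p.2)

section StepIntegral

variable {Ω Ω₀ : Type*} [mΩ : MeasurableSpace Ω] [mΩ₀ : MeasurableSpace Ω₀] {P : Measure Ω}
  [IsProbabilityMeasure P] {Q : Measure Ω₀} [IsProbabilityMeasure Q] {B : ℝ≥0 → Ω₀ → ℝ}

lemma measurable_stepIntegral (hB : ∀ t, Measurable (B t)) {c : ℕ → Ω → ℝ}
    (hc : ∀ j, Measurable (c j)) (τ : ℕ → ℝ≥0) (N : ℕ) : Measurable (stepIntegral B c τ N) :=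
  Finset.measurable_fun_sum _ fun j _ => ((hc j).comp measurable_fst).mul
    (((hB _).comp measurable_snd).sub ((hB _).comp measurable_snd))

/-- With `ω` fixed the coefficients are constants, and the increments of `B` are independent and
Gaussian. -/
lemma map_stepIntegral (hB : ∀ t, Measurable (B t)) (hBQ : IsPreBrownianReal B Q)
    {τ : ℕ → ℝ≥0} (hτ : Monotone τ) (c : ℕ → Ω → ℝ) (N : ℕ) (ω : Ω) :
    Q.map (fun y => stepIntegral B c τ N (ω, y)) =
      gaussianReal 0
        (∑ j ∈ Finset.range N, c j ω ^ 2 * ((τ (j + 1) : ℝ) - τ j)).toNNReal := by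
  have hle : ∀ j, τ j ≤ τ (j + 1) := fun j => hτ (Nat.le_succ j)
  have h := map_sum_mul_of_iIndepFun (Z := fun j y => B (τ (j + 1)) y - B (τ j) y) (μ := Q)
    (fun j => (hB _).sub (hB _)) (hBQ.hasIndepIncrements.nat hτ)
    (v := fun j => τ (j + 1) - τ j) (fun j => ?_) (Finset.range N) (fun j => c j ω)
  · simp_rw [NNReal.coe_sub (hle _)] at h
    exact h
  · have h1 := (hBQ.hasLaw_sub (τ (j + 1)) (τ j)).map_eq
    have h2 : nndist (τ (j + 1) : ℝ) (τ j) = τ (j + 1) - τ j := by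
      have : (τ j : ℝ) ≤ τ (j + 1) := by exact_mod_cast hle j
      ext
      rw [coe_nndist, Real.dist_eq, NNReal.coe_sub (hle j), abs_of_nonneg (sub_nonneg.2 this)]
    rw [← h2]
    exact h1

lemma sum_sq_mul_sub_nonneg {τ : ℕ → ℝ≥0} (hτ : Monotone τ) (a : ℕ → ℝ) (N : ℕ) :
    0 ≤ ∑ j ∈ Finset.range N, a j ^ 2 * ((τ (j + 1) : ℝ) - τ j) := by
  refine Finset.sum_nonneg fun j _ => mul_nonneg (sq_nonneg _) (sub_nonneg.2 ?_)
  exact_mod_cast hτ (Nat.le_succ j)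

/-- The Itô isometry on a product space: integrating over the Brownian factor first leaves the
conditional variance. -/
lemma lintegral_sq_stepIntegral (hB : ∀ t, Measurable (B t)) (hBQ : IsPreBrownianReal B Q)
    {τ : ℕ → ℝ≥0} (hτ : Monotone τ) {c : ℕ → Ω → ℝ} (hc : ∀ j, Measurable (c j)) (N : ℕ) :
    ∫⁻ p, ENNReal.ofReal (stepIntegral B c τ N p ^ 2) ∂(P.prod Q)
      = ∫⁻ ω, ENNReal.ofReal (∑ j ∈ Finset.range N, c j ω ^ 2 * ((τ (j + 1) : ℝ) - τ j)) ∂P := by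
  have hm := measurable_stepIntegral hB hc τ N
  rw [lintegral_prod _ (by fun_prop)]
  refine lintegral_congr fun ω => ?_
  have h := map_stepIntegral hB hBQ hτ c N ω
  have h1 := lintegral_map (μ := Q) (f := fun x : ℝ => ENNReal.ofReal (x ^ 2))
    (g := fun y => stepIntegral B c τ N (ω, y)) (by fun_prop) (by fun_prop)
  rw [← h1, h, lintegral_sq_gaussianReal]
  rfl

lemma integral_comp_stepIntegral (hB : ∀ t, Measurable (B t)) (hBQ : IsPreBrownianReal B Q)
    {τ : ℕ → ℝ≥0} (hτ : Monotone τ) {c : ℕ → Ω → ℝ} (hc : ∀ j, Measurable (c j)) (N : ℕ)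
    {φ : ℝ → ℝ} (hφ : Continuous φ) (hb : ∀ x, |φ x| ≤ 1) :
    ∫ p, φ (stepIntegral B c τ N p) ∂(P.prod Q) = ∫ ω, gaussSmooth φ 0
      (∑ j ∈ Finset.range N, c j ω ^ 2 * ((τ (j + 1) : ℝ) - τ j)) ∂P := by
  have hm := measurable_stepIntegral hB hc τ N
  have hi : Integrable (fun p => φ (stepIntegral B c τ N p)) (P.prod Q) :=
    Integrable.of_bound (hφ.measurable.comp hm).aestronglyMeasurable 1
      (ae_of_all _ fun p => by simpa using hb _)
  rw [integral_prod _ hi]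
  refine integral_congr_ae (ae_of_all _ fun ω => ?_)
  have h := map_stepIntegral hB hBQ hτ c N ω
  have h1 := integral_map (μ := Q) (f := φ)
    (φ := fun y => stepIntegral B c τ N (ω, y)) (by fun_prop) hφ.aestronglyMeasurable
  have h2 := gaussSmooth_eq_integral hφ 0
    (∑ j ∈ Finset.range N, c j ω ^ 2 * ((τ (j + 1) : ℝ) - τ j)).toNNReal
  rw [Real.coe_toNNReal _ (sum_sq_mul_sub_nonneg hτ (fun j => c j ω) N)] at h2
  simp only
  rw [← h1, h, h2]
  simp

end StepIntegral

/-- The points of the dyadic subdivision of `[0, t]`. -/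
noncomputable def dyadicTime (t : ℝ≥0) (k j : ℕ) : ℝ≥0 := t * (j / 2 ^ k)

lemma dyadicTime_mono (t : ℝ≥0) (k : ℕ) : Monotone (dyadicTime t k) := fun i j hij => by
  unfold dyadicTime; gcongr

@[simp] lemma dyadicTime_zero (t : ℝ≥0) (k : ℕ) : dyadicTime t k 0 = 0 := by simp [dyadicTime]

@[simp] lemma dyadicTime_pow (t : ℝ≥0) (k : ℕ) : dyadicTime t k (2 ^ k) = t := by
  simp [dyadicTime]

lemma dyadicTime_succ_two_mul (t : ℝ≥0) (k j : ℕ) :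
    dyadicTime t (k + 1) (2 * j) = dyadicTime t k j := by
  unfold dyadicTime
  congr 1
  push_cast
  rw [pow_succ']
  field_simp

lemma dyadicTime_sub (t : ℝ≥0) (k j : ℕ) :
    (dyadicTime t k (j + 1) : ℝ) - dyadicTime t k j = t / 2 ^ k := by
  unfold dyadicTime
  push_cast
  field_simp
  ring

namespace IsVarianceProcess

variable {Ω Ω₀ : Type*} [mΩ : MeasurableSpace Ω] [mΩ₀ : MeasurableSpace Ω₀] {P : Measure Ω}
  [IsProbabilityMeasure P] {Q : Measure Ω₀} [IsProbabilityMeasure Q] {B : ℝ≥0 → Ω₀ → ℝ}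
  {𝓕 : Filtration ℝ≥0 mΩ} {A : ℝ≥0 → Ω → ℝ} {K D : ℝ}

lemma lintegral_sq_sqrt_sub_le (hA : IsVarianceProcess P 𝓕 A K D) {s t : ℝ≥0} (hst : s ≤ t)
    {δ : ℝ} (hδ : (t : ℝ) - s ≤ δ) :
    ∫⁻ ω, ENNReal.ofReal ((√(A t ω) - √(A s ω)) ^ 2) ∂P ≤ ENNReal.ofReal (D * √δ) := by
  calc _ ≤ ∫⁻ ω, ENNReal.ofReal |A t ω - A s ω| ∂P := lintegral_mono fun ω =>
        ENNReal.ofReal_le_ofReal (sq_sqrt_sub_sqrt_le (hA.nonneg _ _) (hA.nonneg _ _))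
    _ = ENNReal.ofReal (∫ ω, |A t ω - A s ω| ∂P) := by
        rw [ofReal_integral_eq_lintegral_ofReal
          ((hA.integrable t).sub' (hA.integrable s)).abs (ae_of_all _ fun ω => abs_nonneg _)]
    _ ≤ _ := by
        refine ENNReal.ofReal_le_ofReal ((hA.integral_abs_sub_le s t hst).trans ?_)
        have := hA.holder_nonneg
        gcongr

/-- Integral of the step approximation of `√A` on the dyadic subdivision of `[0, t]`. -/
noncomputable def _root_.dyadicStepIntegral (B : ℝ≥0 → Ω₀ → ℝ) (A : ℝ≥0 → Ω → ℝ) (t : ℝ≥0)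
    (k : ℕ) : Ω × Ω₀ → ℝ :=
  stepIntegral B (fun j ω => √(A (dyadicTime t k j) ω)) (dyadicTime t k) (2 ^ k)

lemma measurable_dyadicStepIntegral (hA : IsVarianceProcess P 𝓕 A K D)
    (hB : ∀ t, Measurable (B t)) (t : ℝ≥0) (k : ℕ) : Measurable (dyadicStepIntegral B A t k) :=
  measurable_stepIntegral hB (fun _ => (hA.measurable' _).sqrt) _ _

lemma memLp_dyadicStepIntegral (hA : IsVarianceProcess P 𝓕 A K D) (hB : ∀ t, Measurable (B t))
    (hBQ : IsPreBrownianReal B Q) (t : ℝ≥0) (k : ℕ) :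
    MemLp (dyadicStepIntegral B A t k) 2 (P.prod Q) := by
  refine ⟨(hA.measurable_dyadicStepIntegral hB t k).aestronglyMeasurable, ?_⟩
  refine lt_of_le_of_lt (eLpNorm_two_le_of_lintegral_sq_le (c := K * t) ?_) ENNReal.ofReal_lt_top
  unfold dyadicStepIntegral
  rw [lintegral_sq_stepIntegral hB hBQ (dyadicTime_mono t k) fun _ => (hA.measurable' _).sqrt]
  calc _ ≤ ∫⁻ ω, ENNReal.ofReal (K * t) ∂P := by
        refine lintegral_mono fun ω => ENNReal.ofReal_le_ofReal ?_
        calc _ ≤ ∑ j ∈ Finset.range (2 ^ k),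
              K * ((dyadicTime t k (j + 1) : ℝ) - dyadicTime t k j) := by
              refine Finset.sum_le_sum fun j _ => ?_
              rw [Real.sq_sqrt (hA.nonneg _ _)]
              refine mul_le_mul_of_nonneg_right (hA.le _ _) (sub_nonneg.2 ?_)
              exact_mod_cast dyadicTime_mono t k (Nat.le_succ j)
          _ = K * t := by
              rw [← Finset.mul_sum, Finset.sum_range_sub fun j => (dyadicTime t k j : ℝ)]
              simp
    _ = _ := by simp

/-- Both integrals are written on the finer grid, where `2 * (j / 2)` indexes the left endpoint of
the parent interval. -/
lemma dyadicStepIntegral_succ_sub (t : ℝ≥0) (k : ℕ) (p : Ω × Ω₀) :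
    dyadicStepIntegral B A t (k + 1) p - dyadicStepIntegral B A t k p
      = stepIntegral B (fun j ω => √(A (dyadicTime t (k + 1) j) ω)
          - √(A (dyadicTime t (k + 1) (2 * (j / 2))) ω)) (dyadicTime t (k + 1)) (2 ^ (k + 1)) p := by
  unfold dyadicStepIntegral stepIntegral
  rw [pow_succ', sum_range_two_mul, sum_range_two_mul, ← Finset.sum_sub_distrib]
  refine Finset.sum_congr rfl fun j _ => ?_
  have h1 : 2 * j / 2 = j := by omega
  have h2 : (2 * j + 1) / 2 = j := by omega
  have h3 : 2 * j + 1 + 1 = 2 * (j + 1) := by ring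
  simp only [h1, h2, h3, dyadicTime_succ_two_mul]
  ring

lemma eLpNorm_dyadicStepIntegral_succ_sub_le (hA : IsVarianceProcess P 𝓕 A K D)
    (hB : ∀ t, Measurable (B t)) (hBQ : IsPreBrownianReal B Q) (t : ℝ≥0) (k : ℕ) :
    eLpNorm (fun p => dyadicStepIntegral B A t (k + 1) p - dyadicStepIntegral B A t k p) 2
      (P.prod Q) ≤ ENNReal.ofReal (√(D * √(t / 2 ^ (k + 1)) * t)) := by
  simp_rw [dyadicStepIntegral_succ_sub]
  refine eLpNorm_two_le_of_lintegral_sq_le ?_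
  have hm : ∀ s, Measurable fun ω => √(A s ω) := fun s => (hA.measurable' s).sqrt
  have hm' : ∀ j, Measurable fun ω => √(A (dyadicTime t (k + 1) j) ω)
      - √(A (dyadicTime t (k + 1) (2 * (j / 2))) ω) := fun j => (hm _).sub (hm _)
  rw [lintegral_sq_stepIntegral hB hBQ (dyadicTime_mono t (k + 1)) hm']
  have hδ : (0 : ℝ) ≤ t / 2 ^ (k + 1) := by positivity
  simp_rw [dyadicTime_sub]
  calc _ = ∑ j ∈ Finset.range (2 ^ (k + 1)), (∫⁻ ω, ENNReal.ofReal
        ((√(A (dyadicTime t (k + 1) j) ω) - √(A (dyadicTime t (k + 1) (2 * (j / 2))) ω)) ^ 2) ∂P)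
          * ENNReal.ofReal (t / 2 ^ (k + 1)) := by
        simp_rw [ENNReal.ofReal_sum_of_nonneg fun j _ => mul_nonneg (sq_nonneg _) hδ,
          ENNReal.ofReal_mul (sq_nonneg _)]
        rw [lintegral_finsetSum _ fun j _ => by
          exact (((hm' j).pow_const 2).ennreal_ofReal).mul_const _]
        refine Finset.sum_congr rfl fun j _ => ?_
        rw [lintegral_mul_const _ ((hm' j).pow_const 2).ennreal_ofReal]
    _ ≤ ∑ j ∈ Finset.range (2 ^ (k + 1)), ENNReal.ofReal (D * √(t / 2 ^ (k + 1)))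
          * ENNReal.ofReal (t / 2 ^ (k + 1)) := by
        refine Finset.sum_le_sum fun j _ => ?_
        gcongr
        refine hA.lintegral_sq_sqrt_sub_le (dyadicTime_mono _ _ (Nat.mul_div_le j 2)) ?_
        rw [← dyadicTime_sub t (k + 1) (2 * (j / 2)), sub_le_sub_iff_right]
        exact_mod_cast dyadicTime_mono t (k + 1) (by omega)
    _ = _ := by
        have := hA.holder_nonneg
        rw [Finset.sum_const, Finset.card_range, nsmul_eq_mul,
          ← ENNReal.ofReal_mul (by positivity), ← ENNReal.ofReal_natCast,
          ← ENNReal.ofReal_mul (by positivity)]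
        congr 1
        push_cast
        field_simp

lemma exists_tendsto_dyadicStepIntegral (hA : IsVarianceProcess P 𝓕 A K D)
    (hB : ∀ t, Measurable (B t)) (hBQ : IsPreBrownianReal B Q) (t : ℝ≥0) :
    ∃ Y : Ω × Ω₀ → ℝ, MemLp Y 2 (P.prod Q) ∧
      Tendsto (fun k => eLpNorm (fun p => dyadicStepIntegral B A t k p - Y p) 2 (P.prod Q))
        atTop (𝓝 0) := by
  have hmem := hA.memLp_dyadicStepIntegral (P := P) (Q := Q) hB hBQ t
  -- The `L²` distance between levels is `√(D √(t / 2 ^ (k + 1)) t)`, geometric of rate `2 ^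
  -- (-1/4)`.
  set r : ℝ := √(√(1 / 2)) with hr
  have hr0 : 0 ≤ r := Real.sqrt_nonneg _
  have hr1 : r < 1 := by
    have h : (1 / 2 : ℝ) < 1 := by norm_num
    rw [hr, Real.sqrt_lt' one_pos, Real.sqrt_lt' (by norm_num)]
    norm_num
  have hcauchy : CauchySeq fun k => (hmem k).toLp := by
    refine cauchySeq_of_edist_le_geometric (ENNReal.ofReal r)
      (ENNReal.ofReal (√(D * √(t / 2) * t))) ?_ ENNReal.ofReal_ne_top fun k => ?_
    · rw [← ENNReal.ofReal_one]
      exact (ENNReal.ofReal_lt_ofReal_iff one_pos).2 hr1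
    · rw [edist_comm, Lp.edist_toLp_toLp]
      refine (hA.eLpNorm_dyadicStepIntegral_succ_sub_le hB hBQ t k).trans (le_of_eq ?_)
      have := hA.holder_nonneg
      have hs : ∀ x : ℝ, 0 ≤ x → √(x ^ k) = √x ^ k := fun x hx => by
        rw [Real.sqrt_eq_iff_mul_self_eq (by positivity) (by positivity), ← mul_pow,
          Real.mul_self_sqrt hx]
      rw [← ENNReal.ofReal_pow hr0, ← ENNReal.ofReal_mul (Real.sqrt_nonneg _), hr,
        ← hs _ (Real.sqrt_nonneg _), ← hs _ (by norm_num), ← Real.sqrt_mul (by positivity)]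
      congr 2
      rw [show (t : ℝ) / 2 ^ (k + 1) = t / 2 * (1 / 2) ^ k by
        rw [one_div, inv_pow, pow_succ]; field_simp, Real.sqrt_mul (by positivity)]
      ring
  obtain ⟨Y, hY⟩ := cauchySeq_tendsto_of_complete hcauchy
  refine ⟨Y, Lp.memLp Y, ?_⟩
  rw [Lp.tendsto_Lp_iff_tendsto_eLpNorm'] at hY
  refine hY.congr fun k => eLpNorm_congr_ae ?_
  filter_upwards [(hmem k).coeFn_toLp] with p hp
  simp [hp]

/-- Both sides are limits along the dyadic subdivisions. On the left `f 0` is Lipschitz and the step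
integrals converge in `L²`; on the right the conditional variances are Riemann sums converging in
the mean, and smoothing is Lipschitz in the variance. -/
lemma integral_comp_eq_of_tendsto (hA : IsVarianceProcess P 𝓕 A K D)
    (hB : ∀ t, Measurable (B t)) (hBQ : IsPreBrownianReal B Q) {t : ℝ≥0} {Y : Ω × Ω₀ → ℝ}
    (hY : MemLp Y 2 (P.prod Q))
    (hlim : Tendsto (fun k => eLpNorm (fun p => dyadicStepIntegral B A t k p - Y p) 2 (P.prod Q))
        atTop (𝓝 0)) {f : ℕ → ℝ → ℝ} (hf : BoundedDerivs 2 f) :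
    ∫ p, f 0 (Y p) ∂(P.prod Q) = ∫ ω, gaussSmooth (f 0) 0 (timeIntegral A t ω) ∂P := by
  have hfc : Continuous (f 0) := hf.continuous (by norm_num)
  have hfb : ∀ x, |f 0 x| ≤ 1 := hf.bound 0 (by norm_num)
  have hlip : ∀ x y, |f 0 x - f 0 y| ≤ |x - y| := by
    intro x y
    have := (convex_univ (𝕜 := ℝ) (E := ℝ)).norm_image_sub_le_of_norm_hasDerivWithin_le
      (f := f 0) (f' := f 1) (C := 1) (x := y) (y := x)
      (fun z _ => (hf.hasDerivAt 0 (by norm_num) z).hasDerivWithinAt)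
      (fun z _ => by simpa using hf.bound 1 (by norm_num) z) (Set.mem_univ _) (Set.mem_univ _)
    simpa using this
  have hI : ∀ k, Integrable (fun p => f 0 (dyadicStepIntegral B A t k p)) (P.prod Q) := fun k =>
    Integrable.of_bound (hfc.measurable.comp
      (hA.measurable_dyadicStepIntegral hB t k)).aestronglyMeasurable 1
      (ae_of_all _ fun p => by simpa using hfb _)
  have h1 : Tendsto (fun k => ∫ p, f 0 (dyadicStepIntegral B A t k p) ∂(P.prod Q)) atTop
      (𝓝 (∫ p, f 0 (Y p) ∂(P.prod Q))) := by
    refine tendsto_integral_of_L1' _ (hfc.comp_aestronglyMeasurable hY.1)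
      (Eventually.of_forall hI) ?_
    refine tendsto_of_tendsto_of_tendsto_of_le_of_le tendsto_const_nhds hlim
      (fun _ => zero_le) fun k => ?_
    have hm : AEStronglyMeasurable (fun p => dyadicStepIntegral B A t k p - Y p) (P.prod Q) :=
      (hA.measurable_dyadicStepIntegral hB t k).aestronglyMeasurable.sub hY.1
    exact (eLpNorm_mono_ae (ae_of_all _ fun p => hlip _ _)).trans
      (eLpNorm_le_eLpNorm_of_exponent_le (by norm_num) hm)
  have hV : ∀ k, ∫ p, f 0 (dyadicStepIntegral B A t k p) ∂(P.prod Q)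
      = ∫ ω, gaussSmooth (f 0) 0 (∑ j ∈ Finset.range (2 ^ k), A (dyadicTime t k j) ω *
        ((dyadicTime t k (j + 1) : ℝ) - dyadicTime t k j)) ∂P := by
    intro k
    unfold dyadicStepIntegral
    rw [integral_comp_stepIntegral hB hBQ (dyadicTime_mono t k)
      (fun _ => (hA.measurable' _).sqrt) _ hfc hfb]
    simp_rw [Real.sq_sqrt (hA.nonneg _ _)]
  have hgs : ∀ {V : Ω → ℝ}, Integrable V P → Integrable (fun ω => gaussSmooth (f 0) 0 (V ω)) P :=
    fun {V} hV => Integrable.of_bound (((continuous_gaussSmooth hfc hfb).comp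
      (by fun_prop : Continuous fun v : ℝ => ((0 : ℝ), v))).comp_aestronglyMeasurable hV.1) 1
      (ae_of_all _ fun ω => by simpa using abs_gaussSmooth_le hfb _ _)
  have h2 : Tendsto (fun k => ∫ p, f 0 (dyadicStepIntegral B A t k p) ∂(P.prod Q)) atTop
      (𝓝 (∫ ω, gaussSmooth (f 0) 0 (timeIntegral A t ω) ∂P)) := by
    simp_rw [hV]
    have hb : Tendsto (fun k : ℕ => (t : ℝ) * (D * √(t / 2 ^ k))) atTop (𝓝 0) := by
      have h3 : Tendsto (fun k : ℕ => (t : ℝ) / 2 ^ k) atTop (𝓝 0) :=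
        tendsto_const_nhds.div_atTop (tendsto_pow_atTop_atTop_of_one_lt one_lt_two)
      have h4 := (((Real.continuous_sqrt.tendsto 0).comp h3).const_mul D).const_mul (t : ℝ)
      simpa using h4
    refine tendsto_iff_dist_tendsto_zero.2 (squeeze_zero (fun _ => dist_nonneg) (fun k => ?_) hb)
    have hS : Integrable (fun ω => ∑ j ∈ Finset.range (2 ^ k), A (dyadicTime t k j) ω *
        ((dyadicTime t k (j + 1) : ℝ) - dyadicTime t k j)) P :=
      integrable_finsetSum _ fun j _ => (hA.integrable _).mul_const _
    have hT := hA.integrable_timeIntegral (t := t) t.2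
    rw [Real.dist_eq, ← integral_sub (hgs hS) (hgs hT)]
    refine (MeasureTheory.abs_integral_le_integral_abs).trans ?_
    have h5 := hA.integral_abs_sum_sub_timeIntegral_le (dyadicTime_mono t k) (dyadicTime_zero t k)
      (fun j => (dyadicTime_sub t k j).le) (2 ^ k)
    rw [dyadicTime_pow] at h5
    refine le_trans (integral_mono ((hgs hS).sub' (hgs hT)).abs (hS.sub' hT).abs fun ω => ?_) h5
    refine hf.abs_gaussSmooth_sub_le 0 (hA.timeIntegral_nonneg t.2 ω) ?_
    refine Finset.sum_nonneg fun j _ => mul_nonneg (hA.nonneg _ _) ?_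
    rw [dyadicTime_sub]; positivity
  exact tendsto_nhds_unique h1 h2

end IsVarianceProcess

/-! ### Simple processes and the Itô integral on the extension. -/

namespace IsVarianceProcess

variable {Ω Ω₀ : Type*} [mΩ : MeasurableSpace Ω] [mΩ₀ : MeasurableSpace Ω₀] {P : Measure Ω}
  [IsProbabilityMeasure P] {Q : Measure Ω₀} [IsProbabilityMeasure Q] {B : ℝ≥0 → Ω₀ → ℝ}
  {𝓕 : Filtration ℝ≥0 mΩ} {A : ℝ≥0 → Ω → ℝ} {K D : ℝ}

/-- The step approximation of `√A` on the dyadic subdivision of `[0, t]`. -/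
noncomputable def dyadicStepProcess (hA : IsVarianceProcess P 𝓕 A K D)
    (hB : ∀ t, Measurable (B t)) (t : ℝ≥0) (k : ℕ) : SimpleProcess (prodFiltration 𝓕 hB) where
  N := 2 ^ k
  τ := dyadicTime t k
  ξ j p := √(A (dyadicTime t k j) p.1)
  mono := dyadicTime_mono t k
  measurable j := by
    have h1 : Measurable[prodFiltration 𝓕 hB (dyadicTime t k j), 𝓕 (dyadicTime t k j)]
        (Prod.fst : Ω × Ω₀ → Ω) := measurable_iff_comap_le.2 le_sup_left
    exact Real.continuous_sqrt.measurable.comp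
      (@Measurable.comp _ _ _ (prodFiltration 𝓕 hB (dyadicTime t k j)) (𝓕 (dyadicTime t k j)) _
        _ _ (hA.measurable (dyadicTime t k j)) h1)
  bounded := ⟨√K, fun k p => by
    rw [abs_of_nonneg (Real.sqrt_nonneg _)]
    exact Real.sqrt_le_sqrt (hA.le _ _)⟩

lemma integral_dyadicStepProcess (hA : IsVarianceProcess P 𝓕 A K D)
    (hB : ∀ t, Measurable (B t)) (t : ℝ≥0) (k : ℕ) (p : Ω × Ω₀) :
    (hA.dyadicStepProcess hB t k).integral (fun t p => B t p.2) t p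
      = dyadicStepIntegral B A t k p := by
  refine Finset.sum_congr rfl fun j hj => ?_
  have hj' : j < 2 ^ k := Finset.mem_range.1 hj
  have h : ∀ i ≤ 2 ^ k, dyadicTime t k i ≤ t := fun i hi =>
    (dyadicTime_mono t k hi).trans (dyadicTime_pow t k).le
  simp only [dyadicStepProcess]
  rw [min_eq_left (h _ hj'), min_eq_left (h _ hj'.le)]

lemma exists_value_dyadicStepProcess (hA : IsVarianceProcess P 𝓕 A K D)
    (hB : ∀ t, Measurable (B t)) {t s : ℝ≥0} (hs : 0 < s) (hst : s ≤ t) (k : ℕ) :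
    ∃ u ≤ s, (s : ℝ) - u ≤ t / 2 ^ k ∧
      ∀ p : Ω × Ω₀, (hA.dyadicStepProcess hB t k).value s p = √(A u p.1) := by
  have hmono := dyadicTime_mono t k
  have hmem : s ∈ ⋃ j ∈ Set.Ico 0 (2 ^ k), Set.Ioc (dyadicTime t k j) (dyadicTime t k (j + 1)) := by
    have h := hmono.biUnion_Ico_Ioc_map_succ 0 (2 ^ k)
    simp only [Nat.succ_eq_succ, Nat.succ_eq_add_one] at h
    rw [h]
    simpa using ⟨hs, hst⟩
  simp only [Set.mem_iUnion] at hmem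
  obtain ⟨j, hj, hsj⟩ := hmem
  refine ⟨dyadicTime t k j, hsj.1.le, ?_, fun p => ?_⟩
  · rw [← dyadicTime_sub t k j, sub_le_sub_iff_right]
    exact_mod_cast hsj.2
  · unfold SimpleProcess.value dyadicStepProcess
    rw [Finset.sum_eq_single_of_mem j (Finset.mem_range.2 hj.2), Set.indicator_of_mem hsj]
    intro i _ hij
    refine Set.indicator_of_notMem (fun hsi => ?_) _
    exact Set.disjoint_left.1 (hmono.pairwise_disjoint_on_Ioc_succ hij) hsi hsj

/-- At each time the step process equals `√A` at an earlier time within `t / 2 ^ k`, so the Hölder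
bound applies time by time before integrating. -/
lemma eLpNorm_value_sub_le (hA : IsVarianceProcess P 𝓕 A K D)
    (hB : ∀ t, Measurable (B t)) (t : ℝ≥0) (k : ℕ) :
    eLpNorm (fun p : ℝ × Ω × Ω₀ => (hA.dyadicStepProcess hB t k).value p.1.toNNReal p.2
      - √(A p.1.toNNReal p.2.1)) 2 ((volume.restrict (Set.Ioc 0 (t : ℝ))).prod (P.prod Q))
      ≤ ENNReal.ofReal (√(D * √(t / 2 ^ k) * t)) := by
  refine eLpNorm_two_le_of_lintegral_sq_le ((lintegral_prod_le _).trans ?_)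
  have hD := hA.holder_nonneg
  calc _ ≤ ∫⁻ _ in Set.Ioc 0 (t : ℝ), ENNReal.ofReal (D * √(t / 2 ^ k)) := by
        refine setLIntegral_mono measurable_const fun s hs => ?_
        have hs0 : 0 < s.toNNReal := Real.toNNReal_pos.2 hs.1
        have hst : s.toNNReal ≤ t := Real.toNNReal_le_iff_le_coe.2 hs.2
        obtain ⟨u, hu, hδ, hval⟩ := hA.exists_value_dyadicStepProcess hB hs0 hst k
        simp only [hval]
        have h1 : ∫⁻ p : Ω × Ω₀, ENNReal.ofReal ((√(A u p.1) - √(A s.toNNReal p.1)) ^ 2)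
            ∂(P.prod Q) = ∫⁻ ω, ENNReal.ofReal ((√(A u ω) - √(A s.toNNReal ω)) ^ 2) ∂P := by
          have hm : Measurable fun ω => ENNReal.ofReal ((√(A u ω) - √(A s.toNNReal ω)) ^ 2) :=
            (((hA.measurable' _).sqrt.sub (hA.measurable' _).sqrt).pow_const 2).ennreal_ofReal
          exact measurePreserving_fst.lintegral_comp hm
        rw [h1]
        simp_rw [← neg_sub (√(A s.toNNReal _)) (√(A u _)), neg_sq]
        exact hA.lintegral_sq_sqrt_sub_le hu hδ
    _ = _ := by
        rw [setLIntegral_const, Real.volume_Ioc, sub_zero, ← ENNReal.ofReal_mul (by positivity)]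

/-- The Itô integral of `√A` against a Brownian motion on an independent factor. -/
theorem exists_isItoIntegral (hA : IsVarianceProcess P 𝓕 A K D) (hB : ∀ t, Measurable (B t))
    (hBQ : IsPreBrownianReal B Q) (t : ℝ≥0) :
    ∃ Y : Ω × Ω₀ → ℝ,
      IsItoIntegral (P.prod Q) (prodFiltration 𝓕 hB) (fun s p => B s p.2)
        (fun s p => √(A s p.1)) t Y ∧
      ∀ f, BoundedDerivs 2 f →
        ∫ p, f 0 (Y p) ∂(P.prod Q) = ∫ ω, gaussSmooth (f 0) 0 (timeIntegral A t ω) ∂P := by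
  obtain ⟨Y, hY, hlim⟩ := hA.exists_tendsto_dyadicStepIntegral hB hBQ t
  refine ⟨Y, ⟨?_, hY, fun k => hA.dyadicStepProcess hB t k, ?_, ?_⟩,
    fun f hf => hA.integral_comp_eq_of_tendsto hB hBQ hY hlim hf⟩
  · refine MemLp.of_bound (C := √K) (AEMeasurable.aestronglyMeasurable ?_)
      (ae_of_all _ fun p => ?_)
    · have h1 : Measure.QuasiMeasurePreserving (fun p : ℝ × Ω × Ω₀ => (p.1, p.2.1))
          ((volume.restrict (Set.Ioc 0 (t : ℝ))).prod (P.prod Q)) (volume.prod P) := by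
        have h2 : Measure.QuasiMeasurePreserving (fun p : ℝ × Ω × Ω₀ => (p.1, p.2.1))
            ((volume.restrict (Set.Ioc 0 (t : ℝ))).prod (P.prod Q))
            ((volume.restrict (Set.Ioc 0 (t : ℝ))).prod P) :=
          ((MeasurePreserving.id _).prod measurePreserving_fst).quasiMeasurePreserving
        exact h2.mono_right
          (Measure.AbsolutelyContinuous.prod Measure.absolutelyContinuous_restrict
            Measure.AbsolutelyContinuous.rfl)
      exact (hA.aemeasurable.comp_quasiMeasurePreserving h1).sqrt
    · rw [Real.norm_eq_abs, abs_of_nonneg (Real.sqrt_nonneg _)]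
      exact Real.sqrt_le_sqrt (hA.le _ _)
  · have hb : Tendsto (fun k : ℕ => ENNReal.ofReal (√(D * √(t / 2 ^ k) * t))) atTop (𝓝 0) := by
      have h3 : Tendsto (fun k : ℕ => (t : ℝ) / 2 ^ k) atTop (𝓝 0) :=
        tendsto_const_nhds.div_atTop (tendsto_pow_atTop_atTop_of_one_lt one_lt_two)
      have h4 : Tendsto (fun x : ℝ => ENNReal.ofReal (√(D * √x * t))) (𝓝 0) (𝓝 0) := by
        have h5 : Continuous fun x : ℝ => ENNReal.ofReal (√(D * √x * t)) :=
          ENNReal.continuous_ofReal.comp (by fun_prop)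
        simpa using h5.tendsto 0
      exact h4.comp h3
    exact tendsto_of_tendsto_of_tendsto_of_le_of_le tendsto_const_nhds hb (fun _ => zero_le)
      fun k => hA.eLpNorm_value_sub_le hB t k
  · simp_rw [hA.integral_dyadicStepProcess hB]
    exact hlim

end IsVarianceProcess

/-! ### The kernel of the statistic -/

lemma opNorm_le_of_norm_single_le {d : ℕ} {F : Type*} [NormedAddCommGroup F] [NormedSpace ℝ F]
    {L : EuclideanSpace ℝ (Fin d) →L[ℝ] F} {M : ℝ} (hM : 0 ≤ M)
    (h : ∀ i, ‖L (EuclideanSpace.single i 1)‖ ≤ M) : ‖L‖ ≤ d * M := by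
  refine L.opNorm_le_bound (by positivity) fun v => ?_
  have hv : v = ∑ i, v i • EuclideanSpace.single i (1 : ℝ) := by
    have := (EuclideanSpace.basisFun (Fin d) ℝ).sum_repr v
    simpa using this.symm
  calc ‖L v‖ = ‖∑ i, v i • L (EuclideanSpace.single i 1)‖ := by
        conv_lhs => rw [hv, map_sum]
        simp_rw [map_smul]
    _ ≤ ∑ i : Fin d, ‖v‖ * M := by
        refine (norm_sum_le _ _).trans (Finset.sum_le_sum fun i _ => ?_)
        rw [norm_smul]
        exact mul_le_mul (PiLp.norm_apply_le v i) (h i) (norm_nonneg _) (norm_nonneg _)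
    _ = _ := by simp; ring

lemma min_one_mul_bound {K a b x : ℝ} (h1 : x ≤ a) (h2 : x ≤ a * b) (ha : a ≤ K)
    (hb : 0 ≤ b) : x ≤ K * min 1 b := by
  rcases le_total 1 b with h | h
  · rw [min_eq_left h]; linarith
  · rw [min_eq_right h]; nlinarith

/-- Differences of a function with bounded derivatives of order at most two. -/
lemma HasBoundedDiffs.of_fderiv {E : Type*} [NormedAddCommGroup E] [NormedSpace ℝ E] {f : E → ℝ}
    {K : ℝ} (hf : ContDiff ℝ 2 f) (h0 : ∀ x, |f x| ≤ K) (h1 : ∀ x, ‖fderiv ℝ f x‖ ≤ K)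
    (h2 : ∀ x, ‖fderiv ℝ (fderiv ℝ f) x‖ ≤ K) : HasBoundedDiffs (4 * K) f := by
  have hK : 0 ≤ K := (abs_nonneg _).trans (h0 0)
  have hd : Differentiable ℝ f := hf.differentiable (by norm_num)
  have hd2 : Differentiable ℝ (fderiv ℝ f) :=
    (hf.fderiv_right (m := 1) (by norm_num)).differentiable (by norm_num)
  have hlip : ∀ x v, ‖f (x + v) - f x‖ ≤ K * ‖v‖ := fun x v => by
    simpa using (convex_univ (𝕜 := ℝ) (E := E)).norm_image_sub_le_of_norm_fderiv_le
      (f := f) (C := K) (x := x) (y := x + v) (fun z _ => hd z) (fun z _ => h1 z)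
      (Set.mem_univ _) (Set.mem_univ _)
  have hlip2 : ∀ x v, ‖fderiv ℝ f (x + v) - fderiv ℝ f x‖ ≤ K * ‖v‖ := fun x v => by
    simpa using (convex_univ (𝕜 := ℝ) (E := E)).norm_image_sub_le_of_norm_fderiv_le
      (f := fderiv ℝ f) (C := K) (x := x) (y := x + v) (fun z _ => hd2 z) (fun z _ => h2 z)
      (Set.mem_univ _) (Set.mem_univ _)
  have hb : ∀ x y z, |f x + f y - 2 * f z| ≤ 4 * K := fun x y z => by
    have := _root_.abs_le.1 (h0 x)
    have := _root_.abs_le.1 (h0 y)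
    have := _root_.abs_le.1 (h0 z)
    rw [_root_.abs_le]; constructor <;> linarith
  refine ⟨fun x => (h0 x).trans (by linarith), fun x v => ?_, fun x v => ?_⟩
  · have h3 : |f (x + v) - f x| ≤ 2 * K := by
      have := _root_.abs_le.1 (h0 x)
      have := _root_.abs_le.1 (h0 (x + v))
      rw [_root_.abs_le]; constructor <;> linarith
    have h4 := hlip x v
    rw [Real.norm_eq_abs] at h4
    have := norm_nonneg v
    exact min_one_mul_bound (a := 2 * K) h3 (by nlinarith) (by linarith) this
  · have h5 : |f (x + v) + f (x - v) - 2 * f x| ≤ K * ‖v‖ * ‖v‖ := by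
      -- The second difference is the increment of `z ↦ f (z + v) - f z` from `x - v` to `x`, and
      -- the derivative of this map is at most `K * ‖v‖`.
      have hu : ∀ z, HasFDerivAt (fun z => f (z + v) - f z)
          (fderiv ℝ f (z + v) - fderiv ℝ f z) z := fun z =>
        ((hasFDerivAt_comp_add_right v).2 (hd (z + v)).hasFDerivAt).sub (hd z).hasFDerivAt
      have h6 := (convex_univ (𝕜 := ℝ) (E := E)).norm_image_sub_le_of_norm_hasFDerivWithin_le
        (f := fun z => f (z + v) - f z) (C := K * ‖v‖) (x := x - v) (y := x)
        (fun z _ => (hu z).hasFDerivWithinAt) (fun z _ => hlip2 z v)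
        (Set.mem_univ _) (Set.mem_univ _)
      simp only [sub_add_cancel, sub_sub_cancel, Real.norm_eq_abs] at h6
      convert h6 using 2
      ring
    have h7 : truncNorm v ^ 2 = min 1 (‖v‖ ^ 2) := by
      unfold truncNorm
      rcases le_total 1 ‖v‖ with h | h
      · rw [min_eq_left h, min_eq_left (one_le_pow₀ h), one_pow]
      · rw [min_eq_right h, min_eq_right (pow_le_one₀ (norm_nonneg v) h)]
    rw [h7]
    have := sq_nonneg ‖v‖
    exact min_one_mul_bound (a := 4 * K) (hb _ _ _) (by nlinarith) le_rfl this

/-- Bounds on partial derivatives become operator norm bounds at the price of a factor `d` per order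
of differentiation. -/
lemma HighFreq.IsAdmissible.exists_hasBoundedDiffs {d m : ℕ}
    {g : EuclideanSpace ℝ (Fin d) → (Fin (m + 1) → EuclideanSpace ℝ (Fin d)) → ℝ}
    (hg : IsAdmissible g) : ∃ K, ∀ y, HasBoundedDiffs K fun x => g x y := by
  obtain ⟨K₀, h0⟩ := hg.bounded
  obtain ⟨K₁, h1⟩ := hg.bounded_fst
  obtain ⟨K₂, h2⟩ := hg.bounded_snd
  set M := max 0 (max K₀ (max K₁ K₂)) with hM
  have hM0 : 0 ≤ M := le_max_left _ _
  have e0 : K₀ ≤ M := (le_max_left _ _).trans (le_max_right _ _)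
  have e1 : K₁ ≤ M := ((le_max_left _ _).trans (le_max_right _ _)).trans (le_max_right _ _)
  have e2 : K₂ ≤ M := ((le_max_right _ _).trans (le_max_right _ _)).trans (le_max_right _ _)
  have hd0 : (0 : ℝ) ≤ d := by positivity
  have q1 : (d : ℝ) * M ≤ M + d * M + d * (d * M) := by nlinarith [mul_nonneg hd0 hM0]
  have q2 : (d : ℝ) * (d * M) ≤ M + d * M + d * (d * M) := by nlinarith [mul_nonneg hd0 hM0]
  have q0 : M ≤ M + d * M + d * (d * M) := by
    have := mul_nonneg hd0 hM0
    have := mul_nonneg hd0 this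
    linarith
  refine ⟨4 * (M + d * M + d * (d * M)), fun y => HasBoundedDiffs.of_fderiv (hg.contDiff y)
    (fun x => (h0 x y).trans (e0.trans q0)) (fun x => ?_) fun x => ?_⟩
  · exact (opNorm_le_of_norm_single_le hM0 fun i => (h1 i x y).trans e1).trans q1
  · refine le_trans (opNorm_le_of_norm_single_le (by positivity) fun i => ?_) q2
    refine opNorm_le_of_norm_single_le hM0 fun j => ?_
    have := h2 i j x y
    rw [iteratedFDeriv_two_apply] at this
    exact this.trans e2

section Kernel

variable {E : Type*} [NormedAddCommGroup E] [MeasurableSpace E] [BorelSpace E] {m : ℕ}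
  {ν : Measure E} [IsProbabilityMeasure ν] {K : ℝ} {g : E → (Fin (m + 1) → E) → ℝ}

/-- The mean of `g x` over blocks of independent variables with law `ν`. -/
noncomputable def blockMean (ν : Measure E) (g : E → (Fin (m + 1) → E) → ℝ) (x : E) : ℝ :=
  ∫ y, g x (seqBlock m 0 y) ∂iidLaw ν

lemma hasBoundedDiffs_blockMean (hm : Measurable (Function.uncurry g))
    (hg : ∀ y, HasBoundedDiffs K fun x => g x y) : HasBoundedDiffs K (blockMean ν g) :=
  HasBoundedDiffs.integral (fun _ => (hm.comp measurable_prodMk_left).comp (measurable_seqBlock m 0))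
    fun _ => hg _

lemma isCenteredKernel_sub_blockMean (hm : Measurable (Function.uncurry g))
    (hg : ∀ y, HasBoundedDiffs K fun x => g x y) :
    IsCenteredKernel ν (K + K) fun x y => g x y - blockMean ν g x where
  measurable := hm.sub
    ((hasBoundedDiffs_blockMean (ν := ν) hm hg).continuous.measurable.comp measurable_fst)
  hasBoundedDiffs y := (hg y).sub (hasBoundedDiffs_blockMean hm hg)
  integral_eq_zero x := by
    have hi : Integrable (fun y => g x (seqBlock m 0 y)) (iidLaw ν) := Integrable.of_bound
      ((hm.comp measurable_prodMk_left).comp (measurable_seqBlock m 0)).aestronglyMeasurable K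
      (ae_of_all _ fun y => (hg _).bound x)
    rw [integral_sub hi (integrable_const _)]
    simp [blockMean]

lemma map_iidLaw_fin (N : ℕ) :
    (iidLaw ν).map (fun (y : ℕ → E) (i : Fin N) => y i) = Measure.pi fun _ : Fin N => ν := by
  rw [← Measure.infinitePi_eq_pi]
  exact Measure.map_infinitePi_infinitePi_of_inj (P := fun _ : ℕ => ν)
    (f := fun i : Fin N => (i : ℕ)) Fin.val_injective

/-- The sum of the covariances of blocks of independent variables. -/
lemma sum_covariance_eq_asympVar (hm : Measurable (Function.uncurry g))
    (hg : ∀ y, HasBoundedDiffs K fun x => g x y) (x : E) :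
    ∑ k : Fin (2 * m + 1), covariance
      (fun ξ : Fin (3 * m + 1) → E => g x fun l : Fin (m + 1) => ξ ⟨m + l, by omega⟩)
      (fun ξ : Fin (3 * m + 1) → E => g x fun l : Fin (m + 1) => ξ ⟨k + l, by omega⟩)
      (Measure.pi fun _ : Fin (3 * m + 1) => ν)
      = asympVar ν (fun x y => g x y - blockMean ν g x) x := by
  have hh := isCenteredKernel_sub_blockMean (ν := ν) hm hg
  set h : E → (Fin (m + 1) → E) → ℝ := fun x y => g x y - blockMean ν g x with hdef
  have hgx : Measurable (g x) := hm.comp measurable_prodMk_left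
  have hmean : ∀ i, ∫ y, g x (seqBlock m i y) ∂iidLaw ν = blockMean ν g x := by
    intro i
    have h1 := hh.integral_seqBlock x i
    simp only [hdef] at h1
    have hi : Integrable (fun y => g x (seqBlock m i y)) (iidLaw ν) := Integrable.of_bound
      (hgx.comp (measurable_seqBlock m i)).aestronglyMeasurable K
      (ae_of_all _ fun y => (hg _).bound x)
    rw [integral_sub hi (integrable_const _)] at h1
    simp at h1
    linarith
  have hcov : ∀ k : Fin (2 * m + 1), covariance
      (fun ξ : Fin (3 * m + 1) → E => g x fun l : Fin (m + 1) => ξ ⟨m + l, by omega⟩)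
      (fun ξ : Fin (3 * m + 1) → E => g x fun l : Fin (m + 1) => ξ ⟨k + l, by omega⟩)
      (Measure.pi fun _ : Fin (3 * m + 1) => ν)
      = ∫ y, h x (seqBlock m m y) * h x (seqBlock m k y) ∂iidLaw ν := by
    intro k
    have hr : Measurable fun (y : ℕ → E) (i : Fin (3 * m + 1)) => y i := by fun_prop
    have hblk : ∀ (j : ℕ) (hj : j ≤ 2 * m), Measurable fun ξ : Fin (3 * m + 1) → E =>
        g x fun l : Fin (m + 1) => ξ ⟨j + l, by omega⟩ := fun j hj => hgx.comp (by fun_prop)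
    have e : ∀ (j : ℕ) (hj : j ≤ 2 * m), ∫ ξ : Fin (3 * m + 1) → E,
        g x (fun l : Fin (m + 1) => ξ ⟨j + l, by omega⟩) ∂(Measure.pi fun _ => ν)
        = blockMean ν g x := by
      intro j hj
      rw [← map_iidLaw_fin, integral_map hr.aemeasurable (hblk j hj).aestronglyMeasurable]
      exact hmean j
    have hk : (k : ℕ) ≤ 2 * m := by omega
    rw [covariance, e m (by omega), e k hk, ← map_iidLaw_fin]
    refine (integral_map hr.aemeasurable ?_).trans rfl
    exact (((hblk m (by omega)).sub_const _).mul ((hblk k hk).sub_const _)).aestronglyMeasurable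
  simp_rw [hcov]
  -- The sum is cut at `k = m`, which is lag zero: indices below give negative lags, reflected onto
  -- positive ones, and indices from `m` on give the lags `0, …, m`.
  rw [Fin.sum_univ_eq_sum_range
    (fun k => ∫ y, h x (seqBlock m m y) * h x (seqBlock m k y) ∂iidLaw ν) (2 * m + 1),
    show 2 * m + 1 = m + (m + 1) by ring, Finset.sum_range_add]
  have e1 : ∀ k, ∫ y, h x (seqBlock m m y) * h x (seqBlock m (m + k) y) ∂iidLaw ν
      = autocov ν h k x := fun k => hh.integral_seqBlock_mul x m k
  have e2 : ∀ k ∈ Finset.range m, ∫ y, h x (seqBlock m m y) * h x (seqBlock m k y) ∂iidLaw ν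
      = autocov ν h (m - 1 - k + 1) x := by
    intro k hk
    have hk' := Finset.mem_range.1 hk
    rw [← hh.integral_seqBlock_mul x k, show k + (m - 1 - k + 1) = m by omega]
    simp_rw [mul_comm]
  rw [Finset.sum_congr rfl e2, Finset.sum_range_reflect (fun k => autocov ν h (k + 1) x) m]
  simp_rw [e1]
  rw [Finset.sum_range_succ', asympVar]
  ring

end Kernel

/-! ### Marginal laws of symmetric stable processes -/

namespace HighFreq.IsSymmetricStable

variable {Ω : Type*} [mΩ : MeasurableSpace Ω] {d : ℕ} {P : Measure Ω} [IsProbabilityMeasure P]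
  {𝓕 : Filtration ℝ≥0 mΩ} {α c : ℝ} {X : ℝ≥0 → Ω → EuclideanSpace ℝ (Fin d)}

lemma measurable (hX : IsSymmetricStable P 𝓕 α X) (t : ℝ≥0) : Measurable (X t) :=
  (hX.levy.adapted t).mono (𝓕.le t) le_rfl

lemma charFun_map (hX : IsSymmetricStable P 𝓕 α X)
    (hc : ∀ l : Fin d, HasLevyExponent P (fun t ω => X t ω l)
      (fun β => ((-(c * |β| ^ α) : ℝ) : ℂ))) (t : ℝ≥0) (β : EuclideanSpace ℝ (Fin d)) :
    charFun (P.map (X t)) β = ∏ l, Complex.exp ((t : ℂ) * ((-(c * |β l| ^ α) : ℝ) : ℂ)) := by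
  have hi : iIndepFun (fun (l : Fin d) ω => X t ω l) P :=
    hX.indep_components.comp (fun _ (x : ℝ≥0 → ℝ) => x t) fun _ => measurable_pi_apply t
  have hm := hX.measurable t
  have h1 := (iIndepFun_iff_charFun_pi
    (fun l => ((by fun_prop : Measurable fun ω => X t ω l)).aemeasurable)).1 hi β
  simp_rw [fun l => hc l t (β.ofLp l)] at h1
  exact h1

/-- The self-similarity of the marginal laws. -/
lemma map_smul_eq (hX : IsSymmetricStable P 𝓕 α X) (hα : 0 < α) {n : ℕ} (hn : 1 ≤ n) :
    P.map (fun ω => (n : ℝ) ^ (1 / α) • X (gridTime n 1) ω) = P.map (X 1) := by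
  obtain ⟨c, -, hc⟩ := hX.exponent
  have hm := hX.measurable
  have hn0 : (0 : ℝ) < n := by exact_mod_cast hn
  have h1 := Measure.isProbabilityMeasure_map (μ := P) (hm 1).aemeasurable
  have h2 := Measure.isProbabilityMeasure_map (μ := P)
    (((hm (gridTime n 1)).const_smul ((n : ℝ) ^ (1 / α))).aemeasurable)
  apply Measure.ext_of_charFun
  ext β
  have h3 : P.map (fun ω => (n : ℝ) ^ (1 / α) • X (gridTime n 1) ω)
      = (P.map (X (gridTime n 1))).map fun x => (n : ℝ) ^ (1 / α) • x := by
    rw [Measure.map_map (by fun_prop) (hm _)]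
    rfl
  rw [h3, charFun_map_smul, hX.charFun_map hc, hX.charFun_map hc]
  refine Finset.prod_congr rfl fun l _ => ?_
  have h4 : |((n : ℝ) ^ (1 / α) • β) l| ^ α = n * |β l| ^ α := by
    rw [PiLp.smul_apply, smul_eq_mul, abs_mul, Real.mul_rpow (abs_nonneg _) (abs_nonneg _),
      abs_of_pos (Real.rpow_pos_of_pos hn0 _), ← Real.rpow_mul hn0.le, one_div,
      inv_mul_cancel₀ hα.ne', Real.rpow_one]
  rw [h4]
  congr 1
  have h5 : ((gridTime n 1 : ℝ≥0) : ℂ) = (n : ℂ)⁻¹ := by simp [gridTime]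
  have h6 : (n : ℂ) ≠ 0 := by exact_mod_cast hn0.ne'
  rw [h5]
  push_cast
  field_simp

lemma map_neg_eq (hX : IsSymmetricStable P 𝓕 α X) (t : ℝ≥0) :
    (P.map (X t)).map Neg.neg = P.map (X t) := by
  obtain ⟨c, -, hc⟩ := hX.exponent
  have h1 := Measure.isProbabilityMeasure_map (μ := P) (hX.measurable t).aemeasurable
  have h2 := Measure.isProbabilityMeasure_map (μ := P.map (X t))
    (measurable_neg (G := EuclideanSpace ℝ (Fin d))).aemeasurable
  apply Measure.ext_of_charFun
  ext β
  have h3 : (P.map (X t)).map Neg.neg = (P.map (X t)).map fun x => (-1 : ℝ) • x := by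
    congr 1; ext x; simp
  rw [h3, charFun_map_smul, hX.charFun_map hc, hX.charFun_map hc]
  simp

/-- Scaling by `b` multiplies the stable scale parameter by `b ^ α`, so the one-dimensional estimate
applies to each coordinate. -/
lemma integral_truncNorm_smul_sq_le (hX : IsSymmetricStable P 𝓕 α X) (hα : 0 < α) (hα' : α ≤ 2)
    (hc0 : 0 ≤ c) (hc : ∀ l : Fin d, HasLevyExponent P (fun t ω => X t ω l)
      (fun β => ((-(c * |β| ^ α) : ℝ) : ℂ))) (t : ℝ≥0) {b : ℝ} (hb : 0 ≤ b) :
    ∫ x, truncNorm (b • x) ^ 2 ∂(P.map (X t)) ≤ 6 * d * (t * c * b ^ α) := by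
  have hm := hX.measurable t
  have h1 := Measure.isProbabilityMeasure_map (μ := P) hm.aemeasurable
  have hs : Measurable fun x : EuclideanSpace ℝ (Fin d) => b • x := by fun_prop
  have h2 := Measure.isProbabilityMeasure_map (μ := P.map (X t)) hs.aemeasurable
  have h3 := integral_truncNorm_sq_le_of_charFun (ρ := (P.map (X t)).map fun x => b • x)
    (s := t * c * b ^ α) hα hα' (by positivity) fun l β => ?_
  · have h5 := integral_map (μ := P.map (X t)) hs.aemeasurable
      (f := fun x : EuclideanSpace ℝ (Fin d) => truncNorm x ^ 2)
      (continuous_truncNorm.pow 2).aestronglyMeasurable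
    exact h5.symm.trans_le h3
  · have h4 : ((P.map (X t)).map fun x => b • x).map (fun x => x l)
        = (P.map fun ω => X t ω l).map fun x => b * x := by
      rw [Measure.map_map (by fun_prop) hs, Measure.map_map (by fun_prop) hm,
        Measure.map_map (by fun_prop) (by fun_prop)]
      rfl
    rw [h4, charFun_map_mul, hc l t (b * β)]
    simp only
    rw [abs_mul, Real.mul_rpow (abs_nonneg _) (abs_nonneg _),
      abs_of_nonneg hb]
    congr 1
    push_cast
    ring

lemma integral_truncNorm_sub_sq_le (hX : IsSymmetricStable P 𝓕 α X) (hα : 0 < α) (hα' : α ≤ 2)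
    (hc0 : 0 ≤ c) (hc : ∀ l : Fin d, HasLevyExponent P (fun t ω => X t ω l)
      (fun β => ((-(c * |β| ^ α) : ℝ) : ℂ))) {s t : ℝ≥0} (hst : s ≤ t) :
    ∫ ω, truncNorm (X t ω - X s ω) ^ 2 ∂P ≤ 6 * d * c * ((t : ℝ) - s) := by
  have hm := hX.measurable
  have h1 := hX.integral_truncNorm_smul_sq_le hα hα' hc0 hc (t - s) (b := 1) zero_le_one
  have hsub : Measurable fun ω => X t ω - X s ω := (hm t).sub (hm s)
  have h2 := integral_map (μ := P) hsub.aemeasurable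
    (f := fun x : EuclideanSpace ℝ (Fin d) => truncNorm x ^ 2)
    (continuous_truncNorm.pow 2).aestronglyMeasurable
  simp only [one_smul, Real.one_rpow, mul_one, NNReal.coe_sub hst] at h1
  rw [← hX.levy.stationary_increments s (t - s), add_tsub_cancel_of_le hst, h2] at h1
  linarith

/-- Cauchy–Schwarz on the truncated second moment gives the Hölder exponent `1/2` for every `α`,
which is enough for the Riemann sums to err by `O(1 / √n)`. -/
lemma integral_truncNorm_sub_le (hX : IsSymmetricStable P 𝓕 α X) (hα : 0 < α) (hα' : α ≤ 2)
    (hc0 : 0 ≤ c) (hc : ∀ l : Fin d, HasLevyExponent P (fun t ω => X t ω l)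
      (fun β => ((-(c * |β| ^ α) : ℝ) : ℂ))) {s t : ℝ≥0} (hst : s ≤ t) :
    ∫ ω, truncNorm (X t ω - X s ω) ∂P ≤ √(6 * d * c) * √((t : ℝ) - s) := by
  have hm := hX.measurable
  rw [← Real.sqrt_mul (by positivity)]
  exact (integral_truncNorm_le_sqrt ((hm t).sub (hm s))).trans
    (Real.sqrt_le_sqrt (hX.integral_truncNorm_sub_sq_le hα hα' hc0 hc hst))

/-- A function of the process with bounded differences is a process of bounded variance type. -/
lemma isVarianceProcess_comp (hX : IsSymmetricStable P 𝓕 α X) (hα : 0 < α) (hα' : α ≤ 2)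
    (hc0 : 0 ≤ c) (hc : ∀ l : Fin d, HasLevyExponent P (fun t ω => X t ω l)
      (fun β => ((-(c * |β| ^ α) : ℝ) : ℂ))) {q : EuclideanSpace ℝ (Fin d) → ℝ} {L : ℝ}
    (hq : HasBoundedDiffs L q) (hq0 : ∀ x, 0 ≤ q x) :
    IsVarianceProcess P 𝓕 (fun s ω => q (X s ω)) L (L * √(6 * d * c)) where
  measurable s := hq.continuous.measurable.comp (hX.levy.adapted s)
  nonneg _ _ := hq0 _
  le s ω := (le_abs_self _).trans (hq.bound _)
  integral_abs_sub_le s t hst := by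
    have hm := hX.measurable
    have hi : Integrable (fun ω => truncNorm (X t ω - X s ω)) P :=
      Integrable.of_bound (continuous_truncNorm.comp_aestronglyMeasurable
        ((hm t).sub (hm s)).aestronglyMeasurable) 1
        (ae_of_all _ fun ω => by simpa using abs_truncNorm_le_one _)
    calc _ ≤ ∫ ω, L * truncNorm (X t ω - X s ω) ∂P := by
          refine integral_mono_of_nonneg (ae_of_all _ fun _ => abs_nonneg _) (hi.const_mul L)
            (ae_of_all _ fun ω => hq.diff' _ _)
      _ ≤ _ := by
          rw [integral_const_mul, mul_assoc]
          exact mul_le_mul_of_nonneg_left (hX.integral_truncNorm_sub_le hα hα' hc0 hc hst)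
            hq.nonneg
  aemeasurable := by
    refine aemeasurable_of_continuousWithinAt_Ici
      (fun s => hq.continuous.measurable.comp (hX.measurable s)) ?_
    filter_upwards [hX.levy.cadlag] with ω hω s
    exact hq.continuous.continuousAt.comp_continuousWithinAt (hω s).1

end HighFreq.IsSymmetricStable

/-! ### Increments of Lévy processes -/

/-- Conditional expectation of a function of a measurable and an independent variable. -/
lemma condExp_comp_of_indep {Ω S T : Type*} {𝓜 mΩ : MeasurableSpace Ω} [MeasurableSpace S]
    [MeasurableSpace T] {μ : Measure Ω} [IsProbabilityMeasure μ] (hle : 𝓜 ≤ mΩ) {U : Ω → S}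
    {V : Ω → T} (hU : Measurable[𝓜] U) (hV : Measurable V)
    (hind : Indep 𝓜 (MeasurableSpace.comap V inferInstance) μ) {Φ : S → T → ℝ}
    (hΦ : Measurable (Function.uncurry Φ)) {K : ℝ} (hK : ∀ x y, |Φ x y| ≤ K) :
    μ[fun ω => Φ (U ω) (V ω) | 𝓜] =ᵐ[μ] fun ω => ∫ v, Φ (U ω) v ∂(μ.map V) := by
  have hU' : Measurable U := hU.mono hle le_rfl
  have hprob := Measure.isProbabilityMeasure_map (μ := μ) hV.aemeasurable
  have hG : StronglyMeasurable fun x => ∫ v, Φ x v ∂(μ.map V) :=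
    hΦ.stronglyMeasurable.integral_prod_right
  have hGK : ∀ x, |∫ v, Φ x v ∂(μ.map V)| ≤ K := fun x => abs_integral_le_of_abs_le (hK x)
  have hGi : Integrable (fun ω => ∫ v, Φ (U ω) v ∂(μ.map V)) μ :=
    Integrable.of_bound (hG.measurable.comp hU').aestronglyMeasurable K
      (ae_of_all _ fun ω => hGK _)
  refine (ae_eq_condExp_of_forall_setIntegral_eq hle (Integrable.of_bound
    (hΦ.comp (hU'.prodMk hV)).aestronglyMeasurable K (ae_of_all _ fun ω => hK _ _))
    (fun s _ _ => hGi.integrableOn) (fun s hs _ => ?_)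
    (hG.measurable.comp hU).stronglyMeasurable.aestronglyMeasurable).symm
  -- The indicator of the test set is adjoined to `U`. The pair is still `𝓜`-measurable, hence
  -- independent of `V`, and the set integral becomes an integral against a product law.
  set W : Ω → ℝ × S := fun ω => (s.indicator (fun _ => (1 : ℝ)) ω, U ω) with hW
  have hWm : Measurable[𝓜] W := by
    refine @Measurable.prodMk _ 𝓜 _ _ _ _ _ _ ?_ hU
    exact (@measurable_const _ _ _ 𝓜 (1 : ℝ)).indicator hs
  have hWm' : Measurable W := hWm.mono hle le_rfl
  have hWV : IndepFun W V μ := by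
    rw [IndepFun_iff_Indep]
    exact indep_of_indep_of_le_left hind hWm.comap_le
  have hprod := (indepFun_iff_map_prod_eq_prod_map_map hWm'.aemeasurable hV.aemeasurable).1 hWV
  have hprobW := Measure.isProbabilityMeasure_map (μ := μ) hWm'.aemeasurable
  -- The first coordinate is cut off to `[-1, 1]` only to keep `Ψ` bounded; the indicator takes the
  -- values `0` and `1`, so nothing changes along `W`.
  let Ψ : (ℝ × S) × T → ℝ := fun p => Set.indicator (Set.Icc (-1 : ℝ) 1) id p.1.1 * Φ p.1.2 p.2
  have hΨm : Measurable Ψ :=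
    ((measurable_id.indicator measurableSet_Icc).comp (measurable_fst.comp measurable_fst)).mul
      (hΦ.comp ((measurable_snd.comp measurable_fst).prodMk measurable_snd))
  have hind1 : ∀ x : ℝ, |Set.indicator (Set.Icc (-1 : ℝ) 1) id x| ≤ 1 := by
    intro x
    by_cases hx : x ∈ Set.Icc (-1 : ℝ) 1
    · rw [Set.indicator_of_mem hx]; exact abs_le.2 hx
    · rw [Set.indicator_of_notMem hx]; simp
  have hW1 : ∀ ω, Set.indicator (Set.Icc (-1 : ℝ) 1) id (W ω).1
      = s.indicator (fun _ => (1 : ℝ)) ω := by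
    intro ω
    refine Set.indicator_of_mem ?_ _
    by_cases hω : ω ∈ s <;> simp [hW, hω]
  have hΨi : Integrable Ψ ((μ.map W).prod (μ.map V)) := by
    refine Integrable.of_bound hΨm.aestronglyMeasurable K (ae_of_all _ fun p => ?_)
    rw [Real.norm_eq_abs, abs_mul]
    calc _ ≤ 1 * K := mul_le_mul (hind1 _) (hK _ _) (abs_nonneg _) zero_le_one
      _ = K := one_mul K
  have e1 : ∫ ω in s, Φ (U ω) (V ω) ∂μ = ∫ p, Ψ p ∂((μ.map W).prod (μ.map V)) := by
    rw [← hprod, integral_map (hWm'.prodMk hV).aemeasurable hΨm.aestronglyMeasurable,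
      ← integral_indicator (hle _ hs)]
    refine integral_congr_ae (ae_of_all _ fun ω => ?_)
    simp only [Ψ, hW1]
    by_cases hω : ω ∈ s <;> simp [hω, hW]
  have hΨl : StronglyMeasurable fun w => ∫ v, Ψ (w, v) ∂(μ.map V) :=
    hΨm.stronglyMeasurable.integral_prod_right'
  change ∫ ω in s, _ ∂μ = ∫ ω in s, Φ (U ω) (V ω) ∂μ
  rw [e1, integral_prod _ hΨi, integral_map hWm'.aemeasurable hΨl.aestronglyMeasurable,
    ← integral_indicator (hle _ hs)]
  refine integral_congr_ae (ae_of_all _ fun ω => ?_)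
  simp only [Ψ, hW1, integral_const_mul]
  by_cases hω : ω ∈ s <;> simp [hω, hW]

/-- The normalised increments of `X` along the grid of mesh `1 / n`. -/
noncomputable def scaledIncrement {Ω E : Type*} [NormedAddCommGroup E] [NormedSpace ℝ E] (a : ℝ)
    (X : ℝ≥0 → Ω → E) (n : ℕ) (ω : Ω) (l : ℕ) : E :=
  a • (X (gridTime n (l + 1)) ω - X (gridTime n l) ω)

lemma gridTime_mono (n : ℕ) : Monotone (gridTime n) := fun i j hij => by
  unfold gridTime; gcongr

lemma gridTime_add_one (n i : ℕ) : gridTime n (i + 1) = gridTime n i + gridTime n 1 := by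
  simp [gridTime, add_div]

namespace HighFreq.IsLevyProcess

variable {Ω E : Type*} [mΩ : MeasurableSpace Ω] [NormedAddCommGroup E] [NormedSpace ℝ E]
  [MeasurableSpace E] [BorelSpace E] [SecondCountableTopology E] {P : Measure Ω}
  [IsProbabilityMeasure P] {𝓕 : Filtration ℝ≥0 mΩ} {X : ℝ≥0 → Ω → E}

lemma measurable (hX : IsLevyProcess P 𝓕 X) (t : ℝ≥0) : Measurable (X t) :=
  (hX.adapted t).mono (𝓕.le t) le_rfl

lemma measurable_scaledIncrement_apply (hX : IsLevyProcess P 𝓕 X) (a : ℝ) (n l : ℕ) :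
    Measurable[𝓕 (gridTime n (l + 1))] fun ω => scaledIncrement a X n ω l := by
  have h1 := hX.adapted (gridTime n (l + 1))
  have h2 : Measurable[𝓕 (gridTime n (l + 1))] (X (gridTime n l)) :=
    (hX.adapted (gridTime n l)).mono (𝓕.mono (gridTime_mono n (Nat.le_succ l))) le_rfl
  exact (h1.sub h2).const_smul a

lemma measurable_scaledIncrement (hX : IsLevyProcess P 𝓕 X) (a : ℝ) (n : ℕ) :
    Measurable (scaledIncrement a X n) :=
  measurable_pi_lambda _ fun l =>
    (hX.measurable_scaledIncrement_apply a n l).mono (𝓕.le _) le_rfl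

/-- The past of an observation time and the subsequent increments are independent. -/
lemma iIndep_scaledIncrement (hX : IsLevyProcess P 𝓕 X) (a : ℝ) (n i : ℕ) :
    iIndep (fun k : ℕ => match k with
      | 0 => (𝓕 (gridTime n i) : MeasurableSpace Ω)
      | k + 1 => MeasurableSpace.comap (fun ω => scaledIncrement a X n ω (i + k)) inferInstance)
      P := by
  refine iIndep_of_indep_iSup_lt fun k => ?_
  match k with
  | 0 => simpa using indep_bot_right _
  | k + 1 =>
    have h1 := hX.indep_increments _ _ (gridTime_mono n (Nat.le_succ (i + k)))
    refine indep_of_indep_of_le h1 ?_ (iSup₂_le fun j hj => ?_)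
    · have : (fun ω => scaledIncrement a X n ω (i + k)) = (fun x : E => a • x) ∘
          fun ω => X (gridTime n (i + k).succ) ω - X (gridTime n (i + k)) ω := rfl
      change MeasurableSpace.comap (fun ω => scaledIncrement a X n ω (i + k)) _ ≤ _
      rw [this, ← MeasurableSpace.comap_comp]
      exact MeasurableSpace.comap_mono (measurable_const_smul a).comap_le
    · match j with
      | 0 => exact 𝓕.mono (gridTime_mono n (Nat.le_add_right i k))
      | j + 1 =>
        exact (hX.measurable_scaledIncrement_apply a n (i + j)).comap_le.trans
          (𝓕.mono (gridTime_mono n (by omega)))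

lemma map_scaledIncrement_apply (hX : IsLevyProcess P 𝓕 X) (a : ℝ) (n l : ℕ) :
    P.map (fun ω => scaledIncrement a X n ω l) = P.map fun ω => a • X (gridTime n 1) ω := by
  have hm := hX.measurable
  have h1 := hX.stationary_increments (gridTime n l) (gridTime n 1)
  rw [← gridTime_add_one] at h1
  have hs : Measurable fun x : E => a • x := measurable_const_smul a
  have hsub : Measurable fun ω => X (gridTime n (l + 1)) ω - X (gridTime n l) ω :=
    (hm _).sub (hm _)
  have h2 : P.map (fun ω => scaledIncrement a X n ω l)
      = (P.map fun ω => X (gridTime n (l + 1)) ω - X (gridTime n l) ω).map fun x => a • x := by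
    rw [Measure.map_map hs hsub]; rfl
  rw [h2, h1, Measure.map_map hs (hm _)]
  rfl

lemma map_scaledIncrement (hX : IsLevyProcess P 𝓕 X) (a : ℝ) (n : ℕ) :
    P.map (scaledIncrement a X n) = iidLaw (P.map fun ω => a • X (gridTime n 1) ω) := by
  have hm : ∀ l, Measurable fun ω => scaledIncrement a X n ω l := fun l =>
    (hX.measurable_scaledIncrement_apply a n l).mono (𝓕.le _) le_rfl
  -- The successor map drops the member of index `0`, the initial σ-algebra, and leaves the
  -- increments.
  have h1 := (hX.iIndep_scaledIncrement a n 0).precomp (g := Nat.succ) Nat.succ_injective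
  have h2 : iIndepFun (fun l ω => scaledIncrement a X n ω l) P := by
    rw [iIndepFun_iff_iIndep]
    simpa [Function.comp_def] using h1
  have h3 := (iIndepFun_iff_map_fun_eq_infinitePi_map hm).1 h2
  simp_rw [hX.map_scaledIncrement_apply] at h3
  exact h3

/-- The block starting at `i` is independent of the past up to `i / n`, while the position is known
at that time. Shift invariance of the i.i.d. law removes the index from the mean. -/
lemma condExp_eq_blockMean (hX : IsLevyProcess P 𝓕 X) (a : ℝ) (n i : ℕ) {m : ℕ}
    {g : E → (Fin (m + 1) → E) → ℝ} (hg : Measurable (Function.uncurry g)) {K : ℝ}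
    (hK : ∀ x y, |g x y| ≤ K) :
    P[fun ω => g (X (gridTime n i) ω) (seqBlock m i (scaledIncrement a X n ω)) | 𝓕 (gridTime n i)]
      =ᵐ[P] fun ω => blockMean (P.map fun ω => a • X (gridTime n 1) ω) g (X (gridTime n i) ω) := by
  have hy := hX.measurable_scaledIncrement a n
  have hV : Measurable fun ω => seqBlock m i (scaledIncrement a X n ω) :=
    (measurable_seqBlock m i).comp hy
  have hsm : Measurable fun ω => a • X (gridTime n 1) ω := (hX.measurable _).const_smul a
  have := Measure.isProbabilityMeasure_map (μ := P) hsm.aemeasurable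
  have hind : Indep (𝓕 (gridTime n i))
      (MeasurableSpace.comap (fun ω => seqBlock m i (scaledIncrement a X n ω)) inferInstance)
      P := by
    have h1 := hX.iIndep_scaledIncrement a n i
    have h2 := indep_iSup_of_disjoint (fun k => by
      match k with
      | 0 => exact 𝓕.le _
      | k + 1 => exact ((hX.measurable_scaledIncrement_apply a n (i + k)).mono (𝓕.le _)
          le_rfl).comap_le) h1 (S := {0}) (T := Set.Ici 1) (by simp)
    refine indep_of_indep_of_le h2 ?_ ?_
    · exact le_iSup₂_of_le 0 (by simp) le_rfl
    · refine Measurable.comap_le ((@measurable_pi_iff _ _ _ (_) _ _).2 fun k => ?_)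
      refine measurable_iff_comap_le.2 ?_
      exact le_iSup₂_of_le (k + 1 : ℕ) (by simp) le_rfl
  refine (condExp_comp_of_indep (𝓕.le _) (hX.adapted (gridTime n i)) hV hind hg hK).trans ?_
  refine ae_of_all _ fun ω => ?_
  have hgx : Measurable (g (X (gridTime n i) ω)) := hg.comp measurable_prodMk_left
  have e : P.map (fun ω => seqBlock m i (scaledIncrement a X n ω))
      = (iidLaw (P.map fun ω => a • X (gridTime n 1) ω)).map (seqBlock m i) := by
    rw [← hX.map_scaledIncrement, Measure.map_map (measurable_seqBlock m i) hy]
    rfl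
  simp only
  rw [e, integral_map (measurable_seqBlock m i).aemeasurable hgx.aestronglyMeasurable, blockMean,
    ← integral_shift i (F := fun y => g (X (gridTime n i) ω) (seqBlock m 0 y))
      (hgx.comp (measurable_seqBlock m 0))]
  simp_rw [seqBlock_shift, add_zero]

lemma walk_scaledIncrement (hX : IsLevyProcess P 𝓕 X) {a : ℝ} (ha : a ≠ 0) (n : ℕ) :
    ∀ᵐ ω ∂P, ∀ i, walk a⁻¹ i (scaledIncrement a X n ω) = X (gridTime n i) ω := by
  filter_upwards [hX.zero] with ω hω i
  unfold walk scaledIncrement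
  rw [← Finset.smul_sum, smul_smul, inv_mul_cancel₀ ha, one_smul,
    Finset.sum_range_sub fun l => X (gridTime n l) ω]
  simp [gridTime, hω]

end HighFreq.IsLevyProcess

/-- The statistic is a partial sum along a random walk. -/
lemma statZ_ae_eq_partialSum {Ω : Type*} [mΩ : MeasurableSpace Ω] {d m : ℕ} {P : Measure Ω}
    [IsProbabilityMeasure P] {𝓕 : Filtration ℝ≥0 mΩ} {a : ℕ → ℝ}
    {g : EuclideanSpace ℝ (Fin d) → (Fin (m + 1) → EuclideanSpace ℝ (Fin d)) → ℝ}
    {X : ℝ≥0 → Ω → EuclideanSpace ℝ (Fin d)} (hX : IsLevyProcess P 𝓕 X)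
    (hg : Measurable (Function.uncurry g)) {K : ℝ} (hK : ∀ x y, |g x y| ≤ K) {n : ℕ}
    (ha : a n ≠ 0) (t : ℝ≥0) :
    statZ P 𝓕 a g X n t =ᵐ[P] fun ω => partialSum
      (fun x y => g x y - blockMean (P.map fun ω => a n • X (gridTime n 1) ω) g x)
      (a n)⁻¹ (√n)⁻¹ ⌊(n : ℝ≥0) * t⌋₊ (scaledIncrement (a n) X n ω) := by
  have hce := ae_all_iff.2 fun i => hX.condExp_eq_blockMean (a n) n i hg hK
  filter_upwards [hce, hX.walk_scaledIncrement ha n] with ω h1 h2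
  unfold statZ partialSum
  congr 1
  refine Finset.sum_congr rfl fun i _ => ?_
  rw [h2 i]
  exact congrArg₂ _ rfl (h1 i)

/-! ### Comparison of the statistic with the mixed Gaussian limit -/

lemma floor_mul_inv_sqrt_sq_le (n : ℕ) (t : ℝ≥0) :
    (⌊(n : ℝ≥0) * t⌋₊ : ℝ) * ((√n)⁻¹) ^ 2 ≤ t := by
  rw [inv_pow, Real.sq_sqrt (Nat.cast_nonneg n), ← div_eq_mul_inv]
  refine div_le_of_le_mul₀ (Nat.cast_nonneg n) t.2 ?_
  have h : ((⌊(n : ℝ≥0) * t⌋₊ : ℝ≥0)) ≤ (n : ℝ≥0) * t := Nat.floor_le (zero_le)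
  have h' : (⌊(n : ℝ≥0) * t⌋₊ : ℝ) ≤ (n : ℝ) * t := by exact_mod_cast h
  linarith [mul_comm (n : ℝ) t]

/-- Triangle inequality through the Gaussian mixture whose variance is the grid sum of `A`: the
Lindeberg bound handles one side, and the Riemann sum error, with smoothing 1-Lipschitz in the
variance, the other. -/
lemma smoothDist_statZ_le {Ω Ω' : Type*} [mΩ : MeasurableSpace Ω] [mΩ' : MeasurableSpace Ω']
    {d m : ℕ} {P : Measure Ω} [IsProbabilityMeasure P] {P' : Measure Ω'} {𝓕 : Filtration ℝ≥0 mΩ}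
    {a : ℕ → ℝ}
    {g h : EuclideanSpace ℝ (Fin d) → (Fin (m + 1) → EuclideanSpace ℝ (Fin d)) → ℝ}
    {X : ℝ≥0 → Ω → EuclideanSpace ℝ (Fin d)} {ν : Measure (EuclideanSpace ℝ (Fin d))}
    [IsProbabilityMeasure ν] {K L D M ε : ℝ} {n : ℕ} {t : ℝ≥0} {Y : Ω' → ℝ}
    (hX : IsLevyProcess P 𝓕 X) (hg : Measurable (Function.uncurry g)) (hK : ∀ x y, |g x y| ≤ K)
    (hn : 1 ≤ n) (ha : 1 ≤ a n) (hν : P.map (fun ω => a n • X (gridTime n 1) ω) = ν)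
    (hgh : (fun x y => g x y - blockMean ν g x) = h)
    (hh : IsCenteredKernel ν L h) (hL : 1 ≤ L) (hmL : (m : ℝ) ≤ L) (hL4 : gaussFourthMoment ≤ L)
    (htL : (t : ℝ) ≤ L) (hq : HasBoundedDiffs L (asympVar ν h))
    (hA : IsVarianceProcess P 𝓕 (fun s ω => asympVar ν h (X s ω)) M D)
    (hYm : AEMeasurable Y P')
    (hY : ∀ f, BoundedDerivs 2 f → ∫ ω, f 0 (Y ω) ∂P' = ∫ ω, gaussSmooth (f 0) 0
      (timeIntegral (fun s ω => asympVar ν h (X s ω)) t ω) ∂P)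
    (hε0 : 0 ≤ ε)
    (hε : ∀ f, BoundedDerivs 5 f → ∀ p, |∫ y, h (walk (a n)⁻¹ (p + m + m) y)
      (seqBlock m (p + m + m) y) * gaussSmooth (f 1) (partialSum h (a n)⁻¹ (√n)⁻¹ (p + m) y)
        (remVar (asympVar ν h) (a n)⁻¹ (√n)⁻¹ ⌊(n : ℝ≥0) * t⌋₊ (p + m + m + m + 1) y)
        ∂iidLaw ν| ≤ ε) :
    smoothDist (P.map (statZ P 𝓕 a g X n t)) (P'.map Y) ≤
      18 * L ^ 7 * ((√n)⁻¹ + ∫ x, truncNorm ((a n)⁻¹ • x) ∂ν + ε / (√n)⁻¹)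
        + (t * D + M) * (√n)⁻¹ := by
  have ha0 : a n ≠ 0 := (zero_lt_one.trans_le ha).ne'
  have hn0 : (0 : ℝ) < n := by exact_mod_cast hn
  have hr0 : 0 < (√(n : ℝ))⁻¹ := inv_pos.2 (Real.sqrt_pos.2 hn0)
  have hr1 : (√(n : ℝ))⁻¹ ≤ 1 :=
    inv_le_one_of_one_le₀ (Real.one_le_sqrt.2 (by exact_mod_cast hn))
  have hgrid := hA.integral_abs_grid_sum_sub_timeIntegral_le t hn
  have hgrid0 : 0 ≤ (t * D + M) * (√(n : ℝ))⁻¹ :=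
    (integral_nonneg fun ω => abs_nonneg _).trans hgrid
  have hκ0 : 0 ≤ ∫ x, truncNorm ((a n)⁻¹ • x) ∂ν :=
    integral_nonneg fun x => le_min zero_le_one (norm_nonneg _)
  -- A real supremum may take the default value `0`, so the bound itself must be shown nonnegative.
  refine Real.iSup_le (fun ψ => ?_) (by positivity)
  obtain ⟨ψ, hψ⟩ := ψ
  have hf := testClass.boundedDerivs hψ
  set f : ℕ → ℝ → ℝ := fun l => iteratedDeriv l ψ with hfdef
  have hf0 : f 0 = ψ := iteratedDeriv_zero
  have hψc : Continuous ψ := hψ.1.continuous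
  have hψb : ∀ x, |ψ x| ≤ 1 := fun x => by simpa [hf0] using hf.bound 0 (by norm_num) x
  have hy := hX.measurable_scaledIncrement (a n) n
  have hmap := hX.map_scaledIncrement (a n) n
  rw [hν] at hmap
  have hae := statZ_ae_eq_partialSum hX hg hK ha0 t
  rw [hν, hgh] at hae
  have hps := measurable_partialSum hh.measurable (a n)⁻¹ (√(n : ℝ))⁻¹ ⌊(n : ℝ≥0) * t⌋₊
  have hZm : AEMeasurable (statZ P 𝓕 a g X n t) P := ⟨_, hps.comp hy, hae⟩
  have e1 : ∫ x, ψ x ∂(P.map (statZ P 𝓕 a g X n t)) = ∫ y, f 0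
      (partialSum h (a n)⁻¹ (√n)⁻¹ ⌊(n : ℝ≥0) * t⌋₊ y) ∂iidLaw ν := by
    rw [integral_map hZm hψc.aestronglyMeasurable, ← hmap, integral_map hy.aemeasurable
      (hf0 ▸ hψc.measurable.comp hps).aestronglyMeasurable, hf0]
    exact integral_congr_ae (hae.mono fun ω hω => congrArg ψ hω)
  have e2 : ∫ x, ψ x ∂(P'.map Y) = ∫ ω, gaussSmooth ψ 0
      (timeIntegral (fun s ω => asympVar ν h (X s ω)) t ω) ∂P := by
    rw [integral_map hYm hψc.aestronglyMeasurable, ← hf0]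
    exact hY f (hf.mono (by norm_num))
  have hqc := hq.continuous
  have hgsc : Continuous fun v => gaussSmooth ψ 0 v :=
    (continuous_gaussSmooth hψc hψb).comp (continuous_const.prodMk continuous_id)
  have hrv := measurable_remVar hqc.measurable (a n)⁻¹ (√(n : ℝ))⁻¹ ⌊(n : ℝ≥0) * t⌋₊ 0
  set G : Ω → ℝ := fun ω => (n : ℝ)⁻¹ * ∑ j ∈ Finset.range ⌊(n : ℝ≥0) * t⌋₊,
    asympVar ν h (X (gridTime n j) ω) with hG
  have hGm : Measurable G := (Finset.measurable_fun_sum _ fun j _ =>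
    hqc.measurable.comp (hX.measurable _)).const_mul _
  have hG0 : ∀ ω, 0 ≤ G ω := fun ω =>
    mul_nonneg (inv_nonneg.2 hn0.le) (Finset.sum_nonneg fun j _ => hA.nonneg _ ω)
  have e3 : ∫ y, gaussSmooth (f 0) 0
      (remVar (asympVar ν h) (a n)⁻¹ (√n)⁻¹ ⌊(n : ℝ≥0) * t⌋₊ 0 y) ∂iidLaw ν
      = ∫ ω, gaussSmooth ψ 0 (G ω) ∂P := by
    rw [← hmap, integral_map hy.aemeasurable
      (hf0 ▸ hgsc.measurable.comp hrv).aestronglyMeasurable, hf0]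
    refine integral_congr_ae ((hX.walk_scaledIncrement ha0 n).mono fun ω hω => ?_)
    simp only [remVar, hω, hG, inv_pow, Real.sq_sqrt hn0.le, Finset.range_eq_Ico]
  have h1 := hh.abs_integral_partialSum_sub_le hL hmL hL4 hq hf hr0 hr1
    ((floor_mul_inv_sqrt_sq_le n t).trans htL) (hε f hf)
  rw [e3] at h1
  have hTi := hA.integrable_timeIntegral t.2
  have hi1 : Integrable (fun ω => gaussSmooth ψ 0 (G ω)) P :=
    Integrable.of_bound (hgsc.measurable.comp hGm).aestronglyMeasurable 1
      (ae_of_all _ fun ω => abs_gaussSmooth_le hψb _ _)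
  have hi2 : Integrable (fun ω => gaussSmooth ψ 0
      (timeIntegral (fun s ω => asympVar ν h (X s ω)) t ω)) P :=
    Integrable.of_bound (hgsc.comp_aestronglyMeasurable hTi.aestronglyMeasurable) 1
      (ae_of_all _ fun ω => abs_gaussSmooth_le hψb _ _)
  have hGi : Integrable G P := by
    refine (integrable_finsetSum _ fun j _ => ?_).const_mul _
    exact Integrable.of_bound (hqc.measurable.comp (hX.measurable _)).aestronglyMeasurable L
      (ae_of_all _ fun ω => hq.bound _)
  have h2 : |∫ ω, gaussSmooth ψ 0 (G ω) ∂P - ∫ ω, gaussSmooth ψ 0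
      (timeIntegral (fun s ω => asympVar ν h (X s ω)) t ω) ∂P| ≤ (t * D + M) * (√n)⁻¹ := by
    rw [← integral_sub hi1 hi2]
    refine (abs_integral_le_integral_abs).trans (le_trans ?_ hgrid)
    refine integral_mono (hi1.sub hi2).abs (hGi.sub hTi).abs fun ω => ?_
    have := (hf.mono (by norm_num : 2 ≤ 5)).abs_gaussSmooth_sub_le 0
      (hA.timeIntegral_nonneg t.2 ω) (hG0 ω)
    rwa [hf0] at this
  simp only
  rw [e1, e2]
  exact (abs_sub_le _ _ _).trans (add_le_add h1 h2)

lemma HighFreq.IsSymmetricStable.covFun_eq {Ω : Type*} [mΩ : MeasurableSpace Ω] {d m : ℕ}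
    {P : Measure Ω} [IsProbabilityMeasure P] {𝓕 : Filtration ℝ≥0 mΩ} {α K : ℝ}
    {X : ℝ≥0 → Ω → EuclideanSpace ℝ (Fin d)} (hX : IsSymmetricStable P 𝓕 α X) (hα : 0 < α)
    {g : EuclideanSpace ℝ (Fin d) → (Fin (m + 1) → EuclideanSpace ℝ (Fin d)) → ℝ}
    (hg : Measurable (Function.uncurry g)) (hK : ∀ y, HasBoundedDiffs K fun x => g x y)
    {a : ℕ → ℝ} (ha : ∀ n, a n = (n : ℝ) ^ (1 / α)) {n : ℕ} (hn : 1 ≤ n)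
    (x : EuclideanSpace ℝ (Fin d)) :
    covFun P a g X n x
      = asympVar (P.map (X 1)) (fun x y => g x y - blockMean (P.map (X 1)) g x) x := by
  have := Measure.isProbabilityMeasure_map (μ := P) (hX.measurable 1).aemeasurable
  unfold covFun
  rw [ha, hX.map_smul_eq hα hn]
  exact sum_covariance_eq_asympVar hg hK x

/-! ### The main theorem. -/

theorem theorem2p1 {Ω : Type u} [mΩ : MeasurableSpace Ω] (P : Measure Ω) [IsProbabilityMeasure P]
    (𝓕 : Filtration ℝ≥0 mΩ) (d m : ℕ) (α : ℝ) (hα : 0 < α) (hα' : α ≤ 2)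
    (X : ℝ≥0 → Ω → EuclideanSpace ℝ (Fin d)) (hX : IsSymmetricStable P 𝓕 α X)
    (g : EuclideanSpace ℝ (Fin d) → (Fin (m + 1) → EuclideanSpace ℝ (Fin d)) → ℝ)
    (hg : IsAdmissible g)
    (a : ℕ → ℝ) (ha : ∀ n, a n = (n : ℝ) ^ (1 / α)) :
    -- the process `A_s = 𝔤(X_s)` is well defined, and so is its square root
    (∀ x, Tendsto (fun n : ℕ => covFun P a g X n x) atTop (𝓝 (limCovFun P a g X x)) ∧
      0 ≤ limCovFun P a g X x) ∧
    -- `Y t` is the integral of `√A` with respect to `W` over `[0, t]`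
    ∃ (Ω' : Type u) (mΩ' : MeasurableSpace Ω') (P' : Measure Ω') (𝓖 : Filtration ℝ≥0 mΩ')
      (π : Ω' → Ω) (W : ℝ≥0 → Ω' → ℝ) (Y : ℝ≥0 → Ω' → ℝ),
      IsFilteredExtension P 𝓕 P' 𝓖 π ∧
      IsBrownianFor P' 𝓖 W ∧
      IndepFun (fun (ω : Ω') (t : ℝ≥0) => X t (π ω)) (fun (ω : Ω') (t : ℝ≥0) => W t ω) P' ∧
      (∀ t : ℝ≥0, IsItoIntegral P' 𝓖 W
        (fun s ω => Real.sqrt (limCovFun P a g X (X s (π ω)))) t (Y t)) ∧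
      ∀ t : ℝ≥0, 0 < t →
        (1 < α → α < 2 → ∃ C : ℝ, 0 < C ∧ ∀ n : ℕ, 1 ≤ n →
          smoothDist (P.map (statZ P 𝓕 a g X n t)) (P'.map (Y t)) ≤
            C * (n : ℝ) ^ (1 / 2 - 1 / α)) ∧
        (α = 1 → ∃ C : ℝ, 0 < C ∧ ∀ n : ℕ, 2 ≤ n →
          smoothDist (P.map (statZ P 𝓕 a g X n t)) (P'.map (Y t)) ≤
            C / Real.sqrt n * Real.log n) ∧
        (α < 1 → ∃ C : ℝ, 0 < C ∧ ∀ n : ℕ, 1 ≤ n →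
          smoothDist (P.map (statZ P 𝓕 a g X n t)) (P'.map (Y t)) ≤ C / Real.sqrt n) ∧
        (1 < α → (∀ x y, g x (-y) = g x y) → ∃ C : ℝ, 0 < C ∧ ∀ n : ℕ, 1 ≤ n →
          smoothDist (P.map (statZ P 𝓕 a g X n t)) (P'.map (Y t)) ≤ C / Real.sqrt n) := by
  obtain ⟨c, hc, hexp⟩ := hX.exponent
  obtain ⟨K, hK⟩ := hg.exists_hasBoundedDiffs
  set ν : Measure (EuclideanSpace ℝ (Fin d)) := P.map (X 1) with hν
  have hνp : IsProbabilityMeasure ν :=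
    Measure.isProbabilityMeasure_map (hX.measurable 1).aemeasurable
  obtain ⟨h, hh⟩ : ∃ h, (fun x y => g x y - blockMean ν g x) = h := ⟨_, rfl⟩
  have hck : IsCenteredKernel ν (K + K) h := hh ▸ isCenteredKernel_sub_blockMean hg.measurable hK
  set q := asympVar ν h with hq
  have hqB := hck.hasBoundedDiffs_asympVar
  have hq0 : ∀ x, 0 ≤ q x := hck.asympVar_nonneg
  -- The sequence is constant from `n = 1` on; at `n = 0` the scaling `a 0` degenerates to zero.
  have hcov : ∀ x, ∀ᶠ n : ℕ in atTop, covFun P a g X n x = q x := fun x =>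
    (eventually_ge_atTop 1).mono fun n hn => by
      rw [hX.covFun_eq hα hg.measurable hK ha hn, hq, ← hh]
  have htend : ∀ x, Tendsto (fun n : ℕ => covFun P a g X n x) atTop (𝓝 (q x)) := fun x =>
    tendsto_const_nhds.congr' ((hcov x).mono fun n hn => hn.symm)
  have hlim : ∀ x, limCovFun P a g X x = q x := fun x => (htend x).limUnder_eq
  simp only [hlim]
  refine ⟨fun x => ⟨htend x, hq0 x⟩, ?_⟩
  have hA := hX.isVarianceProcess_comp hα hα' hc.le hexp hqB hq0
  have hB := isBrownianReal_schauderMotion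
  choose Y hYI hYlaw using hA.exists_isItoIntegral measurable_schauderMotion hB.toIsPreBrownianReal
  refine ⟨Ω × (ℕ × ℕ → ℝ), inferInstance, P.prod gaussianSeqLaw,
    prodFiltration 𝓕 measurable_schauderMotion, Prod.fst, fun t p => schauderMotion t p.2, Y,
    isFilteredExtension_prodFiltration 𝓕 measurable_schauderMotion,
    isBrownianFor_prodFiltration 𝓕 measurable_schauderMotion hB, ?_, hYI, fun t ht => ?_⟩
  · exact indepFun_prod (X := fun ω t => X t ω) (Y := fun y t => schauderMotion t y)
      (measurable_pi_lambda _ hX.measurable) (measurable_pi_lambda _ measurable_schauderMotion)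
  -- A single `L` dominates every constant of the Lindeberg bound; it depends on `t` but not on `n`.
  obtain ⟨L, hL1, hmL, hL4, hKL, hqL, htL⟩ : ∃ L : ℝ, 1 ≤ L ∧ (m : ℝ) ≤ L ∧ gaussFourthMoment ≤ L ∧
      K + K ≤ L ∧ (2 * m + 1) * (4 * (K + K) ^ 2) ≤ L ∧ (t : ℝ) ≤ L := by
    obtain ⟨L, hL⟩ := (([1, (m : ℝ), gaussFourthMoment, K + K,
      (2 * m + 1) * (4 * (K + K) ^ 2), (t : ℝ)] : List ℝ).toFinset).exists_le
    exact ⟨L, by simpa using hL⟩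
  have hckL : IsCenteredKernel ν L h :=
    ⟨hck.measurable, fun y => (hck.hasBoundedDiffs y).mono hKL, hck.integral_eq_zero⟩
  have hqBL : HasBoundedDiffs L q := hqB.mono hqL
  have hgK : ∀ x y, |g x y| ≤ K := fun x y => (hK y).bound x
  set κ : ℕ → ℝ := fun n => ∫ x, truncNorm ((a n)⁻¹ • x) ∂ν with hκ
  have hκ0 : ∀ n, 0 ≤ κ n := fun n => integral_nonneg fun x => truncNorm_nonneg _
  set A : ℝ := 6 * d * c with hAdef
  have hA0 : 0 ≤ A := by positivity
  have htr : ∀ b, 0 ≤ b → ∫ x, truncNorm (b • x) ^ 2 ∂ν ≤ A * b ^ α := fun b hb =>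
    (hX.integral_truncNorm_smul_sq_le hα hα' hc.le hexp 1 hb).trans_eq (by simp [hAdef]; ring)
  have ha1 : ∀ n : ℕ, 1 ≤ n → 1 ≤ a n := fun n hn => by
    rw [ha]; exact Real.one_le_rpow (by exact_mod_cast hn) (by positivity)
  have hb0 : ∀ n : ℕ, 1 ≤ n → 0 < (a n)⁻¹ := fun n hn => inv_pos.2 (zero_lt_one.trans_le (ha1 n hn))
  have hbα : ∀ n : ℕ, ((a n)⁻¹) ^ α = (n : ℝ)⁻¹ := fun n => by
    rw [ha, Real.inv_rpow (by positivity), ← Real.rpow_mul (Nat.cast_nonneg n),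
      one_div_mul_cancel hα.ne', Real.rpow_one]
  have hκ2 : ∀ n : ℕ, 1 ≤ n → ∫ x, truncNorm ((a n)⁻¹ • x) ^ 2 ∂ν ≤ A * (n : ℝ)⁻¹ := fun n hn => by
    rw [← hbα]; exact htr _ (hb0 n hn).le
  obtain ⟨D, hD0, hdist⟩ : ∃ D : ℝ, 0 ≤ D ∧ ∀ n : ℕ, 1 ≤ n → ∀ ε, 0 ≤ ε →
      (∀ f, BoundedDerivs 5 f → ∀ p, |∫ y, h (walk (a n)⁻¹ (p + m + m) y)
        (seqBlock m (p + m + m) y) * gaussSmooth (f 1) (partialSum h (a n)⁻¹ (√n)⁻¹ (p + m) y)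
          (remVar q (a n)⁻¹ (√n)⁻¹ ⌊(n : ℝ≥0) * t⌋₊ (p + m + m + m + 1) y)
          ∂iidLaw ν| ≤ ε) →
      smoothDist (P.map (statZ P 𝓕 a g X n t)) ((P.prod gaussianSeqLaw).map (Y t)) ≤
        D * ((√n)⁻¹ + κ n + ε * √n) := by
    refine ⟨18 * L ^ 7 + |t * ((2 * m + 1) * (4 * (K + K) ^ 2) * √(6 * d * c))
      + (2 * m + 1) * (4 * (K + K) ^ 2)|, by positivity, fun n hn ε hε0 hε => ?_⟩
    have hlaw : P.map (fun ω => a n • X (gridTime n 1) ω) = ν := by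
      rw [ha]; exact hX.map_smul_eq hα hn
    refine (smoothDist_statZ_le hX.levy hg.measurable hgK hn (ha1 n hn) hlaw hh hckL hL1 hmL hL4
      htL hqBL hA (hYI t).memLp.aestronglyMeasurable.aemeasurable (hYlaw t) hε0 hε).trans ?_
    rw [div_inv_eq_mul, add_mul (18 * L ^ 7)]
    have hr0 : 0 ≤ (√(n : ℝ))⁻¹ := by positivity
    refine add_le_add le_rfl (mul_le_mul (le_abs_self _) ?_ hr0 (abs_nonneg _))
    have := mul_nonneg hε0 (Real.sqrt_nonneg n)
    linarith [hκ0 n]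
  have hN : ∀ n : ℕ, (⌊(n : ℝ≥0) * t⌋₊ : ℝ) * ((√n)⁻¹) ^ 2 ≤ L := fun n =>
    (floor_mul_inv_sqrt_sq_le n t).trans htL
  have hsqrt : ∀ n : ℕ, √(n : ℝ) * (n : ℝ)⁻¹ = (√n)⁻¹ := fun n => by
    rw [← div_eq_mul_inv, Real.sqrt_div_self]
  -- Without symmetry the first-order error per step is of order `κ n`, so `√n κ n` governs the rate
  -- and the three ranges of `α` differ only in the size of `κ n`.
  obtain ⟨D₁, hD₁, hgen⟩ : ∃ D₁ : ℝ, 0 ≤ D₁ ∧ ∀ n : ℕ, 1 ≤ n →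
      smoothDist (P.map (statZ P 𝓕 a g X n t)) ((P.prod gaussianSeqLaw).map (Y t)) ≤
        D₁ * ((√n)⁻¹ + κ n * √n) := by
    refine ⟨D * (1 + L ^ 3 * (m + 1)), by positivity, fun n hn => ?_⟩
    refine (hdist n hn (L ^ 3 * ((m + 1) * κ n)) (mul_nonneg (by positivity)
      (mul_nonneg (by positivity) (hκ0 n))) fun f hf p => ?_).trans ?_
    · exact hckL.abs_integral_first_order_le (f := fun l => f (l + 1)) hqBL
        (hf.shift (by norm_num)) (hN n) le_rfl
    · rw [mul_assoc D]
      refine mul_le_mul_of_nonneg_left ?_ hD0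
      have h1 : κ n ≤ κ n * √n := le_mul_of_one_le_right (hκ0 n)
        (Real.one_le_sqrt.2 (by exact_mod_cast hn))
      have h2 : 0 ≤ L ^ 3 * (m + 1) * (√(n : ℝ))⁻¹ := by positivity
      nlinarith
  refine ⟨fun h1 _ => ?_, fun h1 => ?_, fun h1 => ?_, fun h1 hev => ?_⟩
  · obtain ⟨C, hC⟩ : ∃ C : ℝ, ∀ n : ℕ, 1 ≤ n → κ n ≤ C * (a n)⁻¹ :=
      ⟨_, fun n hn => integral_truncNorm_le_of_one_lt h1 htr (hb0 n hn)
        (inv_le_one_of_one_le₀ (ha1 n hn))⟩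
    -- The `+ 1` makes the constant strictly positive.
    refine ⟨D₁ * (1 + |C|) + 1, by positivity, fun n hn => (hgen n hn).trans ?_⟩
    have hn0 : (0 : ℝ) < n := by exact_mod_cast hn
    have hn1 : (1 : ℝ) ≤ n := by exact_mod_cast hn
    set u : ℝ := (n : ℝ) ^ (1 / 2 - 1 / α) with hu
    have hu0 : 0 ≤ u := by positivity
    have e1 : (√(n : ℝ))⁻¹ ≤ u := by
      rw [Real.sqrt_eq_rpow, ← Real.rpow_neg hn0.le]
      refine Real.rpow_le_rpow_of_exponent_le hn1 ?_
      have : 1 / α ≤ 1 := (div_le_one hα).2 h1.le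
      linarith
    have e2 : (a n)⁻¹ * √n = u := by
      rw [hu, ha, Real.sqrt_eq_rpow, ← Real.rpow_neg hn0.le, ← Real.rpow_add hn0]
      congr 1; ring
    have e3 : κ n * √n ≤ |C| * u := by
      rw [← e2, ← mul_assoc]
      exact mul_le_mul_of_nonneg_right ((hC n hn).trans
        (mul_le_mul_of_nonneg_right (le_abs_self C) (hb0 n hn).le)) (Real.sqrt_nonneg _)
    nlinarith [mul_le_mul_of_nonneg_left (add_le_add e1 e3) hD₁]
  · have han : ∀ n : ℕ, a n = n := fun n => by rw [ha, h1]; simp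
    obtain ⟨C, hC⟩ : ∃ C : ℝ, ∀ n : ℕ, 2 ≤ n → κ n ≤ C * (Real.log n / n) :=
      ⟨_, fun n hn => by
        simp only [hκ, han]
        exact integral_truncNorm_le_of_eq_one (fun b hb => by
          simpa [h1] using htr b hb) hn⟩
    have hlog2 := Real.log_pos one_lt_two
    refine ⟨D₁ * ((Real.log 2)⁻¹ + |C|) + 1, by positivity,
      fun n hn => (hgen n (by omega)).trans ?_⟩
    have hn2 : (2 : ℝ) ≤ n := by exact_mod_cast hn
    have hlog : Real.log 2 ≤ Real.log n := Real.log_le_log two_pos hn2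
    have hr0 : 0 ≤ (√(n : ℝ))⁻¹ := by positivity
    set u : ℝ := (√(n : ℝ))⁻¹ * Real.log n with hu
    have hu0 : 0 ≤ u := mul_nonneg hr0 (hlog2.le.trans hlog)
    have e1 : (√(n : ℝ))⁻¹ ≤ (Real.log 2)⁻¹ * u := by
      rw [hu, mul_left_comm]
      refine le_mul_of_one_le_right hr0 ?_
      rw [inv_mul_eq_div]
      exact (one_le_div hlog2).2 hlog
    have e3 : κ n * √n ≤ |C| * u := by
      have hl : 0 ≤ Real.log n / n := div_nonneg (hlog2.le.trans hlog) (Nat.cast_nonneg n)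
      calc κ n * √n ≤ |C| * (Real.log n / n) * √n := mul_le_mul_of_nonneg_right ((hC n hn).trans
            (mul_le_mul_of_nonneg_right (le_abs_self C) hl)) (Real.sqrt_nonneg _)
        _ = |C| * (√(n : ℝ) * (n : ℝ)⁻¹ * Real.log n) := by ring
        _ = |C| * u := by rw [hsqrt]
    have e4 : (D₁ * ((Real.log 2)⁻¹ + |C|) + 1) / √n * Real.log n
        = (D₁ * ((Real.log 2)⁻¹ + |C|) + 1) * u := by rw [hu]; ring
    rw [e4]
    nlinarith [mul_le_mul_of_nonneg_left (add_le_add e1 e3) hD₁]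
  · obtain ⟨C, hC⟩ : ∃ C : ℝ, ∀ n : ℕ, 1 ≤ n → κ n ≤ C * (n : ℝ)⁻¹ :=
      ⟨_, fun n hn => (integral_truncNorm_le_of_lt_one h1 htr (hb0 n hn).le).trans_eq
        (by rw [hbα])⟩
    refine ⟨D₁ * (1 + |C|) + 1, by positivity, fun n hn => (hgen n hn).trans ?_⟩
    have hr0 : 0 ≤ (√(n : ℝ))⁻¹ := by positivity
    have e3 : κ n * √n ≤ |C| * (√(n : ℝ))⁻¹ := by
      rw [← hsqrt, mul_comm √(n : ℝ), ← mul_assoc]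
      exact mul_le_mul_of_nonneg_right ((hC n hn).trans
        (mul_le_mul_of_nonneg_right (le_abs_self C) (by positivity))) (Real.sqrt_nonneg _)
    rw [div_eq_mul_inv]
    nlinarith [mul_le_mul_of_nonneg_left e3 hD₁]
  · have hevh : ∀ x y, h x (-y) = h x y := fun x y => by rw [← hh]; simp only [hev]
    refine ⟨D * (1 + √A + 3 * L ^ 6 * ((m + 1) * ((m + 1) * A))) + 1, by positivity,
      fun n hn => ?_⟩
    refine (hdist n hn (3 * L ^ 6 * ((m + 1) * ((m + 1) * (A * (n : ℝ)⁻¹)))) (by positivity)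
      fun f hf p => ?_).trans ?_
    · refine (hckL.abs_integral_first_order_le_of_even (f := fun l => f (l + 1)) hL1 hL4 hqBL
        (hf.shift (by norm_num)) (hN n) le_rfl (hX.map_neg_eq 1) hevh).trans ?_
      have := hκ2 n hn
      gcongr
    · have hr0 : 0 ≤ (√(n : ℝ))⁻¹ := by positivity
      -- In the even case `κ n` occurs only undivided by `r`, so the Cauchy–Schwarz bound `O(1 /
      -- √n)` is enough.
      have e1 : κ n ≤ √A * (√(n : ℝ))⁻¹ := by
        refine (integral_truncNorm_le_sqrt (measurable_const_smul (a n)⁻¹)).trans ?_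
        rw [← Real.sqrt_inv, ← Real.sqrt_mul hA0]
        exact Real.sqrt_le_sqrt (hκ2 n hn)
      have e2 : 3 * L ^ 6 * ((m + 1) * ((m + 1) * (A * (n : ℝ)⁻¹))) * √n
          = 3 * L ^ 6 * ((m + 1) * ((m + 1) * A)) * (√(n : ℝ))⁻¹ := by
        rw [← hsqrt]; ring
      rw [e2, div_eq_mul_inv]
      nlinarith [mul_le_mul_of_nonneg_left e1 hD0]
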